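/- Let $k$ be a field of characteristic $0$, let $A$ be a unital associative (not necessarily commutative) $k$-algebra, let $n\ge 3$ and $I=\{1,\dots,n-1\}$. Put $L=\mathfrak{sl}_n(A)=[\mathfrak{gl}_n(A),\mathfrak{gl}_n(A)]$ and $\mathfrak g=\mathfrak{sl}_n(k)\subset L$, let $\mathfrak h\subset\mathfrak g$ be the space of diagonal matrices of trace zero, and let $\varepsilon_i\in\mathfrak h^*$ be the $i$-th diagonal entry. Let $\Delta_+=\{\varepsilon_i-\varepsilon_j : i<j\}$, let $\alpha_i=\varepsilon_i-\varepsilon_{i+1}$ and $h_i=E_{ii}-E_{i+1,i+1}$ for $i\in I$, and define $\varpi_i\in\mathfrak h^*$ by $\varpi_i(h_j)=\delta_{ij}$. For $\beta\in\mathfrak h^*$ let $L_\beta=\{x\in L : [h,x]=\beta(h)x \text{ for all } h\in\mathfrak h\}$, and put $L_\pm=\bigoplus_{\beta\in\Delta_+}L_{\pm\beta}$, so that $L=L_-\oplus L_0\oplus L_+$. Let $U(L)_0$ be the centralizer of $\mathfrak h$ in the universal enveloping algebra $U(L)$, and let $\pi_0\colon U(L)_0=U(L_0)\oplus\big(U(L)L_+\cap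 U(L)_0\big)\to U(L_0)$ be the projection (the Harish-Chandra homomorphism). For a dominant weight $\lambda=\sum_{i\in I}\ell_i\varpi_i$ with $\ell_i\in\mathbb N=\{0,1,2,\dots\}$, the Seligman algebra is $S^\lambda=U(L_0)/J^\lambda$, where $J^\lambda$ is the two-sided ideal generated by the following elements, for all $i\in I$: (i) $\pi_0(x_1\cdots x_m\,y_1\cdots y_{\ell_i+1})$, where $x_j\in L_{\beta_j}$ with $\beta_j\in\Delta_+$ and $\sum_{j=1}^m\beta_j=(\ell_i+1)\alpha_i$, and $y_j\in L_{-\alpha_i}$; (ii) $h_i-\ell_i\cdot 1$. For $\ell\in\mathbb N$ let $TS^\ell(A)$ be the subalgebra of $A^{\otimes\ell}$ (tensor product over $k$, with componentwise multiplication) formed by the tensors fixed by all permutations of the $\ell$ factors; in particular $TS^0(A)=k$. **Theorem.** Suppose that the support of $\lambda$ is totally disconnected, that is, there is no $i$ with $1\le i<n-1$, $\ell_i>0$ and $\ell_{i+1}>0$. Put $B_1=TS^{\ell_1}(A)$ and $B_{n-1}=TS^{\ell_{n-1}}(A^{\mathrm{op}})$ and, for $1<i<n-1$, $B_i=TS^{\ell_i}(A)/\mathcal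 C_i$, where $\mathcal C_i$ is the two-sided ideal of $TS^{\ell_i}(A)$ generated by all commutators $xy-yx$ with $x,y\in TS^{\ell_i}(A)$. Then $$S^\lambda\;\cong\;\bigotimes_{i\in I}B_i$$ as unital associative $k$-algebras, where the right-hand side is the tensor product of algebras over $k$. -/

import Mathlib

open scoped TensorProduct

noncomputable section

namespace SeligmanAlg

universe u v

attribute [local instance 100] LieRing.ofAssociativeRing

/-! ### Symmetric tensor algebras -/

section SymmetricTensors

variable (K : Type u) [Field K] (A : Type v) [Ring A] [Algebra K A] (l : ℕ)

theorem reindex_mul (s : Equiv.Perm (Fin l)) (x y : ⨂[K] _ : Fin l, A) :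
    PiTensorProduct.reindex K (fun _ : Fin l => A) s (x * y) =
      PiTensorProduct.reindex K (fun _ : Fin l => A) s x *
        PiTensorProduct.reindex K (fun _ : Fin l => A) s y := by
  induction x using PiTensorProduct.induction_on with
  | smul_tprod r f =>
    induction y using PiTensorProduct.induction_on with
    | smul_tprod r' g =>
      simp only [smul_mul_smul_comm, map_smul, PiTensorProduct.tprod_mul_tprod,
        PiTensorProduct.reindex_tprod]
      rfl
    | add a b ha hb => simp only [mul_add, map_add, ha, hb]
  | add a b ha hb => simp only [add_mul, map_add, ha, hb]

/-- `TS^l(A)`: the subalgebra of the tensors in `A ⊗ ⋯ ⊗ A` (`l` factors, componentwise product)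
that are fixed by all permutations of the factors.  For `l = 0` it is the base field. -/
def symTensors : Subalgebra K (⨂[K] _ : Fin l, A) where
  carrier := {t | ∀ s : Equiv.Perm (Fin l),
    PiTensorProduct.reindex K (fun _ : Fin l => A) s t = t}
  mul_mem' := by
    intro a b ha hb s
    rw [reindex_mul, ha s, hb s]
  add_mem' := by
    intro a b ha hb s
    rw [map_add, ha s, hb s]
  algebraMap_mem' := by
    intro r s
    rw [Algebra.algebraMap_eq_smul_one, map_smul, PiTensorProduct.one_def,
      PiTensorProduct.reindex_tprod]
    rfl

/-- The two-sided ideal of an algebra generated by all commutators `x * y - y * x`. -/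
def commutatorIdeal (B : Type*) [Ring B] : TwoSidedIdeal B :=
  TwoSidedIdeal.span {c | ∃ x y : B, c = x * y - y * x}

/-- `TS^l(A)` modulo the ideal generated by its commutators. -/
abbrev SymTensorsAb : Type (max u v) :=
  (commutatorIdeal (symTensors K A l)).ringCon.Quotient

end SymmetricTensors

/-! ### Seligman algebras

`L` is a Lie algebra, `τ : T → L` embeds the splitting Cartan subalgebra of the grading subalgebra.
Weights are linear forms on `T`, `pos` is the set of positive roots, `α i` are the simple roots and
`h i ∈ T` the simple coroots. -/

section Seligman

variable {K : Type u} [Field K] {L : Type*} [LieRing L] [LieAlgebra K L]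
variable {T : Type*} [AddCommGroup T] [Module K T] (τ : T →ₗ[K] L)

/-- The weight space `L_β = {x : [t, x] = β(t) x for all t}`. -/
def weightSpace (β : Module.Dual K T) : Submodule K L where
  carrier := {x | ∀ t : T, ⁅τ t, x⁆ = β t • x}
  zero_mem' := by intro t; simp
  add_mem' := by
    intro x y hx hy t
    rw [lie_add, hx t, hy t, smul_add]
  smul_mem' := by
    intro c x hx t
    rw [lie_smul, hx t, smul_comm]

/-- The weight space of weight zero, as a Lie subalgebra `L₀` of `L`. -/
def zeroPart : LieSubalgebra K L where
  __ := weightSpace τ 0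
  lie_mem' := by
    intro x y hx hy t
    have hx' : ⁅τ t, x⁆ = 0 := by simpa using hx t
    have hy' : ⁅τ t, y⁆ = 0 := by simpa using hy t
    rw [leibniz_lie, hx', hy']
    simp

/-- `L₊`, the sum of the weight spaces of the positive roots. -/
def posPart (pos : Set (Module.Dual K T)) : Submodule K L :=
  ⨆ β ∈ pos, weightSpace τ β

/-- The canonical homomorphism `U(L₀) → U(L)`. -/
def envelopingIncl :
    UniversalEnvelopingAlgebra K (zeroPart τ) →ₐ[K] UniversalEnvelopingAlgebra K L :=
  UniversalEnvelopingAlgebra.lift K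
    ((UniversalEnvelopingAlgebra.ι K).comp (zeroPart τ).incl)

/-- `U(L)₀`, the weight space of weight zero of `U(L)` under the adjoint action of the Cartan
subalgebra. -/
def envelopingZero : Subalgebra K (UniversalEnvelopingAlgebra K L) :=
  Subalgebra.centralizer K (Set.range fun t : T => UniversalEnvelopingAlgebra.ι K (τ t))

/-- `u ∈ U(L₀)` is the image of `z ∈ U(L)₀` under the Harish-Chandra homomorphism, that is, under
the projection `U(L)₀ = U(L₀) ⊕ (U(L) L₊ ∩ U(L)₀) → U(L₀)`; for a root-graded `L` such a `u` exists
and is unique by the Poincaré–Birkhoff–Witt theorem.  (`Ideal.span` is the left ideal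
generated by a set.) -/
def IsHarishChandraImage (pos : Set (Module.Dual K T)) (z : UniversalEnvelopingAlgebra K L)
    (u : UniversalEnvelopingAlgebra K (zeroPart τ)) : Prop :=
  z ∈ envelopingZero τ ∧
    z - envelopingIncl τ u ∈ envelopingZero τ ∧
    z - envelopingIncl τ u ∈ Ideal.span
      ((fun x : L => UniversalEnvelopingAlgebra.ι K x) '' (posPart τ pos : Set L))

variable {I : Type*} (pos : Set (Module.Dual K T)) (α : I → Module.Dual K T) (h : I → T)
  (lam : Module.Dual K T)

/-- The generators of the ideal `J^λ`:
(i) the Harish-Chandra images of `x₁ ⋯ x_m y₁ ⋯ y_{l+1}`, where `l = λ(h_i)`, the `x_j` lie in root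
spaces of positive roots `β_j` with `∑ β_j = (l + 1) α_i`, and the `y_j` lie in `L_{-α_i}`;
(ii) the elements `h_i - λ(h_i) 1`. -/
def seligmanGenerators : Set (UniversalEnvelopingAlgebra K (zeroPart τ)) :=
  {u | ∃ (i : I) (l m : ℕ) (β : Fin m → Module.Dual K T) (x : Fin m → L) (y : Fin (l + 1) → L),
      lam (h i) = (l : K) ∧
      (∀ j, β j ∈ pos ∧ x j ∈ weightSpace τ (β j)) ∧
      (∀ j, y j ∈ weightSpace τ (-α i)) ∧
      ∑ j, β j = (l + 1) • α i ∧
      IsHarishChandraImage τ pos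
        ((List.ofFn fun j => UniversalEnvelopingAlgebra.ι K (x j)).prod *
          (List.ofFn fun j => UniversalEnvelopingAlgebra.ι K (y j)).prod) u} ∪
  {u | ∃ (i : I) (x : zeroPart τ), (x : L) = τ (h i) ∧
      u = UniversalEnvelopingAlgebra.ι K x - algebraMap K _ (lam (h i))}

/-- The two-sided ideal `J^λ` of `U(L₀)`. -/
def seligmanIdeal : TwoSidedIdeal (UniversalEnvelopingAlgebra K (zeroPart τ)) :=
  TwoSidedIdeal.span (seligmanGenerators τ pos α h lam)

/-- The Seligman algebra `S^λ = U(L₀) / J^λ`. -/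
abbrev SeligmanAlgebra :=
  (seligmanIdeal τ pos α h lam).ringCon.Quotient

end Seligman

/-! ### The Lie algebra `sl_n(A)` -/

section SpecialLinear

variable (K : Type u) [Field K] (A : Type v) [Ring A] [Algebra K A] (n : ℕ)

/-- `sl_n(A) = [gl_n(A), gl_n(A)]`. -/
abbrev sl : LieIdeal K (Matrix (Fin n) (Fin n) A) :=
  ⁅(⊤ : LieIdeal K (Matrix (Fin n) (Fin n) A)), (⊤ : LieIdeal K (Matrix (Fin n) (Fin n) A))⁆

/-- The diagonal Cartan subalgebra of `sl_n(K)`: diagonal matrices of trace zero. -/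
def cartan : Submodule K (Matrix (Fin n) (Fin n) K) where
  carrier := {M | M.IsDiag ∧ M.trace = 0}
  zero_mem' := ⟨Matrix.isDiag_zero, Matrix.trace_zero _ _⟩
  add_mem' := by
    rintro a b ⟨ha, ha'⟩ ⟨hb, hb'⟩
    exact ⟨ha.add hb, by rw [Matrix.trace_add, ha', hb', add_zero]⟩
  smul_mem' := by
    rintro c a ⟨ha, ha'⟩
    exact ⟨ha.smul c, by rw [Matrix.trace_smul, ha', smul_zero]⟩

theorem map_cartan_mem (t : cartan K n) :
    (t : Matrix (Fin n) (Fin n) K).map (algebraMap K A) ∈ sl K A n := by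
  obtain ⟨M, hd, htr⟩ := t
  have key : ∀ (i j : Fin n) (a : A), i ≠ j →
      Matrix.single i i a - Matrix.single j j a ∈ sl K A n := by
    intro i j a hij
    have h1 : (⁅Matrix.single i j a, Matrix.single j i (1 : A)⁆ : Matrix (Fin n) (Fin n) A) =
        Matrix.single i i a - Matrix.single j j a := by
      rw [LieRing.of_associative_ring_bracket]
      simp
    rw [← h1]
    exact LieSubmodule.lie_mem_lie (LieSubmodule.mem_top _) (LieSubmodule.mem_top _)
  rcases isEmpty_or_nonempty (Fin n) with hE | ⟨⟨k⟩⟩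
  · have : M.map (algebraMap K A) = 0 := by
      ext i
      exact hE.elim i
    rw [this]
    exact zero_mem _
  · have hsum : M.map (algebraMap K A) =
        ∑ i, (Matrix.single i i (algebraMap K A (M i i)) -
          Matrix.single k k (algebraMap K A (M i i))) := by
      rw [Finset.sum_sub_distrib]
      have h2 : ∑ i, Matrix.single k k (algebraMap K A (M i i)) =
          (0 : Matrix (Fin n) (Fin n) A) := by
        have h3 : ∑ i, algebraMap K A (M i i) = 0 := by
          rw [← map_sum]
          have : ∑ i, M i i = 0 := htr
          rw [this, map_zero]
        have h4 := map_sum (Matrix.singleAddMonoidHom (α := A) k k)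
          (fun i => algebraMap K A (M i i)) Finset.univ
        rw [h3, map_zero] at h4
        exact h4.symm
      rw [h2, sub_zero]
      ext p q
      rw [Matrix.sum_apply]
      by_cases hpq : p = q
      · subst hpq
        simp [Matrix.single_apply]
      · have : M p q = 0 := hd hpq
        simp only [Matrix.map_apply, this, map_zero]
        symm
        apply Finset.sum_eq_zero
        intro i _
        rw [Matrix.single_apply, if_neg]
        rintro ⟨rfl, rfl⟩
        exact hpq rfl
    change M.map (algebraMap K A) ∈ sl K A n
    rw [hsum]
    refine sum_mem fun i _ => ?_
    by_cases hik : i = k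
    · subst hik
      rw [sub_self]
      exact zero_mem _
    · exact key i k _ hik

/-- The Cartan subalgebra of `sl_n(K)`, viewed in `sl_n(A)` through `K → A`. -/
def cartanIncl : cartan K n →ₗ[K] sl K A n where
  toFun t := ⟨(t : Matrix (Fin n) (Fin n) K).map (algebraMap K A), map_cartan_mem K A n t⟩
  map_add' := by
    intro s t
    ext i j
    simp
  map_smul' := by
    intro c t
    apply Subtype.ext
    funext i j
    change algebraMap K A (c * (t : Matrix (Fin n) (Fin n) K) i j) =
      c • algebraMap K A ((t : Matrix (Fin n) (Fin n) K) i j)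
    rw [map_mul, Algebra.smul_def]

/-- The linear form `ε_i`: the `i`-th diagonal entry. -/
def eps (i : Fin n) : Module.Dual K (cartan K n) where
  toFun t := (t : Matrix (Fin n) (Fin n) K) i i
  map_add' _ _ := rfl
  map_smul' _ _ := rfl

/-- The positive roots `ε_i - ε_j`, `i < j`. -/
def posRoots : Set (Module.Dual K (cartan K n)) :=
  {β | ∃ i j : Fin n, i < j ∧ β = eps K n i - eps K n j}

variable {n}

/-- For `i` in the index set of the simple roots: `i` as a matrix index. -/
def lo (i : Fin (n - 1)) : Fin n := ⟨i, by omega⟩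

/-- For `i` in the index set of the simple roots: `i + 1` as a matrix index. -/
def hi (i : Fin (n - 1)) : Fin n := ⟨i + 1, by omega⟩

/-- The simple root `α_i = ε_i - ε_{i+1}`. -/
def simpleRoot (i : Fin (n - 1)) : Module.Dual K (cartan K n) :=
  eps K n (lo i) - eps K n (hi i)

/-- The simple coroot `h_i = E_{i,i} - E_{i+1,i+1}`. -/
def coroot (i : Fin (n - 1)) : cartan K n :=
  ⟨Matrix.diagonal (Pi.single (lo i) 1 - Pi.single (hi i) 1),
    Matrix.isDiag_diagonal _, by simp [Matrix.trace_diagonal]⟩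

/-- The Seligman algebra `S^λ` of `(sl_n(A), sl_n(K))`. -/
abbrev SlSeligman (lam : Module.Dual K (cartan K n)) :=
  SeligmanAlgebra (cartanIncl K A n) (posRoots K n) (simpleRoot K) (coroot K) lam

/-- The algebra `B_i`, for `i` in the index set `{0, …, n - 2}` of the simple roots:
`TS^{l_i}(A)` for the first index, `TS^{l_i}(Aᵒᵖ)` for the last one, and `TS^{l_i}(A)` modulo the
ideal generated by its commutators for the others. -/
def factor (l : Fin (n - 1) → ℕ) (i : Fin (n - 1)) : AlgCat.{max u v} K :=
  if (i : ℕ) = 0 then AlgCat.of K (symTensors K A (l i))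
  else if (i : ℕ) = n - 2 then AlgCat.of K (symTensors K Aᵐᵒᵖ (l i))
  else AlgCat.of K (SymTensorsAb K A (l i))

end SpecialLinear

/-- The support of `l` is totally disconnected: it contains no two consecutive indices. -/
def TotallyDisconnectedSupport {r : ℕ} (l : Fin r → ℕ) : Prop :=
  ∀ i j : Fin r, (j : ℕ) = i + 1 → l i = 0 ∨ l j = 0

end SeligmanAlg

end

/-! Write `h_i(a,b) = [a E_{i,i+1}, b E_{i+1,i}] = ab E_{ii} - ba E_{i+1,i+1}`, and let `θ_i(b)` be
the image of `h_i(1,b)` in `S^λ`. The isomorphism matches `θ_i(b)` with the sum of the `ℓ_i`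
insertions of `b` into `1 ⊗ ⋯ ⊗ 1` in the `i`-th factor. Both sides are generated by these elements,
so it suffices to have a homomorphism in each direction.

The factors. In characteristic 0, `TS^ℓ(A)` is generated by the insertion sums `θ(a)`, and it is
universal for linear maps with `[θ a, θ b] = θ(ab) - θ(ba)`, `θ(1) = ℓ` and vanishing noncommutative
Newton polynomials in `ℓ + 1` arguments (`adjoin_symPowerSum`, `IsPowerSum.exists_symTensors_lift`).

The link. Modulo `U(L) L₊`, the product `x(1)^m y(b₁) ⋯ y(b_m)` straightens to `m!` times the Newton
polynomial in the `h(1,b_j)` (`IsSl2Triple.pow_mul_prod`), and the products with other `x(a)` follow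
by acting with `h(a)` (`IsSl2Triple.prod_mul_prod_mem`). So the relations (i) encode exactly the
vanishing of Newton polynomials.

From the factors to `S^λ`. The element `(ab - ba) E_{i+1,i+1}` can be written with brackets of node
`i` and also with brackets of node `i + 1`. One of the two nodes has `ℓ = 0` and hence dies in
`S^λ`, so this element dies too. Therefore `h_i(a,b) = θ_i(ab)` if `i` has a right neighbour, and
`h_i(a,b) = θ_i(ba)` if it has a left one. This yields the relation for `A` at the first node, for
`Aᵒᵖ` at the last, and commutativity at the inner ones (`isFactorMap_seligmanPowerSum`); distinct
nodes commute.

From `S^λ` to the factors. A Lie homomorphism `φ` from `L₀` to the tensor product is prescribed, and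
it must kill every Harish-Chandra image of the products in (i). Straightening provides some
representative that is killed; that its choice does not matter is shown without the
Poincaré–Birkhoff–Witt theorem, by a linear functional on `U(L)` that kills `U(L) L₊` and restricts
on `U(L₀)` to the extension of `φ` (`exists_enveloping_functional`, `exists_weightHom`). -/

noncomputable section

namespace SeligmanAlg

universe u v

attribute [local instance 100] LieRing.ofAssociativeRing

/-! ### Sums over the removal of one entry of a list -/

section EraseSum

variable {α β V V' : Type*} [AddCommGroup V] [AddCommGroup V']

/-- The sum of `G c l'` over all ways to remove one entry `c` from the list `l`, leaving `l'`. -/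
def eraseSum : List α → (α → List α → V) → V
  | [], _ => 0
  | a :: l, G => G a l + eraseSum l fun c l' => G c (a :: l')

@[simp] theorem eraseSum_nil (G : α → List α → V) : eraseSum [] G = 0 := rfl

theorem eraseSum_cons (a : α) (l : List α) (G : α → List α → V) :
    eraseSum (a :: l) G = G a l + eraseSum l fun c l' => G c (a :: l') := rfl

theorem eraseSum_congr {l : List α} {G H : α → List α → V}
    (h : ∀ c l', (c :: l').Perm l → G c l' = H c l') : eraseSum l G = eraseSum l H := by
  induction l generalizing G H with
  | nil => rfl
  | cons a l ih =>
    rw [eraseSum_cons, eraseSum_cons, h a l (List.Perm.refl _),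
      ih fun c l' hl' => h c (a :: l') ((List.Perm.swap _ _ _).trans (hl'.cons a))]

theorem eraseSum_add (l : List α) (G H : α → List α → V) :
    eraseSum l (fun c l' => G c l' + H c l') = eraseSum l G + eraseSum l H := by
  induction l generalizing G H with
  | nil => simp
  | cons a l ih => simp only [eraseSum_cons, ih]; abel

theorem map_eraseSum {F : Type*} [FunLike F V V'] [AddMonoidHomClass F V V'] (f : F)
    (l : List α) (G : α → List α → V) :
    f (eraseSum l G) = eraseSum l fun c l' => f (G c l') := by
  induction l generalizing G with
  | nil => simp
  | cons a l ih => simp only [eraseSum_cons, map_add, ih]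

theorem eraseSum_neg (l : List α) (G : α → List α → V) :
    eraseSum l (fun c l' => -G c l') = -eraseSum l G :=
  (map_eraseSum (negAddMonoidHom : V →+ V) l G).symm

theorem eraseSum_sub (l : List α) (G H : α → List α → V) :
    eraseSum l (fun c l' => G c l' - H c l') = eraseSum l G - eraseSum l H := by
  simp only [sub_eq_add_neg, eraseSum_add, eraseSum_neg]

theorem eraseSum_mul_right {C : Type*} [Ring C] (l : List α) (G : α → List α → C) (x : C) :
    eraseSum l G * x = eraseSum l fun c l' => G c l' * x :=
  map_eraseSum (AddMonoidHom.mulRight x) l G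

theorem mul_eraseSum {C : Type*} [Ring C] (l : List α) (G : α → List α → C) (x : C) :
    x * eraseSum l G = eraseSum l fun c l' => x * G c l' :=
  map_eraseSum (AddMonoidHom.mulLeft x) l G

theorem eraseSum_const (l : List α) (v : V) :
    eraseSum l (fun _ _ => v) = l.length • v := by
  induction l with
  | nil => simp
  | cons a l ih => rw [eraseSum_cons, ih, List.length_cons, succ_nsmul']

theorem eraseSum_mem {S : Type*} [SetLike S V] [AddSubmonoidClass S V] (s : S) {l : List α}
    {G : α → List α → V} (h : ∀ c l', (c :: l').Perm l → G c l' ∈ s) : eraseSum l G ∈ s := by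
  induction l generalizing G with
  | nil => exact zero_mem s
  | cons a l ih =>
    exact add_mem (h a l (List.Perm.refl _))
      (ih fun c l' hl' => h c (a :: l') ((List.Perm.swap _ _ _).trans (hl'.cons a)))

theorem eraseSum_map (f : α → β) (l : List α) (G : β → List β → V) :
    eraseSum (l.map f) G = eraseSum l fun c l' => G (f c) (l'.map f) := by
  induction l generalizing G with
  | nil => rfl
  | cons a l ih => simp only [List.map_cons, eraseSum_cons, ih]

theorem eraseSum_replicate (a : α) (n : ℕ) (G : α → List α → V) :
    eraseSum (List.replicate n a) G = n • G a (List.replicate (n - 1) a) := by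
  rw [eraseSum_congr (H := fun _ _ => G a (List.replicate (n - 1) a)), eraseSum_const,
    List.length_replicate]
  intro c l' h
  obtain ⟨hl, h⟩ := List.eq_replicate_iff.1 (List.perm_replicate.1 h)
  rw [List.length_cons] at hl
  rw [h c (by simp), ← List.eq_replicate_iff.2
    ⟨(by omega : l'.length = n - 1), fun b hb => h b (by simp [hb])⟩]

/-- The double sum runs over ordered pairs of distinct positions, and exchanging the two positions
is a bijection of these pairs. -/
theorem eraseSum_eraseSum_swap (l : List α) (G : α → α → List α → V) :
    eraseSum l (fun b l' => eraseSum l' fun c l'' => G b c l'') =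
      eraseSum l fun b l' => eraseSum l' fun c l'' => G c b l'' := by
  induction l generalizing G with
  | nil => rfl
  | cons a l ih =>
    simp only [eraseSum_cons, eraseSum_add]
    rw [ih fun b c l'' => G b c (a :: l'')]
    abel

/-- A function on lists that is invariant under permutations. -/
def PermInvariant (F : List α → V) : Prop := ∀ l m : List α, l.Perm m → F l = F m

theorem eraseSum_perm {l m : List α} (h : l.Perm m) {G : α → List α → V}
    (hG : ∀ c, PermInvariant (G c)) : eraseSum l G = eraseSum m G := by
  induction h generalizing G with
  | nil => rfl
  | cons a hlm ih =>
    rw [eraseSum_cons, eraseSum_cons, hG a _ _ hlm,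
      ih fun c _ _ h => hG c _ _ (h.cons a)]
  | swap a b l =>
    simp only [eraseSum_cons]
    rw [eraseSum_congr (l := l) (G := fun c l' => G c (b :: a :: l'))
      (H := fun c l' => G c (a :: b :: l')) fun c l' _ => hG c _ _ (List.Perm.swap _ _ _)]
    abel
  | trans _ _ ih₁ ih₂ => rw [ih₁ hG, ih₂ hG]

theorem eraseSum_ofFn {m : ℕ} (a : Fin m → α) (f : α → α) {F : List α → V}
    (hF : PermInvariant F) :
    eraseSum (List.ofFn a) (fun c l' => F (f c :: l')) =
      ∑ k, F (List.ofFn (Function.update a k (f (a k)))) := by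
  induction m generalizing F with
  | zero => simp
  | succ m ih =>
    rw [List.ofFn_succ, eraseSum_cons, Fin.sum_univ_succ]
    congr 1
    · rw [List.ofFn_succ]
      simp
    · rw [eraseSum_congr (H := fun c l' => F (a 0 :: f c :: l'))
        fun c l' _ => hF _ _ (List.Perm.swap _ _ _)]
      rw [ih (F := fun l => F (a 0 :: l)) (fun i => a i.succ)
        fun _ _ h => hF _ _ (h.cons _)]
      refine Finset.sum_congr rfl fun k _ => ?_
      rw [List.ofFn_succ (f := Function.update a k.succ _)]
      congr 2
      · congr 1
        funext j
        by_cases hjk : j = k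
        · subst hjk; simp
        · rw [Function.update_of_ne hjk, Function.update_of_ne (by simpa using hjk)]

end EraseSum

/-! ### Noncommutative Newton polynomials -/

section Newton

variable {R C : Type*} [Ring R] [Ring C]

/-- Auxiliary recursion for `newton`, with a bound on the number of steps. -/
def newtonAux (θ : R → C) : ℕ → List R → C
  | 0, _ => 1
  | _ + 1, [] => 1
  | n + 1, a :: l => newtonAux θ n l * θ a - eraseSum l fun c l' => newtonAux θ n (c * a :: l')

/-- The polynomial in the values of `θ` that, when `θ a` is the sum of the images of `a` under
commuting algebra homomorphisms `φ_j`, is the sum of the `∏ φ_{j_k} a_k` over distinct `j_k`. -/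
def newton (θ : R → C) (l : List R) : C := newtonAux θ l.length l

@[simp] theorem newton_nil (θ : R → C) : newton θ [] = 1 := rfl

theorem newton_cons (θ : R → C) (a : R) (l : List R) :
    newton θ (a :: l) = newton θ l * θ a - eraseSum l fun c l' => newton θ (c * a :: l') := by
  unfold newton
  rw [List.length_cons, newtonAux]
  congr 1
  refine eraseSum_congr fun c l' h => ?_
  rw [List.length_cons, ← h.length_eq, List.length_cons]

variable {θ : R → C}

/-- The recursion treats the head differently, so symmetry is not visible. After expanding the first
two entries, the only asymmetric term is `θ b * θ a - θ (b * a)`, and the commutator relation says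
precisely that it is symmetric. Shorter lists are handled by induction on the length. -/
theorem newton_perm (hθ : ∀ a b, θ a * θ b - θ b * θ a = θ (a * b) - θ (b * a)) :
    PermInvariant (newton θ) := by
  have key : ∀ n (l m : List R), l.length = n → l.Perm m → newton θ l = newton θ m := by
    intro n
    induction n using Nat.strong_induction_on with
    | _ n ih =>
      intro l m hl h
      induction h with
      | nil => rfl
      | cons a h _ =>
        rw [newton_cons, newton_cons, ih _ (by simp at hl; omega) _ _ rfl h]
        congr 1
        rw [List.length_cons] at hl
        -- `eraseSum_perm` asks for permutation invariance on lists of every length, while the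
        -- induction hypothesis covers short lists only. Replacing the summand by 0 at the other
        -- lengths does not change the sum.
        rw [eraseSum_congr (H := fun c l' => if l'.length + 2 = n then newton θ (c * a :: l') else 0)
          fun c l' hl' => by
            rw [if_pos (by rw [← hl, ← hl'.length_eq, List.length_cons])]]
        rw [eraseSum_perm h]
        · refine eraseSum_congr fun c l' hl' => ?_
          rw [if_pos (by rw [← hl, h.length_eq, ← hl'.length_eq, List.length_cons])]
        · intro c p q hpq
          dsimp only
          rw [hpq.length_eq]
          split_ifs with h1
          · exact ih (n - 1) (by omega) _ _ (by
              rw [List.length_cons, hpq.length_eq]; omega) (hpq.cons _)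
          · rfl
      | swap b a l =>
        simp only [List.length_cons] at hl
        have expand : ∀ a b : R, newton θ (a :: b :: l) =
            newton θ l * (θ b * θ a - θ (b * a)) -
              (eraseSum l (fun c l' => newton θ (c * b :: l') * θ a) +
                eraseSum l (fun c l' => newton θ (c * a :: l') * θ b)) +
              (eraseSum l (fun c l' => newton θ (c * (b * a) :: l')) +
                eraseSum l (fun c l' => newton θ (c * (a * b) :: l'))) +
              eraseSum l fun c l' => eraseSum l' fun d l'' =>
                newton θ (d * b :: c * a :: l'') := by
          intro a b
          rw [newton_cons, eraseSum_cons, newton_cons θ b, newton_cons θ (b * a)]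
          rw [eraseSum_congr (l := l) (G := fun c l' => newton θ (c * a :: b :: l'))
            (H := fun c l' => newton θ (c * a :: l') * θ b - (newton θ (c * (a * b) :: l') +
              eraseSum l' fun d l'' => newton θ (d * b :: c * a :: l'')))]
          · rw [eraseSum_sub, eraseSum_add, sub_mul, eraseSum_mul_right, mul_sub, mul_assoc]
            abel
          · intro c l' hl'
            have hlen : l'.length + 1 = l.length := by rw [← hl'.length_eq, List.length_cons]
            rw [ih (n - 1) (by omega) (c * a :: b :: l') (b :: c * a :: l')
              (by simp only [List.length_cons]; omega) (List.Perm.swap _ _ _),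
              newton_cons, eraseSum_cons, mul_assoc]
        rw [expand, expand]
        have h1 : θ b * θ a - θ (b * a) = θ a * θ b - θ (a * b) := by
          have := hθ a b
          rw [sub_eq_sub_iff_add_eq_add] at this ⊢
          rw [add_comm] at this
          rw [add_comm (θ b * θ a), ← this, add_comm]
        rw [h1, eraseSum_eraseSum_swap l fun c d l'' => newton θ (d * b :: c * a :: l''),
          add_comm (eraseSum l fun c l' => newton θ (c * b :: l') * θ a),
          add_comm (eraseSum l fun c l' => newton θ (c * (b * a) :: l'))]
        congr 1
        refine eraseSum_congr fun c l' hl' => eraseSum_congr fun d l'' hl'' => ?_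
        have hlen : l'.length + 1 = l.length := by rw [← hl'.length_eq, List.length_cons]
        have hlen' : l''.length + 1 = l'.length := by rw [← hl''.length_eq, List.length_cons]
        exact ih (n - 2 + 0) (by omega) _ _ (by simp only [List.length_cons]; omega)
          (List.Perm.swap _ _ _)
      | trans h₁ _ ih₁ ih₂ => rw [ih₁ hl, ih₂ (by rw [← h₁.length_eq, hl])]
  exact fun l m h => key _ l m rfl h

/-- By symmetry any entry may play the role of the head in the recursion. The average over all
choices has the shape produced by `IsSl2Triple.x_mul_prod`. -/
theorem length_smul_newton (hθ : ∀ a b, θ a * θ b - θ b * θ a = θ (a * b) - θ (b * a))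
    (l : List R) :
    l.length • newton θ l = eraseSum l fun b l' =>
      newton θ l' * θ b - eraseSum l' fun c l'' => newton θ (c * b :: l'') := by
  rw [← eraseSum_const]
  refine eraseSum_congr fun c l' h => ?_
  rw [← newton_cons, newton_perm hθ _ _ h]

theorem map_newton {C' : Type*} [Ring C'] (f : C →+* C') (l : List R) :
    f (newton θ l) = newton (f ∘ θ) l := by
  induction hn : l.length using Nat.strong_induction_on generalizing l with
  | _ n ih =>
    cases l with
    | nil => simp
    | cons a l =>
      rw [List.length_cons] at hn
      rw [newton_cons, newton_cons, map_sub, map_mul, map_eraseSum, ih _ (by omega) l rfl]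
      congr 1
      refine eraseSum_congr fun c l' h => ?_
      have hlen := h.length_eq
      rw [List.length_cons] at hlen
      exact ih _ (by simp only [List.length_cons]; omega) _ rfl

theorem newton_mem {S : Type*} [SetLike S C] [SubringClass S C] (s : S) (hs : ∀ a, θ a ∈ s)
    (l : List R) : newton θ l ∈ s := by
  induction hn : l.length using Nat.strong_induction_on generalizing l with
  | _ n ih =>
    cases l with
    | nil => exact one_mem s
    | cons a l =>
      rw [List.length_cons] at hn
      rw [newton_cons]
      refine sub_mem (mul_mem (ih _ (by omega) l rfl) (hs a)) (eraseSum_mem s fun c l' h => ?_)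
      have hlen := h.length_eq
      rw [List.length_cons] at hlen
      exact ih _ (by simp only [List.length_cons]; omega) _ rfl

end Newton

section NewtonLinear

variable {K R C : Type*} [Field K] [Ring R] [Algebra K R] [Ring C] [Algebra K C]
  {θ : R →ₗ[K] C}

theorem newton_cons_add (a b : R) (l : List R) :
    newton θ ((a + b) :: l) = newton θ (a :: l) + newton θ (b :: l) := by
  induction hn : l.length generalizing l a b with
  | zero =>
    rw [List.length_eq_zero_iff.1 hn]
    simp only [newton_cons θ _ [], newton_nil, eraseSum_nil, map_add, one_mul, sub_zero]
  | succ n ih =>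
    simp only [newton_cons θ _ l, map_add, mul_add]
    rw [eraseSum_congr fun c l' h => ih (c * a) (c * b) l' (by
      have := h.length_eq
      rw [List.length_cons] at this
      omega), eraseSum_add]
    abel

theorem newton_cons_smul (r : K) (a : R) (l : List R) :
    newton θ ((r • a) :: l) = r • newton θ (a :: l) := by
  induction hn : l.length generalizing l a with
  | zero =>
    rw [List.length_eq_zero_iff.1 hn]
    simp only [newton_cons θ _ [], newton_nil, eraseSum_nil, map_smul, one_mul, sub_zero]
  | succ n ih =>
    simp only [newton_cons θ _ l, map_smul, mul_smul_comm]
    rw [eraseSum_congr fun c l' h => ih (c * a) l' (by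
      have := h.length_eq
      rw [List.length_cons] at this
      omega), smul_sub]
    congr 1
    exact (map_eraseSum (DistribSMul.toAddMonoidHom C r) _ _).symm

/-- Each further entry 1 contributes a factor `ℓ - m`: the product with `θ 1 = ℓ`, minus `m` equal
correction terms. For `m = ℓ` the value `ℓ!` is the normalising constant of the universal property.
-/
theorem newton_replicate_one {ℓ : ℕ} (h1 : θ 1 = ℓ) (m : ℕ) :
    newton θ (List.replicate m 1) = (ℓ.descFactorial m : C) := by
  induction m with
  | zero => simp
  | succ m ih =>
    have hstep : newton θ (List.replicate (m + 1) 1) = ((ℓ : C) - m) * (ℓ.descFactorial m : C) := by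
      rw [List.replicate_succ, newton_cons, eraseSum_replicate, ih, h1, one_mul]
      cases m with
      | zero => simp
      | succ m =>
        rw [Nat.add_sub_cancel, ← List.replicate_succ, ih, nsmul_eq_mul, sub_mul,
          (Nat.cast_commute ℓ _).eq]
    rw [hstep, Nat.descFactorial_succ]
    rcases le_or_gt m ℓ with h | h
    · rw [Nat.cast_mul, Nat.cast_sub h]
    · rw [Nat.descFactorial_of_lt h]
      simp

/-- Brings the varying entry to the head, independently of its value, so that multilinearity of
`newton` reduces to linearity in the head. -/
theorem ofFn_update_perm {α : Type*} {m : ℕ} (a : Fin m → α) (k : Fin m) :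
    ∃ l : List α, ∀ x, (List.ofFn (Function.update a k x)).Perm (x :: l) := by
  induction m with
  | zero => exact k.elim0
  | succ m ih =>
    refine Fin.cases ?_ (fun k => ?_) k
    · refine ⟨List.ofFn fun i : Fin m => a i.succ, fun x => ?_⟩
      rw [List.ofFn_succ]
      simp
    · obtain ⟨l, hl⟩ := ih (fun i => a i.succ) k
      refine ⟨a 0 :: l, fun x => ?_⟩
      rw [List.ofFn_succ]
      have h1 : (fun i : Fin m => Function.update a k.succ x i.succ) =
          Function.update (fun i : Fin m => a i.succ) k x := by
        funext j
        by_cases hjk : j = k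
        · subst hjk; simp
        · rw [Function.update_of_ne hjk, Function.update_of_ne (by simpa using hjk)]
      rw [h1, Function.update_of_ne (Fin.succ_ne_zero k).symm]
      exact ((hl x).cons _).trans (List.Perm.swap _ _ _)

/-- `newton` on lists of fixed length, as a multilinear map. -/
def newtonMultilinear (hθ : ∀ a b, θ a * θ b - θ b * θ a = θ (a * b) - θ (b * a)) (m : ℕ) :
    MultilinearMap K (fun _ : Fin m => R) C where
  toFun a := newton θ (List.ofFn a)
  map_update_add' := by
    intro inst a k x y
    rw [Subsingleton.elim inst (instDecidableEqFin m)]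
    obtain ⟨l, hl⟩ := ofFn_update_perm a k
    rw [newton_perm hθ _ _ (hl _), newton_perm hθ _ _ (hl _), newton_perm hθ _ _ (hl _),
      newton_cons_add]
  map_update_smul' := by
    intro inst a k r x
    rw [Subsingleton.elim inst (instDecidableEqFin m)]
    obtain ⟨l, hl⟩ := ofFn_update_perm a k
    rw [newton_perm hθ _ _ (hl _), newton_perm hθ _ _ (hl _), newton_cons_smul]

end NewtonLinear

/-! ### Generators of the algebra of symmetric tensors -/

section PowerSum

variable (K : Type*) [Field K] {A : Type*} [Ring A] [Algebra K A] (ℓ : ℕ)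

/-- The sum of the `ℓ` insertions of `a` into the tensor `1 ⊗ ⋯ ⊗ 1`. -/
def powerSum : A →ₗ[K] ⨂[K] _ : Fin ℓ, A :=
  ∑ p : Fin ℓ, (PiTensorProduct.singleAlgHom (R := K) (A := fun _ : Fin ℓ => A) p).toLinearMap

variable {K ℓ}

theorem powerSum_apply (a : A) :
    powerSum K ℓ a = ∑ p : Fin ℓ, PiTensorProduct.tprod K (Function.update 1 p a) := by
  rw [powerSum, LinearMap.sum_apply]
  rfl

theorem tprod_mul_powerSum (w : Fin ℓ → A) (a : A) :
    PiTensorProduct.tprod K w * powerSum K ℓ a =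
      ∑ p, PiTensorProduct.tprod K (Function.update w p (w p * a)) := by
  rw [powerSum_apply, Finset.mul_sum]
  refine Finset.sum_congr rfl fun p _ => ?_
  rw [PiTensorProduct.tprod_mul_tprod]
  congr 1
  funext q
  by_cases h : q = p
  · subst h; simp
  · simp [Function.update_of_ne h]

/-- Insertions at different places commute, so only the insertions of both elements at the same
place survive in the commutator. -/
theorem powerSum_comm (a b : A) :
    powerSum K ℓ a * powerSum K ℓ b - powerSum K ℓ b * powerSum K ℓ a =
      powerSum K ℓ (a * b) - powerSum K ℓ (b * a) := by
  have h : ∀ a b : A, powerSum K ℓ a * powerSum K ℓ b = powerSum K ℓ (a * b) +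
      ∑ p : Fin ℓ, ∑ q : Fin ℓ, if p = q then 0 else
        PiTensorProduct.tprod K (Function.update (Function.update (1 : Fin ℓ → A) p a) q b) := by
    intro a b
    rw [powerSum_apply a, Finset.sum_mul, powerSum_apply (a * b), ← Finset.sum_add_distrib]
    refine Finset.sum_congr rfl fun p _ => ?_
    rw [tprod_mul_powerSum, ← Finset.add_sum_erase _ _ (Finset.mem_univ p),
      ← Finset.add_sum_erase (a := p) Finset.univ (fun q => if p = q then _ else _)
        (Finset.mem_univ p)]
    simp only [Function.update_self, Function.update_idem, if_true, zero_add]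
    congr 1
    refine Finset.sum_congr rfl fun q hq => ?_
    have hqp := Finset.ne_of_mem_erase hq
    rw [if_neg hqp.symm, Function.update_of_ne hqp, Pi.one_apply, one_mul]
  rw [h a b, h b a, Finset.sum_comm (γ := Fin ℓ) (f := fun p q => if p = q then 0 else
        PiTensorProduct.tprod K (Function.update (Function.update (1 : Fin ℓ → A) p b) q a))]
  have : ∀ p q : Fin ℓ, (if p = q then (0 : ⨂[K] _ : Fin ℓ, A) else
      PiTensorProduct.tprod K (Function.update (Function.update (1 : Fin ℓ → A) p a) q b)) =
      if q = p then 0 else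
      PiTensorProduct.tprod K (Function.update (Function.update (1 : Fin ℓ → A) q b) p a) := by
    intro p q
    by_cases h : p = q
    · simp [h]
    · rw [if_neg h, if_neg (Ne.symm h), Function.update_comm h]
  simp only [this]
  abel

theorem powerSum_one : powerSum K ℓ (1 : A) = ℓ := by
  have : ∀ p : Fin ℓ, Function.update (1 : Fin ℓ → A) p 1 = 1 := fun p =>
    Function.update_eq_self p 1
  rw [powerSum_apply]
  simp only [this]
  rw [← PiTensorProduct.one_def, Finset.sum_const, Finset.card_univ, Fintype.card_fin, nsmul_one]

-- Multiplying by `powerSum` inserts the new element at any place `p`. Either `p` is unused, which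
-- extends the injection, or `p` is the place of an earlier entry `c`, which turns `c` into `c * a`;
-- the recursion for `newton` subtracts the second kind.
open Classical in
theorem newton_powerSum {m : ℕ} (a : Fin m → A) :
    newton (powerSum K ℓ) (List.ofFn a) = ∑ j : Fin m → Fin ℓ,
      if Function.Injective j then
        PiTensorProduct.tprod K (Function.extend j a 1) else 0 := by
  induction m with
  | zero =>
    rw [Fintype.sum_subsingleton _ (fun i : Fin 0 => i.elim0),
      if_pos (Function.injective_of_subsingleton _)]
    simp only [List.ofFn_zero, newton_nil, PiTensorProduct.one_def]
    congr 1
    funext q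
    rw [Function.extend_apply' _ _ _ (by rintro ⟨i, -⟩; exact i.elim0)]
  | succ m ih =>
    rw [List.ofFn_succ, newton_cons, eraseSum_ofFn _ (fun c => c * a 0)
      (newton_perm powerSum_comm)]
    simp only [ih]
    rw [sub_eq_iff_eq_add, Finset.sum_mul, ← (Fin.consEquiv fun _ => Fin ℓ).sum_comp,
      Fintype.sum_prod_type, Finset.sum_comm (γ := Fin ℓ), Finset.sum_comm (γ := Fin m),
      ← Finset.sum_add_distrib]
    refine Finset.sum_congr rfl fun j _ => ?_
    simp only [Fin.consEquiv, Equiv.coe_fn_mk, Fin.cons_injective_iff]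
    by_cases hj : Function.Injective j
    · simp only [hj, if_true, and_true]
      rw [tprod_mul_powerSum, ← Finset.sum_filter,
        ← Finset.sum_filter_add_sum_filter_not Finset.univ (fun p => p ∉ Set.range j)]
      congr 1
      · refine Finset.sum_congr rfl fun p hp => ?_
        have hp := (Finset.mem_filter.1 hp).2
        congr 1
        have hinj : Function.Injective (Fin.cons p j : Fin (m + 1) → Fin ℓ) :=
          Fin.cons_injective_iff.2 ⟨hp, hj⟩
        funext q
        by_cases hq : ∃ i, (Fin.cons p j : Fin (m + 1) → Fin ℓ) i = q
        · obtain ⟨i, rfl⟩ := hq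
          rw [hinj.extend_apply]
          refine Fin.cases ?_ (fun i => ?_) i
          · rw [Fin.cons_zero, Function.update_self, Function.extend_apply' _ _ _ hp,
              Pi.one_apply, one_mul]
          · rw [Fin.cons_succ, Function.update_of_ne (fun h => hp ⟨i, h⟩), hj.extend_apply]
        · rw [Function.extend_apply' _ _ _ hq, Function.update_of_ne, Function.extend_apply']
          · rintro ⟨i, rfl⟩
            exact hq ⟨i.succ, by simp⟩
          · rintro rfl
            exact hq ⟨0, by simp⟩
      · have himg : Finset.univ.filter (fun p => ¬ (p ∉ Set.range j)) =
            Finset.univ.image j := by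
          ext p; simp
        rw [himg, Finset.sum_image fun _ _ _ _ h => hj h]
        refine Finset.sum_congr rfl fun k _ => ?_
        congr 1
        funext q
        by_cases hq : ∃ i, j i = q
        · obtain ⟨i, rfl⟩ := hq
          rw [hj.extend_apply]
          by_cases hik : i = k
          · subst hik; simp [hj.extend_apply]
          · rw [Function.update_of_ne (hj.ne hik), hj.extend_apply, hj.extend_apply,
              Function.update_of_ne hik]
        · rw [Function.extend_apply' _ _ _ hq, Function.update_of_ne, Function.extend_apply' _ _ _ hq]
          rintro rfl
          exact hq ⟨k, rfl⟩
    · simp [hj]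

/-- No injection exists from `ℓ + 1` entries into `ℓ` places. -/
theorem newton_powerSum_eq_zero {l : List A} (hl : l.length = ℓ + 1) :
    newton (powerSum K ℓ) l = 0 := by
  classical
  rw [← List.ofFn_get l, newton_powerSum]
  refine Finset.sum_eq_zero fun j _ => if_neg fun hj => ?_
  have := Fintype.card_le_of_injective j hj
  simp [hl] at this

theorem newton_powerSum_eq_sum_reindex (a : Fin ℓ → A) :
    newton (powerSum K ℓ) (List.ofFn a) = ∑ s : Equiv.Perm (Fin ℓ),
      PiTensorProduct.reindex K (fun _ : Fin ℓ => A) s (PiTensorProduct.tprod K a) := by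
  classical
  rw [newton_powerSum, ← Finset.sum_filter]
  symm
  refine Finset.sum_bij (fun s _ => (s : Fin ℓ → Fin ℓ)) ?_ ?_ ?_ ?_
  · intro s _
    simpa using s.injective
  · intro s _ t _ h
    exact Equiv.coe_fn_injective h
  · intro j hj
    have hj := (Finset.mem_filter.1 hj).2
    exact ⟨Equiv.ofBijective j (Finite.injective_iff_bijective.1 hj), Finset.mem_univ _, rfl⟩
  · intro s _
    rw [PiTensorProduct.reindex_tprod]
    congr 1
    funext q
    obtain ⟨i, rfl⟩ := s.surjective q
    rw [s.injective.extend_apply, Equiv.symm_apply_apply]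

theorem powerSum_mem (a : A) : powerSum K ℓ a ∈ symTensors K A ℓ := by
  intro s
  rw [powerSum_apply, map_sum,
    ← Equiv.sum_comp s fun p => PiTensorProduct.tprod K (Function.update (1 : Fin ℓ → A) p a)]
  refine Finset.sum_congr rfl fun p _ => ?_
  rw [PiTensorProduct.reindex_tprod]
  congr 1
  funext q
  obtain ⟨i, rfl⟩ := s.surjective q
  rw [Equiv.symm_apply_apply]
  by_cases h : i = p
  · subst h
    rw [Function.update_self, Function.update_self]
  · rw [Function.update_of_ne h, Function.update_of_ne (s.injective.ne h)]
    rfl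

/-- The symmetrisation of a pure tensor is a Newton polynomial in power sums. A symmetric tensor is
its own symmetrisation up to the factor `ℓ!`, which is invertible in characteristic 0. -/
theorem symTensors_eq_adjoin [CharZero K] :
    symTensors K A ℓ = Algebra.adjoin K (Set.range (powerSum K ℓ : A → _)) := by
  refine le_antisymm (fun x hx => ?_) (Algebra.adjoin_le ?_)
  · have hsum : ∀ t : ⨂[K] _ : Fin ℓ, A, ∑ s : Equiv.Perm (Fin ℓ),
        PiTensorProduct.reindex K (fun _ : Fin ℓ => A) s t ∈
          Algebra.adjoin K (Set.range (powerSum K ℓ : A → _)) := by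
      intro t
      induction t using PiTensorProduct.induction_on with
      | smul_tprod r a =>
        simp only [map_smul]
        rw [← Finset.smul_sum, ← newton_powerSum_eq_sum_reindex]
        exact Subalgebra.smul_mem _ (newton_mem _
          (fun a => Algebra.subset_adjoin (Set.mem_range_self a)) _) r
      | add a b ha hb =>
        simp only [map_add, Finset.sum_add_distrib]
        exact add_mem ha hb
    have h := hsum x
    simp only [hx _] at h
    rw [Finset.sum_const, Finset.card_univ, Fintype.card_perm, Fintype.card_fin,
      ← Nat.cast_smul_eq_nsmul K] at h
    have h2 := Subalgebra.smul_mem _ h ((ℓ.factorial : K)⁻¹)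
    rwa [smul_smul, inv_mul_cancel₀ (Nat.cast_ne_zero.2 ℓ.factorial_ne_zero), one_smul] at h2
  · rintro _ ⟨a, rfl⟩
    exact powerSum_mem a

end PowerSum

/-! ### The universal property of the algebra of symmetric tensors -/

section Universal

variable {K : Type*} [Field K] {A : Type*} [Ring A] [Algebra K A] {C : Type*} [Ring C]
  [Algebra K C]

/-- The relations satisfied by the sum of `ℓ` commuting algebra homomorphisms `A → C`. -/
structure IsPowerSum (θ : A →ₗ[K] C) (ℓ : ℕ) : Prop where
  comm : ∀ a b, θ a * θ b - θ b * θ a = θ (a * b) - θ (b * a)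
  one : θ 1 = ℓ
  vanish : ∀ l : List A, l.length = ℓ + 1 → newton θ l = 0

theorem exists_spanQuotient_lift {B : Type*} [Ring B] [Algebra K B] (f : B →ₐ[K] C) {s : Set B}
    (hs : ∀ x ∈ s, f x = 0) :
    ∃ g : (TwoSidedIdeal.span s).ringCon.Quotient →ₐ[K] C,
      ∀ x, g ((TwoSidedIdeal.span s).ringCon.mkₐ K x) = f x := by
  have hle : (TwoSidedIdeal.span s).ringCon ≤ RingCon.ker f.toRingHom := by
    intro x y hxy
    have h1 := (TwoSidedIdeal.span_le (I := TwoSidedIdeal.ker f)).2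
      (fun x hx => (TwoSidedIdeal.mem_ker f).2 (hs x hx)) ((TwoSidedIdeal.rel_iff _ _ _).1 hxy)
    exact sub_eq_zero.1 ((map_sub f x y).symm.trans ((TwoSidedIdeal.mem_ker f).1 h1))
  exact ⟨RingCon.liftₐ _ f hle, fun x => rfl⟩

/-- `powerSum` with values in the algebra of symmetric tensors. -/
def symPowerSum (K : Type*) [Field K] {A : Type*} [Ring A] [Algebra K A] (ℓ : ℕ) :
    A →ₗ[K] symTensors K A ℓ :=
  (powerSum K ℓ).codRestrict (Subalgebra.toSubmodule (symTensors K A ℓ)) powerSum_mem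

theorem isPowerSum_symPowerSum (ℓ : ℕ) : IsPowerSum (symPowerSum K (A := A) ℓ) ℓ where
  comm a b := Subtype.ext (powerSum_comm a b)
  one := Subtype.ext (by
    rw [show ((ℓ : symTensors K A ℓ) : ⨂[K] _ : Fin ℓ, A) = ℓ from
      map_natCast (symTensors K A ℓ).val ℓ]
    exact powerSum_one)
  vanish l hl := Subtype.ext
    ((map_newton (symTensors K A ℓ).val.toRingHom l).trans (newton_powerSum_eq_zero hl))

/-- `powerSum` with values in the abelianized algebra of symmetric tensors. -/
def symPowerSumAb (K : Type*) [Field K] {A : Type*} [Ring A] [Algebra K A] (ℓ : ℕ) :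
    A →ₗ[K] SymTensorsAb K A ℓ :=
  ((commutatorIdeal (symTensors K A ℓ)).ringCon.mkₐ K).toLinearMap ∘ₗ symPowerSum K ℓ

theorem isPowerSum_symPowerSumAb (ℓ : ℕ) : IsPowerSum (symPowerSumAb K (A := A) ℓ) ℓ where
  comm a b := by
    have := congrArg ((commutatorIdeal (symTensors K A ℓ)).ringCon.mkₐ K)
      ((isPowerSum_symPowerSum (K := K) ℓ).comm a b)
    rw [map_sub, map_sub, map_mul, map_mul] at this
    exact this
  one := by
    have := congrArg ((commutatorIdeal (symTensors K A ℓ)).ringCon.mkₐ K)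
      (isPowerSum_symPowerSum (K := K) (A := A) ℓ).one
    rw [map_natCast] at this
    exact this
  vanish l hl := by
    have := congrArg ((commutatorIdeal (symTensors K A ℓ)).ringCon.mkₐ K)
      ((isPowerSum_symPowerSum (K := K) ℓ).vanish l hl)
    rw [map_zero] at this
    exact (map_newton ((commutatorIdeal (symTensors K A ℓ)).ringCon.mkₐ K).toRingHom l).symm.trans
      this

theorem symPowerSumAb_commute (K : Type*) [Field K] {A : Type*} [Ring A] [Algebra K A] (ℓ : ℕ)
    (a b : A) :
    symPowerSumAb K (A := A) ℓ a * symPowerSumAb K (A := A) ℓ b = symPowerSumAb K (A := A) ℓ b * symPowerSumAb K (A := A) ℓ a := by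
  have h : (commutatorIdeal (symTensors K A ℓ)).ringCon
      (symPowerSum K ℓ a * symPowerSum K ℓ b) (symPowerSum K ℓ b * symPowerSum K ℓ a) :=
    (TwoSidedIdeal.rel_iff _ _ _).2 (TwoSidedIdeal.subset_span ⟨_, _, rfl⟩)
  exact Quotient.sound h

variable [CharZero K]

/-- The Newton polynomial in `ℓ` arguments is multilinear, hence a linear map `s` on the whole of
`A^{⊗ℓ}`. The vanishing in `ℓ + 1` arguments makes `s` turn right multiplication by a power sum into
right multiplication by `θ`. So `s / ℓ!` is multiplicative on the subalgebra generated by the power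
sums. -/
theorem IsPowerSum.exists_lift {θ : A →ₗ[K] C} {ℓ : ℕ} (hθ : IsPowerSum θ ℓ) :
    ∃ g : Algebra.adjoin K (Set.range (powerSum K ℓ : A → _)) →ₐ[K] C,
      ∀ a h, g ⟨powerSum K ℓ a, h⟩ = θ a := by
  let s : (⨂[K] _ : Fin ℓ, A) →ₗ[K] C := PiTensorProduct.lift (newtonMultilinear hθ.comm ℓ)
  have hs : ∀ a : Fin ℓ → A, s (PiTensorProduct.tprod K a) = newton θ (List.ofFn a) := fun a =>
    PiTensorProduct.lift.tprod a
  have hfac : (ℓ.factorial : K) ≠ 0 := Nat.cast_ne_zero.2 ℓ.factorial_ne_zero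
  have hs1 : s 1 = (ℓ.factorial : K) • (1 : C) := by
    rw [PiTensorProduct.one_def, hs]
    have : List.ofFn (1 : Fin ℓ → A) = List.replicate ℓ 1 := List.ofFn_const ℓ 1
    rw [this, newton_replicate_one hθ.one, Nat.descFactorial_self, Nat.cast_smul_eq_nsmul,
      nsmul_one]
  have hsmul : ∀ (x : ⨂[K] _ : Fin ℓ, A) (a : A), s (x * powerSum K ℓ a) = s x * θ a := by
    intro x a
    induction x using PiTensorProduct.induction_on with
    | smul_tprod r w =>
      rw [smul_mul_assoc, map_smul, map_smul, smul_mul_assoc, tprod_mul_powerSum, map_sum]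
      simp only [hs]
      -- The difference of the two sides is the recursion for `newton` at `a :: List.ofFn w`, a list
      -- of length `ℓ + 1`.
      rw [← eraseSum_ofFn w (fun c => c * a) (newton_perm hθ.comm), eq_comm, ← sub_eq_zero,
        ← smul_sub, ← newton_cons, hθ.vanish _ (by simp), smul_zero]
    | add x y hx hy => rw [add_mul, map_add, map_add, add_mul, hx, hy]
  let g : (⨂[K] _ : Fin ℓ, A) →ₗ[K] C := (ℓ.factorial : K)⁻¹ • s
  have hg1 : g 1 = 1 := by
    rw [LinearMap.smul_apply, hs1, smul_smul, inv_mul_cancel₀ hfac, one_smul]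
  have hg : ∀ x y, y ∈ Algebra.adjoin K (Set.range (powerSum K ℓ : A → _)) →
      g (x * y) = g x * g y := by
    intro x y hy
    induction hy using Algebra.adjoin_induction generalizing x with
    | mem y hy =>
      obtain ⟨a, rfl⟩ := hy
      have h1 : g (powerSum K ℓ a) = θ a := by
        have := hsmul 1 a
        rw [one_mul, hs1, smul_one_mul] at this
        rw [LinearMap.smul_apply, this, smul_smul, inv_mul_cancel₀ hfac, one_smul]
      rw [h1, LinearMap.smul_apply, hsmul, LinearMap.smul_apply, smul_mul_assoc]
    | algebraMap r =>
      rw [Algebra.algebraMap_eq_smul_one, mul_smul_comm, mul_one, map_smul, map_smul, hg1,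
        mul_smul_comm, mul_one]
    | add y z _ _ hy hz => rw [mul_add, map_add, map_add, mul_add, hy, hz]
    | mul y z _ _ hy hz => rw [← mul_assoc, hz, hy, hz y, mul_assoc]
  refine ⟨AlgHom.ofLinearMap (g.comp (Subalgebra.val _).toLinearMap) hg1
    fun x y => hg _ _ y.2, fun a h => ?_⟩
  change g (powerSum K ℓ a) = θ a
  have := hsmul 1 a
  rw [one_mul, hs1, smul_one_mul] at this
  rw [LinearMap.smul_apply, this, smul_smul, inv_mul_cancel₀ hfac, one_smul]

theorem adjoin_symPowerSum (ℓ : ℕ) :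
    Algebra.adjoin K (Set.range (symPowerSum K (A := A) ℓ)) = ⊤ := by
  rw [eq_top_iff]
  rintro ⟨x, hx⟩ -
  have h : Algebra.adjoin K (Set.range (powerSum K ℓ : A → _)) =
      (Algebra.adjoin K (Set.range (symPowerSum K (A := A) ℓ))).map (symTensors K A ℓ).val := by
    rw [AlgHom.map_adjoin, ← Set.range_comp]
    rfl
  have hx' := hx
  rw [symTensors_eq_adjoin, h] at hx'
  obtain ⟨y, hy, hyx⟩ := hx'
  rwa [show (⟨x, hx⟩ : symTensors K A ℓ) = y from Subtype.ext hyx.symm]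

theorem IsPowerSum.exists_symTensors_lift {θ : A →ₗ[K] C} {ℓ : ℕ} (hθ : IsPowerSum θ ℓ) :
    ∃ g : symTensors K A ℓ →ₐ[K] C, ∀ a, g (symPowerSum K ℓ a) = θ a := by
  obtain ⟨g, hg⟩ := hθ.exists_lift
  exact ⟨g.comp (Subalgebra.equivOfEq _ _ symTensors_eq_adjoin).toAlgHom,
    fun a => hg a _⟩

theorem adjoin_symPowerSumAb (ℓ : ℕ) :
    Algebra.adjoin K (Set.range (symPowerSumAb K (A := A) ℓ)) = ⊤ := by
  have h : Set.range (symPowerSumAb K (A := A) ℓ) =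
      (commutatorIdeal (symTensors K A ℓ)).ringCon.mkₐ K '' Set.range (symPowerSum K ℓ) := by
    rw [← Set.range_comp]
    rfl
  rw [h, ← AlgHom.map_adjoin, adjoin_symPowerSum, Algebra.map_top, AlgHom.range_eq_top]
  exact RingCon.mkₐ_surjective _

/-- The image of the lift to `symTensors` is generated by the commuting values of `θ`, so the lift
kills all commutators. -/
theorem IsPowerSum.exists_symTensorsAb_lift {θ : A →ₗ[K] C} {ℓ : ℕ} (hθ : IsPowerSum θ ℓ)
    (hcomm : ∀ a b, θ a * θ b = θ b * θ a) :
    ∃ g : SymTensorsAb K A ℓ →ₐ[K] C, ∀ a, g (symPowerSumAb K (A := A) ℓ a) = θ a := by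
  obtain ⟨g, hg⟩ := hθ.exists_symTensors_lift
  have hg' : ∀ x y, g x * g y = g y * g x := by
    have h1 : ∀ x, g x ∈ Algebra.adjoin K (Set.range θ) := by
      intro x
      have hx : x ∈ Algebra.adjoin K (Set.range (symPowerSum K (A := A) ℓ)) := by
        rw [adjoin_symPowerSum]; trivial
      have : g x ∈ (Algebra.adjoin K (Set.range (symPowerSum K (A := A) ℓ))).map g := ⟨x, hx, rfl⟩
      rw [AlgHom.map_adjoin, ← Set.range_comp] at this
      convert this using 3
      funext a
      exact (hg a).symm
    intro x y
    refine (Algebra.commute_of_mem_adjoin_of_forall_mem_commute (h1 y) ?_).eq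
    rintro _ ⟨b, rfl⟩
    refine (Algebra.commute_of_mem_adjoin_of_forall_mem_commute (h1 x) ?_).symm
    rintro _ ⟨c, rfl⟩
    exact hcomm _ _
  obtain ⟨h, hh⟩ := exists_spanQuotient_lift g (s := {c | ∃ x y, c = x * y - y * x}) (by
    rintro _ ⟨x, y, rfl⟩
    rw [map_sub, map_mul, map_mul, hg', sub_self])
  exact ⟨h, fun a => (hh _).trans (hg a)⟩

end Universal

/-! ### Straightening of products of positive and negative root vectors -/

section Straightening

variable {K U U₀ C : Type*} [Field K] [Ring U] [Algebra K U] [Ring U₀] [Algebra K U₀]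
  [Ring C] [Algebra K C]

/-- The pairs `(z, ψ u)` where `z` is congruent to `u` modulo the left ideal `J`. -/
def congruenceGraph (incl : U₀ →ₐ[K] U) (J : Ideal U) (ψ : U₀ →ₐ[K] C) : Submodule K (U × C) where
  carrier := {p | ∃ u, p.1 - incl u ∈ J ∧ ψ u = p.2}
  zero_mem' := ⟨0, by simp, by simp⟩
  add_mem' := by
    rintro p q ⟨u, hu, hu'⟩ ⟨v, hv, hv'⟩
    refine ⟨u + v, ?_, by rw [map_add, hu', hv']; rfl⟩
    rw [map_add, Prod.fst_add, add_sub_add_comm]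
    exact J.add_mem hu hv
  smul_mem' := by
    rintro r p ⟨u, hu, hu'⟩
    refine ⟨r • u, ?_, by rw [map_smul, hu']; rfl⟩
    rw [map_smul, Prod.smul_fst, ← smul_sub]
    exact Submodule.smul_of_tower_mem J r hu

variable {incl : U₀ →ₐ[K] U} {J : Ideal U} {ψ : U₀ →ₐ[K] C}

theorem mem_congruenceGraph {z : U} {s : C} :
    (z, s) ∈ congruenceGraph incl J ψ ↔ ∃ u, z - incl u ∈ J ∧ ψ u = s := Iff.rfl

theorem congruenceGraph_of_mem {z : U} (hz : z ∈ J) : (z, (0 : C)) ∈ congruenceGraph incl J ψ :=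
  ⟨0, by simpa using hz, map_zero ψ⟩

theorem congruenceGraph_mul_left {z : U} {s : C} (h : (z, s) ∈ congruenceGraph incl J ψ) (u : U₀) :
    (incl u * z, ψ u * s) ∈ congruenceGraph incl J ψ := by
  obtain ⟨v, hv, hv'⟩ := mem_congruenceGraph.1 h
  refine ⟨u * v, ?_, by rw [map_mul, hv']⟩
  rw [map_mul, ← mul_sub]
  exact J.mul_mem_left _ hv

theorem congruenceGraph_mul_right (hJ : ∀ z ∈ J, ∀ u, z * incl u ∈ J) {z : U} {s : C}
    (h : (z, s) ∈ congruenceGraph incl J ψ) (u : U₀) :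
    (z * incl u, s * ψ u) ∈ congruenceGraph incl J ψ := by
  obtain ⟨v, hv, hv'⟩ := mem_congruenceGraph.1 h
  refine ⟨v * u, ?_, by rw [map_mul, hv']⟩
  rw [map_mul, ← sub_mul]
  exact hJ _ hv _

theorem eraseSum_mk {α V V' : Type*} [AddCommGroup V] [AddCommGroup V'] (l : List α)
    (G : α → List α → V) (G' : α → List α → V') :
    (eraseSum l G, eraseSum l G') = eraseSum l fun c l' => (G c l', G' c l') :=
  Prod.ext (map_eraseSum (AddMonoidHom.fst V V') l fun c l' => (G c l', G' c l')).symm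
    (map_eraseSum (AddMonoidHom.snd V V') l fun c l' => (G c l', G' c l')).symm

theorem mul_prod_map {R : Type*} (f : R → U) (g : R → R) (H : U)
    (hg : ∀ c, H * f c = f c * H + f (g c))
    (hf : ∀ a b, f a * f b = f b * f a) (l : List R) :
    H * (l.map f).prod = (l.map f).prod * H +
      eraseSum l fun c l' => ((g c :: l').map f).prod := by
  induction l with
  | nil => simp
  | cons a l ih =>
    rw [List.map_cons, List.prod_cons, ← mul_assoc, hg, add_mul, mul_assoc, ih, mul_add,
      mul_eraseSum, eraseSum_cons]
    simp only [List.map_cons, List.prod_cons]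
    rw [mul_assoc, add_assoc]
    congr 1
    rw [add_comm]
    congr 1
    refine eraseSum_congr fun c l' _ => ?_
    rw [← mul_assoc, hf, mul_assoc]

variable {R : Type*} [Ring R] [Algebra K R]

/-- The commutation relations between the root vectors `x a`, `y b` of an `sl₂` with coordinate
algebra `R` and the elements `h b = [x 1, y b]`. -/
structure IsSl2Triple (incl : U₀ →ₐ[K] U) (J : Ideal U) (x y : R →ₗ[K] U) (h : R → U₀) :
    Prop where
  mul_mem : ∀ z ∈ J, ∀ u, z * incl u ∈ J
  x_mem : x 1 ∈ J
  xx : ∀ a b, x a * x b = x b * x a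
  yy : ∀ a b, y a * y b = y b * y a
  xy : ∀ b, x 1 * y b = y b * x 1 + incl (h b)
  hy : ∀ b c, incl (h b) * y c = y c * incl (h b) - y (b * c + c * b)
  hx : ∀ b c, incl (h b) * x c = x c * incl (h b) + x (b * c + c * b)

variable {x y : R →ₗ[K] U} {h : R → U₀}

/-- Commuting `x 1` past `y b` creates `h b`, and moving `h b` to the right past a later `y c` costs
`y (b * c + c * b)`. On the right-hand side this cost is shared: `c * b` belongs to the choice of
`b` as removed entry, `b * c` to the choice of `c`. That makes the formula symmetric in the list. -/
theorem IsSl2Triple.x_mul_prod (H : IsSl2Triple incl J x y h) (l : List R) :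
    x 1 * (l.map y).prod = (l.map y).prod * x 1 + eraseSum l fun b l' =>
      (l'.map y).prod * incl (h b) - eraseSum l' fun c l'' => ((c * b :: l'').map y).prod := by
  induction l with
  | nil => simp
  | cons a l ih =>
    have hyl : incl (h a) * (l.map y).prod = (l.map y).prod * incl (h a) -
        ((eraseSum l fun c l' => ((a * c :: l').map y).prod) +
          eraseSum l fun c l' => ((c * a :: l').map y).prod) := by
      rw [mul_prod_map y (fun c => -(a * c + c * a)) _
        (fun c => by rw [H.hy, map_neg, sub_eq_add_neg]) H.yy, ← eraseSum_add, sub_eq_add_neg,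
        ← eraseSum_neg]
      simp only [List.map_cons, List.prod_cons, map_neg, map_add, neg_mul, add_mul]
    rw [List.map_cons, List.prod_cons, ← mul_assoc, H.xy, add_mul, mul_assoc, ih, mul_add,
      mul_eraseSum, hyl, eraseSum_cons]
    rw [eraseSum_congr (l := l)
      (G := fun c l' => ((a :: l').map y).prod * incl (h c) -
        eraseSum (a :: l') fun d l'' => ((d * c :: l'').map y).prod)
      (H := fun c l' => y a * ((l'.map y).prod * incl (h c) -
        eraseSum l' fun d l'' => ((d * c :: l'').map y).prod) - ((a * c :: l').map y).prod)]
    · rw [eraseSum_sub, mul_assoc]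
      abel
    · intro c l' _
      rw [eraseSum_cons, mul_sub, mul_eraseSum, List.map_cons, List.prod_cons, mul_assoc]
      rw [eraseSum_congr (l := l') (G := fun d l'' => ((d * c :: a :: l'').map y).prod)
        (H := fun d l'' => y a * ((d * c :: l'').map y).prod)]
      · abel
      · intro d l'' _
        simp only [List.map_cons, List.prod_cons]
        rw [← mul_assoc, H.yy, mul_assoc]

/-- One factor `x 1` is absorbed at a time. The term still ending in `x 1` lies in `J`, and the
remaining terms reproduce the symmetrised Newton recursion; the absorption step at length `m + 1`
contributes the factor `m + 1` of the factorial. -/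
theorem IsSl2Triple.pow_mul_prod (H : IsSl2Triple incl J x y h) {θ : R → C}
    (hθ : ∀ a b, θ a * θ b - θ b * θ a = θ (a * b) - θ (b * a)) (hψ : ∀ b, ψ (h b) = θ b)
    (l : List R) :
    (x 1 ^ l.length * (l.map y).prod, l.length.factorial • newton θ l) ∈
      congruenceGraph incl J ψ := by
  induction hm : l.length generalizing l with
  | zero =>
    rw [List.length_eq_zero_iff.1 hm]
    exact ⟨1, by simp, by simp⟩
  | succ m ih =>
    rw [pow_succ, mul_assoc, H.x_mul_prod, Nat.factorial_succ, mul_comm, mul_smul, ← hm,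
      length_smul_newton hθ, mul_add, mul_eraseSum,
      ← zero_add (m.factorial • eraseSum _ _), ← Prod.mk_add_mk]
    refine add_mem (congruenceGraph_of_mem ?_) ?_
    · rw [← mul_assoc]
      exact J.mul_mem_left _ H.x_mem
    · have h1 : ∀ G : R → List R → C, m.factorial • eraseSum l G =
          eraseSum l fun c l' => m.factorial • G c l' := fun G =>
        map_eraseSum (nsmulAddMonoidHom (α := C) m.factorial) l G
      rw [h1, eraseSum_mk]
      refine eraseSum_mem _ fun b l' hl' => ?_
      have hlen : l'.length = m := by
        have := hl'.length_eq
        rw [List.length_cons] at this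
        omega
      rw [mul_sub, smul_sub, ← Prod.mk_sub_mk, mul_eraseSum]
      refine sub_mem ?_ ?_
      · rw [← mul_assoc, ← smul_mul_assoc, ← hψ]
        exact congruenceGraph_mul_right H.mul_mem (ih l' hlen) _
      · rw [show m.factorial • eraseSum l' (fun c l'' => newton θ (c * b :: l'')) =
          eraseSum l' fun c l'' => m.factorial • newton θ (c * b :: l'') from
          map_eraseSum (nsmulAddMonoidHom (α := C) m.factorial) _ _, eraseSum_mk]
        refine eraseSum_mem _ fun c l'' hl'' => ih _ ?_
        have := hl''.length_eq
        rw [List.length_cons] at this ⊢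
        omega

/-- The action of `h a` turns `x 1 ^ (j + 1)` into a nonzero multiple of `x a * x 1 ^ j`. Hence
general factors `x a` arise from powers of `x 1` by commutators with `h a`, and congruence to
something killed by `ψ` is preserved by multiplication with `h a` on both sides. -/
theorem IsSl2Triple.prod_mul_prod_mem [CharZero K] (H : IsSl2Triple incl J x y h) {m : ℕ}
    (hm : ∀ l : List R, l.length = m →
      (x 1 ^ m * (l.map y).prod, (0 : C)) ∈ congruenceGraph incl J ψ)
    (k l : List R) (hk : k.length = m) (hl : l.length = m) :
    ((k.map x).prod * (l.map y).prod, (0 : C)) ∈ congruenceGraph incl J ψ := by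
  -- Induction on the number `p` of general factors; the other `j` factors are `x 1`.
  have key : ∀ p (k : List R), k.length = p → ∀ j (l : List R), p + j = m → l.length = m →
      ((k.map x).prod * (x 1 ^ j * (l.map y).prod), (0 : C)) ∈ congruenceGraph incl J ψ := by
    intro p
    induction p with
    | zero =>
      intro k hk j l hj hl
      rw [List.length_eq_zero_iff.1 hk, List.map_nil, List.prod_nil, one_mul]
      obtain rfl : j = m := by omega
      exact hm l hl
    | succ p ih =>
      rintro (_ | ⟨a, k⟩) hk j l hj hl
      · simp at hk
      rw [List.length_cons] at hk
      have hxk : incl (h a) * (k.map x).prod = (k.map x).prod * incl (h a) +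
          eraseSum k fun c k' => (((a * c + c * a) :: k').map x).prod :=
        mul_prod_map x _ _ (H.hx a) H.xx k
      have hyl : incl (h a) * (l.map y).prod = (l.map y).prod * incl (h a) +
          eraseSum l fun c k' => ((-(a * c + c * a) :: k').map y).prod :=
        mul_prod_map y _ _ (fun c => by rw [H.hy, map_neg, sub_eq_add_neg]) H.yy l
      have hxj : ∀ j : ℕ, incl (h a) * x 1 ^ (j + 1) = x 1 ^ (j + 1) * incl (h a) +
          (2 * (j + 1) : K) • (x a * x 1 ^ j) := by
        intro j
        have h1 : incl (h a) * x 1 = x 1 * incl (h a) + (2 : K) • x a := by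
          rw [H.hx, mul_one, one_mul, ← two_smul K a, map_smul]
        induction j with
        | zero => simpa using h1
        | succ j ihj =>
          have h2 : x 1 ^ (j + 1) * x a = x a * x 1 ^ (j + 1) :=
            ((show Commute (x 1) (x a) from H.xx 1 a).pow_left _).eq
          rw [pow_succ _ (j + 1), ← mul_assoc, ihj, add_mul, mul_assoc, h1, mul_add,
            smul_mul_assoc, mul_assoc (x a), ← pow_succ, mul_smul_comm, h2, ← mul_assoc,
            add_assoc, ← add_smul]
          congr 2
          push_cast
          ring
      have hcomm : (k.map x).prod * x a = x a * (k.map x).prod := by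
        refine (Commute.list_prod_right _ _ fun z hz => ?_).symm.eq
        obtain ⟨c, -, rfl⟩ := List.mem_map.1 hz
        exact H.xx a c
      -- The commutator of `h a` with the whole product, solved for the contribution of `x 1 ^ (j +
      -- 1)`. All other terms have one general factor fewer.
      have heq : (2 * (j + 1) : K) • (((a :: k).map x).prod * (x 1 ^ j * (l.map y).prod)) =
          incl (h a) * ((k.map x).prod * (x 1 ^ (j + 1) * (l.map y).prod)) -
          (k.map x).prod * (x 1 ^ (j + 1) * (l.map y).prod) * incl (h a) -
          (eraseSum k fun c k' =>
            (((a * c + c * a) :: k').map x).prod * (x 1 ^ (j + 1) * (l.map y).prod)) -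
          eraseSum l fun c k' => (k.map x).prod * (x 1 ^ (j + 1) *
            ((-(a * c + c * a) :: k').map y).prod) := by
        rw [← eraseSum_mul_right, ← mul_eraseSum, ← mul_eraseSum, ← mul_assoc (incl (h a)), hxk,
          add_mul, mul_assoc (k.map x).prod (incl (h a)), ← mul_assoc (incl (h a)), hxj, add_mul,
          mul_assoc (x 1 ^ (j + 1)) (incl (h a)), hyl, List.map_cons, List.prod_cons, ← hcomm]
        simp only [mul_add, mul_assoc, smul_mul_assoc, mul_smul_comm]
        abel
      have h2 : (2 * (j + 1) : K) ≠ 0 := by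
        exact_mod_cast (by positivity : 2 * (j + 1) ≠ 0)
      rw [← (congruenceGraph incl J ψ).smul_mem_iff h2, Prod.smul_mk, smul_zero, heq]
      have hmain := ih k (by omega) (j + 1) l (by omega) hl
      have e1 := congruenceGraph_mul_left hmain (h a)
      have e2 := congruenceGraph_mul_right H.mul_mem hmain (h a)
      have e3 : ((eraseSum k fun c k' =>
          (((a * c + c * a) :: k').map x).prod * (x 1 ^ (j + 1) * (l.map y).prod)), (0 : C)) ∈
          congruenceGraph incl J ψ := by
        rw [show (0 : C) = eraseSum k fun _ _ => 0 by rw [eraseSum_const, smul_zero], eraseSum_mk]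
        refine eraseSum_mem _ fun c k' hk' => ih _ ?_ _ _ (by omega) hl
        have := hk'.length_eq
        rw [List.length_cons] at this ⊢
        omega
      have e4 : ((eraseSum l fun c k' => (k.map x).prod * (x 1 ^ (j + 1) *
            ((-(a * c + c * a) :: k').map y).prod)), (0 : C)) ∈ congruenceGraph incl J ψ := by
        rw [show (0 : C) = eraseSum l fun _ _ => 0 by rw [eraseSum_const, smul_zero], eraseSum_mk]
        refine eraseSum_mem _ fun c k' hk' => ih _ (by omega) _ _ (by omega) ?_
        have := hk'.length_eq
        rw [List.length_cons] at this ⊢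
        omega
      simpa using sub_mem (sub_mem (sub_mem e1 e2) e3) e4
  simpa using key m k hk 0 l (by omega) hl

end Straightening

/-! ### Affine actions on a symmetric algebra -/

section Affine

variable {K W β : Type*} [Field K] [AddCommGroup W] [Module K W] (b : Module.Basis β K W)

/-- The embedding of a vector space as the space of linear forms of its symmetric algebra. -/
def linForm : W →ₗ[K] MvPolynomial β K := b.constr K MvPolynomial.X

theorem linForm_basis (i : β) : linForm b (b i) = MvPolynomial.X i := b.constr_basis K _ i

/-- The derivation of the symmetric algebra of `W` that extends an endomorphism of `W`. -/
def derOfEnd (f : Module.End K W) : Derivation K (MvPolynomial β K) (MvPolynomial β K) :=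
  MvPolynomial.mkDerivation K fun i => linForm b (f (b i))

theorem derOfEnd_linForm (f : Module.End K W) (w : W) :
    derOfEnd b f (linForm b w) = linForm b (f w) := by
  have h : (derOfEnd b f).toLinearMap ∘ₗ linForm b = linForm b ∘ₗ f := by
    refine b.ext fun i => ?_
    change derOfEnd b f (linForm b (b i)) = linForm b (f (b i))
    rw [linForm_basis, derOfEnd, MvPolynomial.mkDerivation_X]
  exact LinearMap.congr_fun h w

theorem derivation_ext_linForm {D D' : Derivation K (MvPolynomial β K) (MvPolynomial β K)}
    (h : ∀ w, D (linForm b w) = D' (linForm b w)) : D = D' :=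
  MvPolynomial.derivation_ext fun i => by rw [← linForm_basis b, h]

theorem derOfEnd_add (f g : Module.End K W) :
    derOfEnd b (f + g) = derOfEnd b f + derOfEnd b g :=
  derivation_ext_linForm b fun w => by
    rw [Derivation.add_apply, derOfEnd_linForm, derOfEnd_linForm, derOfEnd_linForm,
      LinearMap.add_apply, map_add]

theorem derOfEnd_smul (c : K) (f : Module.End K W) :
    derOfEnd b (c • f) = c • derOfEnd b f :=
  derivation_ext_linForm b fun w => by
    rw [Derivation.smul_apply, derOfEnd_linForm, derOfEnd_linForm, LinearMap.smul_apply, map_smul]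

theorem derOfEnd_lie (f g : Module.End K W) :
    derOfEnd b (f * g - g * f) = ⁅derOfEnd b f, derOfEnd b g⁆ :=
  derivation_ext_linForm b fun w => by
    rw [Derivation.commutator_apply, derOfEnd_linForm, derOfEnd_linForm, derOfEnd_linForm,
      derOfEnd_linForm, derOfEnd_linForm, LinearMap.sub_apply, map_sub, Module.End.mul_apply,
      Module.End.mul_apply]

/-- The operator on the symmetric algebra that is the sum of the derivation extending the
endomorphism `f` and of the multiplication by `f w₀`. -/
def affineOperator (w₀ : W) (f : Module.End K W) : Module.End K (MvPolynomial β K) :=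
  (derOfEnd b f : MvPolynomial β K →ₗ[K] MvPolynomial β K) +
    LinearMap.mulLeft K (linForm b (f w₀))

theorem affineOperator_apply (w₀ : W) (f : Module.End K W) (p : MvPolynomial β K) :
    affineOperator b w₀ f p = derOfEnd b f p + linForm b (f w₀) * p := rfl

/-- Formally, `affineOperator` describes the derivation action on `Sym(W) · exp(w₀)`: the derivation
of `f` maps `p exp(w₀)` to `(f p + f(w₀) p) exp(w₀)`. Hence it respects brackets. -/
theorem affineOperator_lie (w₀ : W) (f g : Module.End K W) :
    affineOperator b w₀ (f * g - g * f) = affineOperator b w₀ f * affineOperator b w₀ g -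
      affineOperator b w₀ g * affineOperator b w₀ f := by
  refine LinearMap.ext fun p => ?_
  rw [LinearMap.sub_apply, Module.End.mul_apply, Module.End.mul_apply, affineOperator_apply,
    affineOperator_apply, affineOperator_apply, affineOperator_apply, affineOperator_apply,
    derOfEnd_lie, Derivation.commutator_apply, map_add, map_add, Derivation.leibniz,
    Derivation.leibniz, derOfEnd_linForm, derOfEnd_linForm, LinearMap.sub_apply, map_sub,
    Module.End.mul_apply, Module.End.mul_apply]
  simp only [smul_eq_mul]
  ring

/-- The action of the endomorphisms of `W` on the symmetric algebra by `affineOperator`. -/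
def affineAction (w₀ : W) : Module.End K W →ₗ⁅K⁆ Module.End K (MvPolynomial β K) where
  toFun f := affineOperator b w₀ f
  map_add' f g := LinearMap.ext fun p => by
    rw [LinearMap.add_apply, affineOperator_apply, affineOperator_apply, affineOperator_apply,
      derOfEnd_add, Derivation.add_apply, LinearMap.add_apply, map_add, add_mul,
      add_add_add_comm]
  map_smul' c f := LinearMap.ext fun p => by
    rw [RingHom.id_apply, LinearMap.smul_apply, affineOperator_apply, affineOperator_apply,
      derOfEnd_smul, Derivation.smul_apply, LinearMap.smul_apply, map_smul, smul_mul_assoc,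
      smul_add]
  map_lie' {f g} := affineOperator_lie b w₀ f g

theorem affineAction_apply (w₀ : W) (f : Module.End K W) (p : MvPolynomial β K) :
    affineAction b w₀ f p = derOfEnd b f p + linForm b (f w₀) * p := rfl

theorem derOfEnd_prod (f : Module.End K W) (l : List W) :
    derOfEnd b f (l.map (linForm b)).prod =
      eraseSum l fun w l' => ((f w :: l').map (linForm b)).prod := by
  induction l with
  | nil => simp
  | cons w l ih =>
    rw [List.map_cons, List.prod_cons, Derivation.leibniz, ih, smul_eq_mul, smul_eq_mul,
      derOfEnd_linForm, mul_eraseSum, eraseSum_cons, add_comm]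
    refine congrArg₂ (· + ·) ?_ (eraseSum_congr fun c l' _ => ?_)
    · rw [List.map_cons, List.prod_cons, mul_comm]
    · rw [List.map_cons, List.prod_cons, List.map_cons, List.map_cons, List.prod_cons,
        List.prod_cons, mul_left_comm]

variable {R C : Type*} [Ring R] [Algebra K R] [Ring C] [Algebra K C] {θ : R →ₗ[K] C}
  (pr : W →ₗ[K] R)

variable (θ) in
/-- The linear map on the symmetric algebra of `W` that extends `newton θ`. -/
def newtonFunctional : MvPolynomial β K →ₗ[K] C :=
  (MvPolynomial.basisMonomials β K).constr K fun s =>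
    newton θ ((Finsupp.toMultiset s).toList.map fun i => pr (b i))

theorem prod_map_X (s : β →₀ ℕ) (l : List β) (h : (l : Multiset β) = Finsupp.toMultiset s) :
    ((l.map MvPolynomial.X).prod : MvPolynomial β K) = MvPolynomial.basisMonomials β K s := by
  classical
  rw [MvPolynomial.coe_basisMonomials]
  induction l generalizing s with
  | nil =>
    have : s = 0 := by
      rw [← Finsupp.toMultiset_toFinsupp s, ← h]
      exact map_zero Multiset.toFinsupp
    simp [this]
  | cons i l ih =>
    have hs : s = Finsupp.single i 1 + Multiset.toFinsupp (l : Multiset β) := by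
      rw [← Finsupp.toMultiset_toFinsupp s, ← h, ← Multiset.cons_coe, ← Multiset.singleton_add,
        map_add, Multiset.toFinsupp_singleton]
    rw [List.map_cons, List.prod_cons, ih _ (Multiset.toFinsupp_toMultiset _).symm,
      MvPolynomial.X, MvPolynomial.monomial_mul, one_mul, hs]

theorem newtonFunctional_monomial
    (hθ : ∀ a b, θ a * θ b - θ b * θ a = θ (a * b) - θ (b * a)) (l : List β) :
    newtonFunctional b θ pr (l.map MvPolynomial.X).prod =
      newton θ (l.map fun i => pr (b i)) := by
  classical
  rw [prod_map_X (Multiset.toFinsupp (l : Multiset β)) l (Multiset.toFinsupp_toMultiset _).symm,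
    newtonFunctional, Module.Basis.constr_basis]
  refine newton_perm hθ _ _ (List.Perm.map _ ?_)
  rw [← Multiset.coe_eq_coe, Multiset.coe_toList, Multiset.toFinsupp_toMultiset]

theorem newtonFunctional_prod
    (hθ : ∀ a b, θ a * θ b - θ b * θ a = θ (a * b) - θ (b * a)) (l : List W) :
    newtonFunctional b θ pr (l.map (linForm b)).prod = newton θ (l.map pr) := by
  -- The tail of basis vectors makes the induction possible: the head is replaced by a basis vector
  -- by linearity and then moved into the tail.
  have key : ∀ (l : List W) (m : List β),
      newtonFunctional b θ pr ((l.map (linForm b)).prod * (m.map MvPolynomial.X).prod) =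
        newton θ (l.map pr ++ m.map fun i => pr (b i)) := by
    intro l
    induction l with
    | nil =>
      intro m
      simpa using newtonFunctional_monomial b pr hθ m
    | cons w l ih =>
      intro m
      let F : W →ₗ[K] C :=
        { toFun := fun w => newton θ ((w :: l).map pr ++ m.map fun i => pr (b i))
          map_add' := fun v w => by
            rw [List.map_cons, List.cons_append, map_add, newton_cons_add]
            rfl
          map_smul' := fun r w => by
            rw [List.map_cons, List.cons_append, map_smul, newton_cons_smul]
            rfl }
      have h : newtonFunctional b θ pr ∘ₗ LinearMap.mulRight K
          ((l.map (linForm b)).prod * (m.map MvPolynomial.X).prod) ∘ₗ linForm b = F := by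
        refine b.ext fun i => ?_
        have := ih (i :: m)
        rw [List.map_cons, List.prod_cons, List.map_cons, mul_left_comm] at this
        change newtonFunctional b θ pr (linForm b (b i) * _) =
          newton θ ((b i :: l).map pr ++ m.map fun i => pr (b i))
        rw [linForm_basis, this]
        exact newton_perm hθ _ _ List.perm_middle
      have := LinearMap.congr_fun h w
      rw [List.map_cons, List.prod_cons, mul_assoc]
      exact this
  simpa using key l []

/-- This is the Newton recursion read backwards: multiplication by `r w₀` puts `Y` at the head of
the list, the derivation replaces each entry `c` by `c * Y`, and the two together give `newton θ l *
θ Y`. -/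
theorem newtonFunctional_affineAction
    (hθ : ∀ a b, θ a * θ b - θ b * θ a = θ (a * b) - θ (b * a)) {w₀ : W} {r : Module.End K W}
    {Y : R} (hr : ∀ w, pr (r w) = pr w * Y) (h₀ : pr (r w₀) = Y) (p : MvPolynomial β K) :
    newtonFunctional b θ pr (affineAction b w₀ r p) = newtonFunctional b θ pr p * θ Y := by
  suffices h : newtonFunctional b θ pr ∘ₗ affineAction b w₀ r =
      LinearMap.mulRight K (θ Y) ∘ₗ newtonFunctional b θ pr from LinearMap.congr_fun h p
  refine (MvPolynomial.basisMonomials β K).ext fun s => ?_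
  have hs : MvPolynomial.basisMonomials β K s =
      (((Finsupp.toMultiset s).toList.map b).map (linForm b)).prod := by
    rw [List.map_map, show linForm b ∘ b = MvPolynomial.X from funext (linForm_basis b)]
    exact (prod_map_X s _ (Multiset.coe_toList _)).symm
  generalize (Finsupp.toMultiset s).toList.map b = l at hs
  rw [hs, LinearMap.comp_apply, LinearMap.comp_apply, affineAction_apply, map_add,
    derOfEnd_prod, map_eraseSum, LinearMap.mulRight_apply, newtonFunctional_prod b pr hθ,
    ← List.prod_cons, ← List.map_cons, newtonFunctional_prod b pr hθ, List.map_cons, h₀,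
    newton_cons, eraseSum_map, add_comm, sub_add]
  rw [sub_eq_self, sub_eq_zero]
  refine eraseSum_congr fun w l' _ => ?_
  rw [newtonFunctional_prod b pr hθ, List.map_cons, hr]

end Affine

/-! ### Linear functionals on an enveloping algebra -/

section Functional

variable {K L : Type*} [Field K] [LieRing L] [LieAlgebra K L]

theorem adjoin_range_ι :
    Algebra.adjoin K (Set.range (UniversalEnvelopingAlgebra.ι K : L → _)) = ⊤ := by
  rw [eq_top_iff]
  rintro u -
  let S := Algebra.adjoin K (Set.range (UniversalEnvelopingAlgebra.ι K : L → _))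
  let f : L →ₗ⁅K⁆ S :=
    { toFun := fun x => ⟨UniversalEnvelopingAlgebra.ι K x, Algebra.subset_adjoin ⟨x, rfl⟩⟩
      map_add' := fun x y => Subtype.ext (map_add _ x y)
      map_smul' := fun r x => Subtype.ext (map_smul _ r x)
      map_lie' := fun {x y} => Subtype.ext (LieHom.map_lie _ x y) }
  have h : S.val.comp (UniversalEnvelopingAlgebra.lift K f) = AlgHom.id K _ := by
    apply UniversalEnvelopingAlgebra.hom_ext
    ext x
    simp [f]
  rw [← AlgHom.id_apply (R := K) u, ← h]
  exact (UniversalEnvelopingAlgebra.lift K f u).2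

variable {W R C : Type*} [AddCommGroup W] [Module K W] [Ring R] [Algebra K R] [Ring C]
  [Algebra K C] {θ : R →ₗ[K] C}

/-- Take `χ u` to be `newtonFunctional` of `u · 1` for the affine action on `Sym(W)`. If `x` moves
`w₀` as `r Y` does, then `x · 1 = r Y · 1`; since `r Y` commutes with the action of `U(L)`, it can
be pulled out in front of `u`, where the functional converts it into right multiplication by `θ Y`.
-/
theorem exists_enveloping_functional
    (hθ : ∀ a b, θ a * θ b - θ b * θ a = θ (a * b) - θ (b * a)) (σ : L →ₗ⁅K⁆ Module.End K W)
    (w₀ : W) (r : R → Module.End K W) (pr : W →ₗ[K] R) (hσ : ∀ x Y w, σ x (r Y w) = r Y (σ x w))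
    (hpr : ∀ Y w, pr (r Y w) = pr w * Y) :
    ∃ χ : UniversalEnvelopingAlgebra K L →ₗ[K] C, χ 1 = 1 ∧
      ∀ x Y, σ x w₀ = r Y w₀ → pr (r Y w₀) = Y →
        ∀ u, χ (u * UniversalEnvelopingAlgebra.ι K x) = χ u * θ Y := by
  let b := Module.Basis.ofVectorSpace K W
  let ρ := UniversalEnvelopingAlgebra.lift K ((affineAction b w₀).comp σ)
  have hρ : ∀ x p, ρ (UniversalEnvelopingAlgebra.ι K x) p = affineAction b w₀ (σ x) p := by
    intro x p
    rw [UniversalEnvelopingAlgebra.lift_ι_apply]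
    rfl
  have hcomm : ∀ Y u, Commute (affineAction b w₀ (r Y)) (ρ u) := by
    intro Y u
    have hu : u ∈ Algebra.adjoin K (Set.range (UniversalEnvelopingAlgebra.ι K : L → _)) := by
      rw [adjoin_range_ι]; trivial
    induction hu using Algebra.adjoin_induction with
    | mem u hu =>
      obtain ⟨x, rfl⟩ := hu
      have h0 : ⁅r Y, σ x⁆ = 0 := by
        rw [LieRing.of_associative_ring_bracket, sub_eq_zero]
        exact LinearMap.ext fun w => (hσ x Y w).symm
      have h1 := LieHom.map_lie (affineAction b w₀) (r Y) (σ x)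
      rw [h0, map_zero, LieRing.of_associative_ring_bracket, eq_comm, sub_eq_zero] at h1
      rw [UniversalEnvelopingAlgebra.lift_ι_apply]
      exact h1
    | algebraMap c => rw [AlgHom.commutes]; exact Algebra.commute_algebraMap_right _ _
    | add u v _ _ hu hv => rw [map_add]; exact hu.add_right hv
    | mul u v _ _ hu hv => rw [map_mul]; exact hu.mul_right hv
  refine ⟨newtonFunctional b θ pr ∘ₗ LinearMap.applyₗ 1 ∘ₗ ρ.toLinearMap, ?_, ?_⟩
  · change newtonFunctional b θ pr (ρ 1 1) = 1
    rw [map_one ρ]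
    simpa using newtonFunctional_prod b pr hθ []
  · intro x Y hx hY u
    change newtonFunctional b θ pr (ρ (u * _) 1) = newtonFunctional b θ pr (ρ u 1) * θ Y
    have h1 : affineAction b w₀ (σ x) 1 = affineAction b w₀ (r Y) 1 := by
      rw [affineAction_apply, affineAction_apply, hx]
      simp
    rw [map_mul, Module.End.mul_apply, hρ, h1, ← Module.End.mul_apply, ← (hcomm Y u).eq,
      Module.End.mul_apply, newtonFunctional_affineAction b pr hθ (hpr Y) hY]

end Functional

/-! ### Independence of the Harish-Chandra representative -/

section Uniqueness

variable {K : Type*} [Field K] {L : Type*} [LieRing L] [LieAlgebra K L] {T : Type*}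
  [AddCommGroup T] [Module K T] {τ : T →ₗ[K] L} {pos : Set (Module.Dual K T)}
  {C : Type*} [Ring C] [Algebra K C]

/-- The left ideal of the enveloping algebra generated by the positive part. -/
abbrev posIdeal (τ : T →ₗ[K] L) (pos : Set (Module.Dual K T)) :
    Ideal (UniversalEnvelopingAlgebra K L) :=
  Ideal.span ((fun x : L => UniversalEnvelopingAlgebra.ι K x) '' (posPart τ pos : Set L))

theorem envelopingIncl_ι (x : zeroPart τ) :
    envelopingIncl τ (UniversalEnvelopingAlgebra.ι K x) =
      UniversalEnvelopingAlgebra.ι K (x : L) := by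
  rw [envelopingIncl, UniversalEnvelopingAlgebra.lift_ι_apply]
  rfl

/-- The functional `χ` kills the left ideal generated by `L₊` and equals the extension of `φ` on
`U(L₀)`, so an element of `U(L₀)` whose image lies in that ideal is killed by the extension of `φ`.
This is the part of uniqueness in the Poincaré–Birkhoff–Witt decomposition that the theorem needs.
-/
theorem eq_zero_of_mem_congruenceGraph {φ : zeroPart τ →ₗ⁅K⁆ C}
    {χ : UniversalEnvelopingAlgebra K L →ₗ[K] C} (h1 : χ 1 = 1)
    (h0 : ∀ (x : zeroPart τ) u, χ (u * UniversalEnvelopingAlgebra.ι K (x : L)) = χ u * φ x)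
    (hpos : ∀ x ∈ posPart τ pos, ∀ u, χ (u * UniversalEnvelopingAlgebra.ι K x) = 0) {s : C}
    (hs : (0, s) ∈ congruenceGraph (envelopingIncl τ) (posIdeal τ pos)
      (UniversalEnvelopingAlgebra.lift K φ)) : s = 0 := by
  obtain ⟨u, hu, rfl⟩ := hs
  rw [zero_sub] at hu
  have hJ : ∀ z ∈ posIdeal τ pos, χ z = 0 := by
    intro z hz
    refine Submodule.span_induction (p := fun z _ => ∀ u, χ (u * z) = 0) ?_ ?_ ?_ ?_ hz 1 |>
      fun h => by rwa [one_mul] at h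
    · rintro _ ⟨x, hx, rfl⟩ u
      exact hpos x hx u
    · intro u; rw [mul_zero, map_zero]
    · intro x y _ _ hx hy u; rw [mul_add, map_add, hx, hy, add_zero]
    · intro a x _ hx u; rw [smul_eq_mul, ← mul_assoc]; exact hx _
  have hincl : ∀ v, χ (v * envelopingIncl τ u) =
      χ v * UniversalEnvelopingAlgebra.lift K φ u := by
    have hu : u ∈ Algebra.adjoin K
        (Set.range (UniversalEnvelopingAlgebra.ι K : zeroPart τ → _)) := by
      rw [adjoin_range_ι]; trivial
    clear * - h0 hu
    induction hu using Algebra.adjoin_induction with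
    | mem u hu =>
      obtain ⟨x, rfl⟩ := hu
      intro v
      rw [envelopingIncl_ι, h0, UniversalEnvelopingAlgebra.lift_ι_apply]
    | algebraMap c =>
      intro v
      rw [AlgHom.commutes, AlgHom.commutes, ← Algebra.commutes, ← Algebra.commutes,
        ← Algebra.smul_def, ← Algebra.smul_def, map_smul]
    | add u v _ _ hu hv => intro w; simp only [map_add, mul_add, hu, hv]
    | mul u v _ _ hu hv =>
      intro w
      rw [map_mul (envelopingIncl τ), map_mul (UniversalEnvelopingAlgebra.lift K φ), ← mul_assoc,
        hv, hu, mul_assoc]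
  have := hincl 1
  rw [one_mul, h1, one_mul] at this
  rw [← this, ← neg_eq_zero, ← map_neg]
  exact hJ _ hu

end Uniqueness

/-! ### Root spaces of `sl_n(A)` -/

section RootSpaces

variable {K : Type u} [Field K] {A : Type v} [Ring A] [Algebra K A] {n : ℕ}

/-- The trace zero diagonal matrix with entries `n - |S|` at the indices in `S` and `-|S|` at the
other ones. -/
def testElement (K : Type u) [Field K] (S : Finset (Fin n)) : cartan K n :=
  ⟨Matrix.diagonal fun p => (if p ∈ S then (n : K) else 0) - S.card,
    Matrix.isDiag_diagonal _, by
      rw [Matrix.trace_diagonal, Finset.sum_sub_distrib, Finset.sum_ite_mem, Finset.univ_inter,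
        Finset.sum_const, Finset.sum_const, Finset.card_univ, Fintype.card_fin, nsmul_eq_mul,
        nsmul_eq_mul, mul_comm, sub_self]⟩

theorem eps_sub_eps_testElement (S : Finset (Fin n)) (p q : Fin n) :
    (eps K n p - eps K n q) (testElement K S) =
      n * ((if p ∈ S then 1 else 0) - (if q ∈ S then 1 else 0)) := by
  change (Matrix.diagonal _ : Matrix (Fin n) (Fin n) K) p p - Matrix.diagonal _ q q = _
  rw [Matrix.diagonal_apply_eq, Matrix.diagonal_apply_eq]
  split_ifs <;> ring

theorem lie_cartanIncl_apply (t : cartan K n) (x : sl K A n) (p q : Fin n) :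
    ((⁅cartanIncl K A n t, x⁆ : sl K A n) : Matrix (Fin n) (Fin n) A) p q =
      ((eps K n p - eps K n q) t) • (x : Matrix (Fin n) (Fin n) A) p q := by
  have ht : ((cartanIncl K A n t : sl K A n) : Matrix (Fin n) (Fin n) A) =
      Matrix.diagonal fun i => algebraMap K A ((t : Matrix (Fin n) (Fin n) K) i i) := by
    change (t : Matrix (Fin n) (Fin n) K).map (algebraMap K A) = _
    conv_lhs => rw [← t.2.1.diagonal_diag]
    rw [Matrix.diagonal_map (map_zero _)]
    rfl
  have h1 : ((⁅cartanIncl K A n t, x⁆ : sl K A n) : Matrix (Fin n) (Fin n) A) =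
      ⁅((cartanIncl K A n t : sl K A n) : Matrix (Fin n) (Fin n) A), (x : Matrix (Fin n) (Fin n) A)⁆ :=
    rfl
  rw [h1, LieRing.of_associative_ring_bracket, ht, Matrix.sub_apply, Matrix.diagonal_mul,
    Matrix.mul_diagonal, ← Algebra.commutes, ← sub_mul, ← map_sub, ← Algebra.smul_def]
  rfl

theorem mem_weightSpace_iff {β : Module.Dual K (cartan K n)} {x : sl K A n} :
    x ∈ weightSpace (cartanIncl K A n) β ↔ ∀ t p q,
      ((eps K n p - eps K n q) t) • (x : Matrix (Fin n) (Fin n) A) p q =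
        β t • (x : Matrix (Fin n) (Fin n) A) p q := by
  constructor
  · intro hx t p q
    rw [← lie_cartanIncl_apply, hx t]
    rfl
  · intro h t
    refine Subtype.ext (Matrix.ext fun p q => ?_)
    rw [lie_cartanIncl_apply, h]
    rfl

theorem mem_weightSpace_of_support {i j : Fin n} {x : sl K A n}
    (h : ∀ p q, ¬(p = i ∧ q = j) → (x : Matrix (Fin n) (Fin n) A) p q = 0) :
    x ∈ weightSpace (cartanIncl K A n) (eps K n i - eps K n j) := by
  rw [mem_weightSpace_iff]
  intro t p q
  by_cases hpq : p = i ∧ q = j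
  · rw [hpq.1, hpq.2]
  · rw [h p q hpq, smul_zero, smul_zero]

/-- The matrix `a E_{pq}` as an element of `sl_n(A)`. -/
def rootVector (K : Type u) [Field K] [Algebra K A] {p q : Fin n} (h : p ≠ q) :
    A →ₗ[K] sl K A n where
  toFun a := ⟨Matrix.single p q a, by
    have h1 : (⁅Matrix.single p p (1 : A), Matrix.single p q a⁆ : Matrix (Fin n) (Fin n) A) =
        Matrix.single p q a := by
      rw [LieRing.of_associative_ring_bracket]
      simp [h.symm]
    rw [← h1]
    exact LieSubmodule.lie_mem_lie (LieSubmodule.mem_top _) (LieSubmodule.mem_top _)⟩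
  map_add' a b := Subtype.ext (Matrix.single_add _ _ _ _)
  map_smul' c a := Subtype.ext (Matrix.smul_single c p q a).symm

@[simp] theorem coe_rootVector {p q : Fin n} (h : p ≠ q) (a : A) :
    (rootVector K h a : Matrix (Fin n) (Fin n) A) = Matrix.single p q a := rfl

theorem rootVector_mem_weightSpace {p q : Fin n} (h : p ≠ q) (a : A) :
    rootVector K h a ∈ weightSpace (cartanIncl K A n) (eps K n p - eps K n q) :=
  mem_weightSpace_of_support fun i j hij => by
    rw [coe_rootVector]
    exact Matrix.single_apply_of_ne _ _ _ _ _ fun h => hij ⟨h.1.symm, h.2.symm⟩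

theorem lie_zeroPart_mem_weightSpace {β : Module.Dual K (cartan K n)} {x y : sl K A n}
    (hx : x ∈ weightSpace (cartanIncl K A n) β) (hy : y ∈ zeroPart (cartanIncl K A n)) :
    ⁅x, y⁆ ∈ weightSpace (cartanIncl K A n) β := by
  intro t
  have hy' : ⁅cartanIncl K A n t, y⁆ = 0 := by
    have := hy t
    rwa [LinearMap.zero_apply, zero_smul] at this
  rw [leibniz_lie, hx t, hy', lie_zero, add_zero, smul_lie]

/-- `L₀` normalises `L₊`, so the left ideal `U(L) L₊` is stable under right multiplication by
`U(L₀)`. -/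
theorem mul_envelopingIncl_mem {z : UniversalEnvelopingAlgebra K (sl K A n)}
    (hz : z ∈ posIdeal (cartanIncl K A n) (posRoots K n))
    (u : UniversalEnvelopingAlgebra K (zeroPart (cartanIncl K A n))) :
    z * envelopingIncl (cartanIncl K A n) u ∈ posIdeal (cartanIncl K A n) (posRoots K n) := by
  have hu : u ∈ Algebra.adjoin K (Set.range (UniversalEnvelopingAlgebra.ι K :
      zeroPart (cartanIncl K A n) → _)) := by
    rw [adjoin_range_ι]; trivial
  induction hu using Algebra.adjoin_induction generalizing z with
  | mem u hu =>
    obtain ⟨y, rfl⟩ := hu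
    rw [envelopingIncl_ι]
    induction hz using Submodule.span_induction with
    | mem z hz =>
      obtain ⟨x, hx, rfl⟩ := hz
      have h1 : ⁅x, (y : sl K A n)⁆ ∈ posPart (cartanIncl K A n) (posRoots K n) := by
        have hle : posPart (cartanIncl K A n) (posRoots K n) ≤
            (posPart (cartanIncl K A n) (posRoots K n)).comap
              (-(LieAlgebra.ad K (sl K A n) (y : sl K A n))) := by
          refine iSup₂_le fun β hβ x hx => ?_
          rw [Submodule.mem_comap, LinearMap.neg_apply, LieAlgebra.ad_apply, lie_skew]
          exact Submodule.mem_iSup_of_mem β (Submodule.mem_iSup_of_mem hβ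
            (lie_zeroPart_mem_weightSpace hx y.2))
        have := hle hx
        rwa [Submodule.mem_comap, LinearMap.neg_apply, LieAlgebra.ad_apply, lie_skew] at this
      have h2 : UniversalEnvelopingAlgebra.ι K x * UniversalEnvelopingAlgebra.ι K (y : sl K A n) =
          UniversalEnvelopingAlgebra.ι K (y : sl K A n) * UniversalEnvelopingAlgebra.ι K x +
            UniversalEnvelopingAlgebra.ι K ⁅x, (y : sl K A n)⁆ := by
        rw [LieHom.map_lie, LieRing.of_associative_ring_bracket]
        abel
      change UniversalEnvelopingAlgebra.ι K x * UniversalEnvelopingAlgebra.ι K (y : sl K A n) ∈ _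
      rw [h2]
      exact add_mem (Ideal.mul_mem_left _ _ (Ideal.subset_span ⟨x, hx, rfl⟩))
        (Ideal.subset_span ⟨_, h1, rfl⟩)
    | zero => rw [zero_mul]; exact zero_mem _
    | add a b _ _ ha hb => rw [add_mul]; exact add_mem ha hb
    | smul a b _ hb => rw [smul_eq_mul, mul_assoc]; exact Ideal.mul_mem_left _ _ hb
  | algebraMap c =>
    rw [AlgHom.commutes, ← Algebra.commutes]
    exact Ideal.mul_mem_left _ _ hz
  | add u v _ _ hu hv => rw [map_add, mul_add]; exact add_mem (hu hz) (hv hz)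
  | mul u v _ _ hu hv => rw [map_mul, ← mul_assoc]; exact hv (hu hz)

variable [CharZero K]

theorem support_of_mem_weightSpace {i j : Fin n} (hij : i ≠ j) {x : sl K A n}
    (hx : x ∈ weightSpace (cartanIncl K A n) (eps K n i - eps K n j)) {p q : Fin n}
    (hpq : ¬(p = i ∧ q = j)) : (x : Matrix (Fin n) (Fin n) A) p q = 0 := by
  by_contra hne
  have hn : (n : K) ≠ 0 := Nat.cast_ne_zero.2 (Nat.pos_iff_ne_zero.1 i.pos)
  have h : ∀ S : Finset (Fin n), ((if p ∈ S then 1 else 0) - (if q ∈ S then 1 else 0) : K) =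
      (if i ∈ S then 1 else 0) - (if j ∈ S then 1 else 0) := by
    intro S
    have h1 := mem_weightSpace_iff.1 hx (testElement K S) p q
    rw [eps_sub_eps_testElement, eps_sub_eps_testElement, ← sub_eq_zero, ← sub_smul] at h1
    have h2 := (smul_eq_zero.1 h1).resolve_right hne
    exact mul_left_cancel₀ hn (sub_eq_zero.1 h2)
  -- These two indicator sets already force `p = i` and `q = j`.
  have hi := h {i}
  have hj := h {j}
  simp only [Finset.mem_singleton, if_true, if_neg hij, if_neg hij.symm] at hi hj
  apply hpq
  constructor
  · by_contra hp
    rw [if_neg hp] at hi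
    split_ifs at hi <;> norm_num at hi
  · by_contra hq
    rw [if_neg hq] at hj
    split_ifs at hj <;> norm_num at hj

theorem isDiag_of_mem_zeroPart {x : sl K A n} (hx : x ∈ zeroPart (cartanIncl K A n)) :
    (x : Matrix (Fin n) (Fin n) A).IsDiag := by
  intro p q hpq
  by_contra hne
  have hn : (n : K) ≠ 0 := Nat.cast_ne_zero.2 (Nat.pos_iff_ne_zero.1 p.pos)
  have h1 := (mem_weightSpace_iff (β := 0)).1 hx (testElement K {p}) p q
  rw [eps_sub_eps_testElement, LinearMap.zero_apply, zero_smul] at h1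
  have h2 := (smul_eq_zero.1 h1).resolve_right hne
  simp [hpq.symm, hn] at h2

theorem strictUpper_of_mem_posPart {x : sl K A n}
    (hx : x ∈ posPart (cartanIncl K A n) (posRoots K n)) {p q : Fin n} (hqp : q ≤ p) :
    (x : Matrix (Fin n) (Fin n) A) p q = 0 := by
  let f : sl K A n →ₗ[K] A :=
    { toFun := fun x => (x : Matrix (Fin n) (Fin n) A) p q
      map_add' := fun _ _ => rfl
      map_smul' := fun _ _ => rfl }
  have hle : posPart (cartanIncl K A n) (posRoots K n) ≤ LinearMap.ker f := by
    refine iSup₂_le ?_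
    rintro _ ⟨i, j, hij, rfl⟩ x hx
    refine LinearMap.mem_ker.2 (support_of_mem_weightSpace hij.ne hx ?_)
    rintro ⟨rfl, rfl⟩
    exact absurd hij (not_lt.2 hqp)
  exact LinearMap.mem_ker.1 (hle hx)

theorem eq_rootVector_of_mem_weightSpace {i j : Fin n} (hij : i ≠ j) {x : sl K A n}
    (hx : x ∈ weightSpace (cartanIncl K A n) (eps K n i - eps K n j)) :
    x = rootVector K hij ((x : Matrix (Fin n) (Fin n) A) i j) := by
  refine Subtype.ext (Matrix.ext fun p q => ?_)
  rw [coe_rootVector]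
  by_cases h : p = i ∧ q = j
  · rw [h.1, h.2, Matrix.single_apply_same]
  · rw [support_of_mem_weightSpace hij hx h,
      Matrix.single_apply_of_ne _ _ _ _ _ fun h' => h ⟨h'.1.symm, h'.2.symm⟩]

theorem lo_ne_hi (i : Fin (n - 1)) : lo i ≠ hi i := fun h => by
  have := congrArg Fin.val h
  simp [lo, hi] at this

theorem lo_lt_hi (i : Fin (n - 1)) : lo i < hi i := by
  simp [lo, hi, Fin.lt_def]

/-- Evaluated at the test element of an initial segment ending in `r`, a positive root counts
whether it crosses the cut after `r`, i.e. gives its coefficient at the simple root there. Only the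
cut after `lo i` is ever crossed, so every summand is that simple root. -/
theorem posRoots_sum_eq {i : Fin (n - 1)} {m k : ℕ} {β : Fin m → Module.Dual K (cartan K n)}
    (hβ : ∀ j, β j ∈ posRoots K n) (hsum : ∑ j, β j = k • simpleRoot K i) :
    m = k ∧ ∀ j, β j = simpleRoot K i := by
  have hn : (n : K) ≠ 0 := Nat.cast_ne_zero.2 (by have := i.pos; omega)
  choose p q hpq hβ using hβ
  have hcount : ∀ r : Fin n, (∑ j, if p j ≤ r ∧ r < q j then 1 else 0 : ℕ) =
      k * if r = lo i then 1 else 0 := by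
    intro r
    have h1 := LinearMap.congr_fun hsum (testElement K (Finset.Iic r))
    simp only [hβ, simpleRoot] at h1
    rw [LinearMap.sum_apply, LinearMap.smul_apply] at h1
    simp only [eps_sub_eps_testElement, Finset.mem_Iic] at h1
    rw [← Finset.mul_sum, nsmul_eq_mul, mul_left_comm] at h1
    have h2 := mul_left_cancel₀ hn h1
    have h3 : ∀ a b : Fin n, a < b → ((if a ≤ r then 1 else 0) - (if b ≤ r then 1 else 0) : K) =
        ((if a ≤ r ∧ r < b then 1 else 0 : ℕ) : K) := by
      intro a b hab
      by_cases ha : a ≤ r <;> by_cases hb : b ≤ r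
      · simp [ha, hb, not_lt.2 hb]
      · simp [ha, hb, not_le.1 hb]
      · exact absurd (hab.le.trans hb) ha
      · simp [ha, hb]
    have h4 : (lo i ≤ r ∧ r < hi i) ↔ r = lo i := by
      simp only [lo, hi, Fin.le_def, Fin.lt_def, Fin.ext_iff]
      omega
    simp only [h3 _ _ (hpq _), h3 _ _ (lo_lt_hi i), h4] at h2
    exact_mod_cast h2
  have hzero : ∀ r, r ≠ lo i → ∀ j, ¬(p j ≤ r ∧ r < q j) := by
    intro r hr j hj
    have h1 := hcount r
    rw [if_neg hr, mul_zero, Finset.sum_eq_zero_iff] at h1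
    have := h1 j (Finset.mem_univ j)
    rw [if_pos hj] at this
    exact one_ne_zero this
  have hp : ∀ j, p j = lo i := fun j => by
    by_contra h
    exact hzero _ h j ⟨le_rfl, hpq j⟩
  have hq : ∀ j, q j = hi i := fun j => by
    have h1 := hpq j
    rw [hp j] at h1
    by_contra h
    refine hzero (hi i) (lo_ne_hi i).symm j ⟨by rw [hp j]; exact (lo_lt_hi i).le, ?_⟩
    simp only [lo, hi, Fin.lt_def, Fin.ext_iff] at h1 h ⊢
    omega
  refine ⟨?_, fun j => by rw [hβ, hp, hq]; rfl⟩
  have h1 := hcount (lo i)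
  simpa [hp, hq, lo_lt_hi] using h1

end RootSpaces

/-! ### The diagonal part of `sl_n(A)` -/

section Diagonal

variable {K : Type u} [Field K] {A : Type v} [Ring A] [Algebra K A] {n : ℕ}

/-- The bracket `[a E_{i,i+1}, b E_{i+1,i}] = ab E_{i,i} - ba E_{i+1,i+1}`. -/
def corootBracket (K : Type u) [Field K] [Algebra K A] (i : Fin (n - 1)) (a b : A) :
    zeroPart (cartanIncl K A n) :=
  ⟨⁅rootVector K (lo_ne_hi i) a, rootVector K (lo_ne_hi i).symm b⁆, by
    intro t
    rw [leibniz_lie, rootVector_mem_weightSpace _ _ t, rootVector_mem_weightSpace _ _ t,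
      smul_lie, lie_smul, ← add_smul]
    congr 1
    simp⟩

theorem coe_corootBracket (i : Fin (n - 1)) (a b : A) :
    ((corootBracket K i a b : sl K A n) : Matrix (Fin n) (Fin n) A) =
      Matrix.single (lo i) (lo i) (a * b) - Matrix.single (hi i) (hi i) (b * a) := by
  have h : ((corootBracket K i a b : sl K A n) : Matrix (Fin n) (Fin n) A) =
    ⁅Matrix.single (lo i) (hi i) a, Matrix.single (hi i) (lo i) b⁆ := rfl
  rw [h, LieRing.of_associative_ring_bracket]
  simp

theorem zeroPart_ext {x y : zeroPart (cartanIncl K A n)}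
    (h : ((x : sl K A n) : Matrix (Fin n) (Fin n) A) = ((y : sl K A n) : Matrix _ _ A)) : x = y :=
  Subtype.ext (Subtype.ext h)

theorem coe_lie_zeroPart (x y : zeroPart (cartanIncl K A n)) :
    ((⁅x, y⁆ : zeroPart (cartanIncl K A n)) : Matrix (Fin n) (Fin n) A) =
      ((x : sl K A n) : Matrix (Fin n) (Fin n) A) * ((y : sl K A n) : Matrix _ _ A) -
      ((y : sl K A n) : Matrix (Fin n) (Fin n) A) * ((x : sl K A n) : Matrix _ _ A) := rfl

/-- The trace of a commutator of matrices is a sum of commutators of entries. This is the only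
constraint on the diagonal that `span_corootBracket` needs. -/
theorem trace_mem_commutators (x : sl K A n) :
    (x : Matrix (Fin n) (Fin n) A).trace ∈ Submodule.span K {c : A | ∃ a b, c = a * b - b * a} := by
  have hle : (sl K A n).toSubmodule ≤
      (Submodule.span K {c : A | ∃ a b, c = a * b - b * a}).comap
        (Matrix.traceLinearMap (Fin n) K A) := by
    rw [LieSubmodule.lieIdeal_oper_eq_linear_span', Submodule.span_le]
    rintro _ ⟨M, -, N, -, rfl⟩
    change (⁅M, N⁆ : Matrix (Fin n) (Fin n) A).trace ∈ Submodule.span K _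
    rw [LieRing.of_associative_ring_bracket, Matrix.trace_sub]
    have h1 : (N * M).trace = ∑ i, ∑ j, N j i * M i j := by
      rw [Finset.sum_comm]
      rfl
    rw [h1]
    change (∑ i, ∑ j, M i j * N j i) - _ ∈ Submodule.span K _
    rw [← Finset.sum_sub_distrib]
    refine sum_mem fun i _ => ?_
    rw [← Finset.sum_sub_distrib]
    exact sum_mem fun j _ => Submodule.subset_span ⟨_, _, rfl⟩
  exact hle x.2

end Diagonal

/-! ### The `sl₂`-triples of the simple roots and the span of `L₀` -/

section Sl2

variable {K : Type u} [Field K] {A : Type v} [Ring A] [Algebra K A] {n : ℕ}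

/-- The canonical map from a Lie algebra to its enveloping algebra, as a linear map. -/
abbrev ιLinear (K : Type*) [Field K] (L : Type*) [LieRing L] [LieAlgebra K L] :
    L →ₗ[K] UniversalEnvelopingAlgebra K L :=
  (UniversalEnvelopingAlgebra.ι K : L →ₗ⁅K⁆ UniversalEnvelopingAlgebra K L)

theorem ι_mul_ι {L : Type*} [LieRing L] [LieAlgebra K L] (x y : L) :
    UniversalEnvelopingAlgebra.ι K x * UniversalEnvelopingAlgebra.ι K y =
      UniversalEnvelopingAlgebra.ι K y * UniversalEnvelopingAlgebra.ι K x +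
        UniversalEnvelopingAlgebra.ι K ⁅x, y⁆ := by
  rw [LieHom.map_lie, LieRing.of_associative_ring_bracket]
  abel

theorem sl_ext {x y : sl K A n} (h : (x : Matrix (Fin n) (Fin n) A) = y) : x = y := Subtype.ext h

theorem coe_lie_sl (x y : sl K A n) : ((⁅x, y⁆ : sl K A n) : Matrix (Fin n) (Fin n) A) =
    (x : Matrix (Fin n) (Fin n) A) * y - (y : Matrix (Fin n) (Fin n) A) * x := rfl

theorem isSl2Triple (i : Fin (n - 1)) :
    IsSl2Triple (envelopingIncl (cartanIncl K A n)) (posIdeal (cartanIncl K A n) (posRoots K n))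
      (ιLinear K (sl K A n) ∘ₗ rootVector K (lo_ne_hi i))
      (ιLinear K (sl K A n) ∘ₗ rootVector K (lo_ne_hi i).symm)
      (fun b => UniversalEnvelopingAlgebra.ι K (corootBracket K i 1 b)) where
  mul_mem _ hz u := mul_envelopingIncl_mem hz u
  x_mem := Ideal.subset_span ⟨_, Submodule.mem_iSup_of_mem _ (Submodule.mem_iSup_of_mem
    ⟨lo i, hi i, lo_lt_hi i, rfl⟩ (rootVector_mem_weightSpace (lo_ne_hi i) 1)), rfl⟩
  xx a b := by
    have h : ⁅rootVector K (lo_ne_hi i) a, rootVector K (lo_ne_hi i) b⁆ = 0 :=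
      sl_ext (by
        rw [coe_lie_sl, coe_rootVector, coe_rootVector,
          Matrix.single_mul_single_of_ne _ _ _ _ (lo_ne_hi i).symm,
          Matrix.single_mul_single_of_ne _ _ _ _ (lo_ne_hi i).symm, sub_zero]
        rfl)
    change UniversalEnvelopingAlgebra.ι K _ * UniversalEnvelopingAlgebra.ι K _ =
      UniversalEnvelopingAlgebra.ι K _ * UniversalEnvelopingAlgebra.ι K _
    rw [ι_mul_ι, h, map_zero, add_zero]
  yy a b := by
    have h : ⁅rootVector K (lo_ne_hi i).symm a, rootVector K (lo_ne_hi i).symm b⁆ = 0 :=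
      sl_ext (by
        rw [coe_lie_sl, coe_rootVector, coe_rootVector,
          Matrix.single_mul_single_of_ne _ _ _ _ (lo_ne_hi i),
          Matrix.single_mul_single_of_ne _ _ _ _ (lo_ne_hi i), sub_zero]
        rfl)
    change UniversalEnvelopingAlgebra.ι K _ * UniversalEnvelopingAlgebra.ι K _ =
      UniversalEnvelopingAlgebra.ι K _ * UniversalEnvelopingAlgebra.ι K _
    rw [ι_mul_ι, h, map_zero, add_zero]
  xy b := by
    rw [envelopingIncl_ι]
    exact ι_mul_ι _ _
  hy b c := by
    have h : ⁅(corootBracket K i 1 b : sl K A n), rootVector K (lo_ne_hi i).symm c⁆ =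
        -rootVector K (lo_ne_hi i).symm (b * c + c * b) :=
      sl_ext (by
        rw [coe_lie_sl, coe_corootBracket, coe_rootVector]
        change _ = -(rootVector K (lo_ne_hi i).symm (b * c + c * b) : Matrix (Fin n) (Fin n) A)
        rw [coe_rootVector, sub_mul, mul_sub, Matrix.single_mul_single_same,
          Matrix.single_mul_single_of_ne _ _ _ _ (lo_ne_hi i),
          Matrix.single_mul_single_same,
          Matrix.single_mul_single_of_ne _ _ _ _ (lo_ne_hi i), Matrix.single_add,
          one_mul, mul_one]
        abel)
    rw [envelopingIncl_ι]
    change UniversalEnvelopingAlgebra.ι K _ * UniversalEnvelopingAlgebra.ι K _ =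
      UniversalEnvelopingAlgebra.ι K _ * UniversalEnvelopingAlgebra.ι K _ -
        UniversalEnvelopingAlgebra.ι K _
    rw [ι_mul_ι, h, map_neg, sub_eq_add_neg]
  hx b c := by
    have h : ⁅(corootBracket K i 1 b : sl K A n), rootVector K (lo_ne_hi i) c⁆ =
        rootVector K (lo_ne_hi i) (b * c + c * b) :=
      sl_ext (by
        rw [coe_lie_sl, coe_corootBracket, coe_rootVector, coe_rootVector, sub_mul, mul_sub,
          Matrix.single_mul_single_same,
          Matrix.single_mul_single_of_ne _ _ _ _ (lo_ne_hi i).symm,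
          Matrix.single_mul_single_same,
          Matrix.single_mul_single_of_ne _ _ _ _ (lo_ne_hi i).symm, Matrix.single_add,
          one_mul, mul_one]
        abel)
    rw [envelopingIncl_ι]
    change UniversalEnvelopingAlgebra.ι K _ * UniversalEnvelopingAlgebra.ι K _ =
      UniversalEnvelopingAlgebra.ι K _ * UniversalEnvelopingAlgebra.ι K _ +
        UniversalEnvelopingAlgebra.ι K _
    rw [ι_mul_ι, h]

/-- The relations involve the product of `R` only through `b * c + c * b`, which is the same in the
opposite ring. This serves the last node. -/
theorem IsSl2Triple.op {U U₀ R : Type*} [Ring U] [Algebra K U] [Ring U₀]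
    [Algebra K U₀] [Ring R] [Algebra K R] {incl : U₀ →ₐ[K] U} {J : Ideal U} {x y : R →ₗ[K] U}
    {h : R → U₀} (H : IsSl2Triple incl J x y h) :
    IsSl2Triple incl J (x ∘ₗ (MulOpposite.opLinearEquiv K).symm.toLinearMap)
      (y ∘ₗ (MulOpposite.opLinearEquiv K).symm.toLinearMap) (fun b => h b.unop) where
  mul_mem := H.mul_mem
  x_mem := H.x_mem
  xx a b := H.xx _ _
  yy a b := H.yy _ _
  xy b := H.xy _
  hy b c := by
    change _ = _ - y (c.unop * b.unop + b.unop * c.unop)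
    rw [add_comm (c.unop * b.unop)]
    exact H.hy b.unop c.unop
  hx b c := by
    change _ = _ + x (c.unop * b.unop + b.unop * c.unop)
    rw [add_comm (c.unop * b.unop)]
    exact H.hx b.unop c.unop

/-- The inclusion of the diagonal part into the matrices, as a linear map. -/
def zeroPartMatrix (K : Type u) [Field K] [Algebra K A] :
    zeroPart (cartanIncl K A n) →ₗ[K] Matrix (Fin n) (Fin n) A where
  toFun x := (x : sl K A n)
  map_add' _ _ := rfl
  map_smul' _ _ := rfl

theorem single_sub {m : ℕ} (i j : Fin m) (a b : A) :
    Matrix.single i j (a - b) = Matrix.single i j a - Matrix.single i j b := by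
  rw [sub_eq_add_neg, Matrix.single_add, ← Matrix.single_neg, sub_eq_add_neg]

theorem single_commutator_eq {i : Fin (n - 1)} (a b : A) :
    ((corootBracket K i a b - corootBracket K i 1 (a * b) : zeroPart (cartanIncl K A n)) :
      Matrix (Fin n) (Fin n) A) = Matrix.single (hi i) (hi i) (a * b - b * a) := by
  change ((corootBracket K i a b : sl K A n) : Matrix (Fin n) (Fin n) A) -
    ((corootBracket K i 1 (a * b) : sl K A n) : Matrix (Fin n) (Fin n) A) = _
  rw [coe_corootBracket, coe_corootBracket, single_sub, one_mul, mul_one]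
  abel

theorem single_commutator_eq' {i : Fin (n - 1)} (a b : A) :
    ((corootBracket K i a b - corootBracket K i 1 (b * a) : zeroPart (cartanIncl K A n)) :
      Matrix (Fin n) (Fin n) A) = Matrix.single (lo i) (lo i) (a * b - b * a) := by
  change ((corootBracket K i a b : sl K A n) : Matrix (Fin n) (Fin n) A) -
    ((corootBracket K i 1 (b * a) : sl K A n) : Matrix (Fin n) (Fin n) A) = _
  rw [coe_corootBracket, coe_corootBracket, single_sub, one_mul, mul_one]
  abel

/-- Both sides are `(ab - ba)` at the diagonal position shared by the two nodes. This coupling of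
neighbours is where the hypothesis on the support enters. -/
theorem commutator_succ_eq {i j : Fin (n - 1)} (hij : (j : ℕ) = i + 1) (a b : A) :
    corootBracket K i a b - corootBracket K i 1 (a * b) =
      corootBracket K j a b - corootBracket K j 1 (b * a) := by
  apply zeroPart_ext
  rw [single_commutator_eq, single_commutator_eq',
    show lo j = hi i from Fin.ext (by simp [lo, hi, hij])]

/-- The bracket is `ab - ba` at both diagonal positions of the node; each summand is one of them. -/
theorem lie_corootBracket_self (i : Fin (n - 1)) (a b : A) :
    ⁅corootBracket K i 1 a, corootBracket K i 1 b⁆ =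
      (corootBracket K i a b - corootBracket K i 1 (b * a)) +
        (corootBracket K i a b - corootBracket K i 1 (a * b)) := by
  apply zeroPart_ext
  rw [coe_lie_zeroPart, coe_corootBracket, coe_corootBracket]
  change _ = ((corootBracket K i a b - corootBracket K i 1 (b * a) : zeroPart (cartanIncl K A n)) :
      Matrix (Fin n) (Fin n) A) +
    ((corootBracket K i a b - corootBracket K i 1 (a * b) : zeroPart (cartanIncl K A n)) :
      Matrix (Fin n) (Fin n) A)
  rw [single_commutator_eq, single_commutator_eq']
  simp only [sub_mul, mul_sub, one_mul, mul_one, Matrix.single_mul_single_same, single_sub,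
    Matrix.single_mul_single_of_ne _ _ _ _ (lo_ne_hi i),
    Matrix.single_mul_single_of_ne _ _ _ _ (lo_ne_hi i).symm]
  abel

theorem lie_corootBracket_of_far {i j : Fin (n - 1)} (h : i ≠ j) (hij : (i : ℕ) ≠ j + 1)
    (hji : (j : ℕ) ≠ i + 1) (a b : A) :
    ⁅corootBracket K i 1 a, corootBracket K j 1 b⁆ = 0 := by
  apply zeroPart_ext
  have h1 : lo i ≠ lo j := fun e => h (Fin.ext (by simpa [lo] using e))
  have h2 : hi i ≠ hi j := fun e => h (Fin.ext (by simpa [hi] using e))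
  have h3 : lo i ≠ hi j := fun e => hij (by simpa [lo, hi] using e)
  have h4 : lo j ≠ hi i := fun e => hji (by simpa [lo, hi] using e)
  rw [coe_lie_zeroPart, coe_corootBracket, coe_corootBracket]
  simp only [sub_mul, mul_sub, Matrix.single_mul_single_of_ne _ _ _ _ h1,
    Matrix.single_mul_single_of_ne _ _ _ _ h1.symm, Matrix.single_mul_single_of_ne _ _ _ _ h2,
    Matrix.single_mul_single_of_ne _ _ _ _ h2.symm, Matrix.single_mul_single_of_ne _ _ _ _ h3,
    Matrix.single_mul_single_of_ne _ _ _ _ h3.symm, Matrix.single_mul_single_of_ne _ _ _ _ h4,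
    Matrix.single_mul_single_of_ne _ _ _ _ h4.symm, sub_zero]
  rfl

theorem corootBracket_add_right (i : Fin (n - 1)) (a b c : A) :
    corootBracket K i a (b + c) = corootBracket K i a b + corootBracket K i a c := by
  refine Subtype.ext ?_
  change ⁅_, _⁆ = ⁅_, _⁆ + ⁅_, _⁆
  rw [map_add, lie_add]

theorem corootBracket_smul_right (i : Fin (n - 1)) (r : K) (a b : A) :
    corootBracket K i a (r • b) = r • corootBracket K i a b := by
  refine Subtype.ext ?_
  change ⁅_, _⁆ = r • ⁅_, _⁆
  rw [map_smul, lie_smul]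

/-- Summation by parts writes a diagonal matrix through the brackets `h_i(1, ·)` of its partial
sums, up to its trace in the last corner. That trace is a sum of commutators, and a commutator in
the last corner is a difference of two brackets of the last node. -/
theorem span_corootBracket [CharZero K] (hn : 2 ≤ n) :
    Submodule.span K (Set.range fun p : Fin (n - 1) × A × A => corootBracket K p.1 p.2.1 p.2.2) =
      ⊤ := by
  rw [eq_top_iff]
  rintro x -
  set S := Submodule.span K
    (Set.range fun p : Fin (n - 1) × A × A => corootBracket K p.1 p.2.1 p.2.2)
  have hS : ∀ i a b, corootBracket K i a b ∈ S := fun i a b =>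
    Submodule.subset_span ⟨(i, a, b), rfl⟩
  obtain ⟨m, rfl⟩ : ∃ m, n = m + 2 := ⟨n - 2, by omega⟩
  let M : Matrix (Fin (m + 2)) (Fin (m + 2)) A := (x : sl K A (m + 2))
  have hdiag : M.IsDiag := isDiag_of_mem_zeroPart x.2
  let partialSum : ℕ → A := fun k => ∑ j : Fin (m + 2), if (j : ℕ) < k then M j j else 0
  have hlast : ∀ t ∈ Submodule.span K {c : A | ∃ a b, c = a * b - b * a},
      ∃ y ∈ S, ((y : sl K A (m + 2)) : Matrix (Fin (m + 2)) (Fin (m + 2)) A) =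
        Matrix.single (Fin.last _) (Fin.last _) t := by
    intro t ht
    induction ht using Submodule.span_induction with
    | mem t ht =>
      obtain ⟨a, b, rfl⟩ := ht
      exact ⟨_, sub_mem (hS (Fin.last m) a b) (hS (Fin.last m) 1 (a * b)),
        single_commutator_eq a b⟩
    | zero => exact ⟨0, zero_mem _, by rw [Matrix.single_zero]; rfl⟩
    | add s t _ _ hs ht =>
      obtain ⟨y, hy, hy'⟩ := hs
      obtain ⟨z, hz, hz'⟩ := ht
      refine ⟨y + z, add_mem hy hz, ?_⟩
      rw [Matrix.single_add, ← hy', ← hz']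
      rfl
    | smul c t _ ht =>
      obtain ⟨y, hy, hy'⟩ := ht
      refine ⟨c • y, Submodule.smul_mem _ c hy, ?_⟩
      rw [← Matrix.smul_single, ← hy']
      rfl
  obtain ⟨y, hy, hy'⟩ := hlast _ (trace_mem_commutators (x : sl K A (m + 2)))
  have hx : x = ∑ i : Fin (m + 1), corootBracket K i 1 (partialSum (i + 1)) + y := by
    apply zeroPart_ext
    have h0 : M = ∑ p, Matrix.single p p (M p p) := by
      conv_lhs => rw [← hdiag.diagonal_diag]
      exact (Matrix.sum_single_eq_diagonal _).symm
    have hs : ∀ p : Fin (m + 2), M p p = partialSum (p + 1) - partialSum p := by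
      intro p
      change _ = (∑ j : Fin (m + 2), if (j : ℕ) < p + 1 then M j j else 0) -
        ∑ j : Fin (m + 2), if (j : ℕ) < p then M j j else 0
      rw [← Finset.sum_sub_distrib, Finset.sum_eq_single p]
      · simp
      · intro j _ hj
        have : (j : ℕ) ≠ p := fun h => hj (Fin.ext h)
        split_ifs <;> first | omega | simp
      · simp
    have hfull : partialSum (m + 1 + 1) = M.trace :=
      Finset.sum_congr rfl fun j _ => if_pos j.2
    have hzero : partialSum 0 = 0 := Finset.sum_eq_zero fun j _ => if_neg (Nat.not_lt_zero _)
    have hcoe : zeroPartMatrix K (∑ i : Fin (m + 1), corootBracket K (n := m + 2) i 1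
        (partialSum (i + 1)) + y) =
        ∑ i : Fin (m + 1), (Matrix.single i.castSucc i.castSucc (partialSum (i + 1)) -
          Matrix.single i.succ i.succ (partialSum (i + 1))) +
        Matrix.single (Fin.last _) (Fin.last _) M.trace := by
      rw [← hy', map_add, map_sum]
      refine congrArg₂ (· + ·) (Finset.sum_congr rfl fun i _ => ?_) rfl
      have := coe_corootBracket (K := K) (n := m + 2) i 1 (partialSum (i + 1))
      rw [one_mul, mul_one] at this
      exact this
    refine Eq.trans (h0.trans ?_) hcoe.symm
    simp only [hs, single_sub]
    rw [Finset.sum_sub_distrib, Fin.sum_univ_castSucc, Fin.sum_univ_succ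
      (f := fun p : Fin (m + 2) => Matrix.single p p (partialSum p)), Finset.sum_sub_distrib]
    simp only [Fin.val_castSucc, Fin.val_last, Fin.val_succ, Fin.val_zero, hzero, hfull,
      Matrix.single_zero, zero_add]
    abel
  rw [hx]
  exact add_mem (sum_mem fun i _ => hS i _ _) hy

end Sl2

/-! ### A module with a highest weight vector and the functional it defines -/

section WeightFunctional

variable {K : Type u} [Field K] {A : Type v} [Ring A] [Algebra K A] {n : ℕ}
  {C : Type*} [Ring C] [Algebra K C]

variable (n A) in
/-- The coordinate ring acting on `LevelModule`. -/
abbrev LevelRing := A × Aᵐᵒᵖ × (Fin (n - 1) → Matrix (Fin n) (Fin n) A)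

variable (n A) in
/-- The sum of the column module, of the dual of the row module and of `n - 1` copies of the left
regular module of the matrix algebra. -/
abbrev LevelModule := (Fin n → A) × (Fin n → A) × (Fin (n - 1) → Matrix (Fin n) (Fin n) A)

variable (A) in
/-- The projection to the first `k` coordinates. -/
def levelIdempotent (k : Fin (n - 1)) : Matrix (Fin n) (Fin n) A :=
  Matrix.diagonal fun j => if j ≤ lo k then 1 else 0

/-- The action of `sl_n(A)` on `LevelModule`. -/
def levelAction (K : Type u) [Field K] [Algebra K A] :
    sl K A n →ₗ⁅K⁆ Module.End K (LevelModule A n) where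
  toFun x :=
    { toFun := fun w => (x.1.mulVec w.1,
        -Matrix.vecMul w.2.1 x.1, fun k => x.1 * w.2.2 k)
      map_add' := fun v w => by
        refine Prod.ext ?_ (Prod.ext ?_ (funext fun k => ?_))
        · exact Matrix.mulVec_add x.1 v.1 w.1
        · exact (congrArg Neg.neg (Matrix.add_vecMul _ _ _)).trans (neg_add _ _)
        · exact mul_add _ _ _
      map_smul' := fun c w => by
        refine Prod.ext ?_ (Prod.ext ?_ (funext fun k => ?_))
        · exact Matrix.mulVec_smul x.1 c w.1
        · exact (congrArg Neg.neg (Matrix.smul_vecMul c w.2.1 x.1)).trans (smul_neg _ _).symm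
        · exact mul_smul_comm c x.1 (w.2.2 k) }
  map_add' x y := by
    refine LinearMap.ext fun w => Prod.ext ?_ (Prod.ext ?_ (funext fun k => ?_))
    · exact Matrix.add_mulVec x.1 y.1 w.1
    · exact (congrArg Neg.neg (Matrix.vecMul_add x.1 y.1 w.2.1)).trans (neg_add _ _)
    · exact add_mul _ _ _
  map_smul' c x := by
    refine LinearMap.ext fun w => Prod.ext ?_ (Prod.ext ?_ (funext fun k => ?_))
    · exact Matrix.smul_mulVec c x.1 w.1
    · exact (congrArg Neg.neg (Matrix.vecMul_smul w.2.1 c x.1)).trans (smul_neg _ _).symm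
    · exact smul_mul_assoc _ _ _
  map_lie' {x y} := by
    refine LinearMap.ext fun w => Prod.ext ?_ (Prod.ext ?_ (funext fun k => ?_))
    · change Matrix.mulVec (x.1 * y.1 - y.1 * x.1) w.1 =
        Matrix.mulVec x.1 (Matrix.mulVec y.1 w.1) -
        Matrix.mulVec y.1 (Matrix.mulVec x.1 w.1)
      rw [Matrix.sub_mulVec, Matrix.mulVec_mulVec, Matrix.mulVec_mulVec]
    · change -Matrix.vecMul w.2.1 (x.1 * y.1 - y.1 * x.1) =
        -Matrix.vecMul (-Matrix.vecMul w.2.1 y.1) x.1 -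
        -Matrix.vecMul (-Matrix.vecMul w.2.1 x.1) y.1
      rw [Matrix.vecMul_sub, Matrix.neg_vecMul, Matrix.neg_vecMul, Matrix.vecMul_vecMul,
        Matrix.vecMul_vecMul]
      abel
    · change (x.1 * y.1 - y.1 * x.1) * w.2.2 k =
        x.1 * (y.1 * w.2.2 k) - y.1 * (x.1 * w.2.2 k)
      rw [sub_mul, mul_assoc, mul_assoc]

/-- The right action of `LevelRing` on `LevelModule`. -/
def levelRightAction (K : Type u) [Field K] [Algebra K A] (Y : LevelRing A n) :
    Module.End K (LevelModule A n) where
  toFun w := (fun i => w.1 i * Y.1, fun i => Y.2.1.unop * w.2.1 i, fun k => w.2.2 k * Y.2.2 k)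
  map_add' _ _ := Prod.ext (funext fun _ => add_mul _ _ _)
    (Prod.ext (funext fun _ => mul_add _ _ _) (funext fun _ => add_mul _ _ _))
  map_smul' c w := Prod.ext (funext fun _ => smul_mul_assoc _ _ _)
    (Prod.ext (funext fun _ => mul_smul_comm _ _ _) (funext fun k => smul_mul_assoc c (w.2.2 k) (Y.2.2 k)))

theorem levelAction_levelRightAction (x : sl K A n) (Y : LevelRing A n) (w : LevelModule A n) :
    levelAction K x (levelRightAction K Y w) = levelRightAction K Y (levelAction K x w) := by
  refine Prod.ext (funext fun i => ?_) (Prod.ext (funext fun i => ?_) (funext fun k => ?_))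
  · change ∑ j, x.1 i j * (w.1 j * Y.1) = (∑ j, x.1 i j * w.1 j) * Y.1
    simp only [Finset.sum_mul, mul_assoc]
  · change -∑ j, Y.2.1.unop * w.2.1 j * x.1 j i =
      Y.2.1.unop * -∑ j, w.2.1 j * x.1 j i
    simp only [Finset.mul_sum, mul_assoc, mul_neg]
  · exact (mul_assoc _ _ _).symm

/-- An upper triangular matrix preserves the span of the first `k` coordinate vectors. -/
theorem mul_levelIdempotent {M : Matrix (Fin n) (Fin n) A} (hM : ∀ p q, q < p → M p q = 0)
    (k : Fin (n - 1)) :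
    M * levelIdempotent A k = levelIdempotent A k * M * levelIdempotent A k := by
  ext p q
  rw [levelIdempotent, Matrix.mul_diagonal, Matrix.mul_diagonal, Matrix.diagonal_mul]
  by_cases hq : q ≤ lo k
  · by_cases hp : p ≤ lo k
    · simp [hp]
    · rw [hM p q (lt_of_le_of_lt hq (not_le.1 hp))]
      simp
  · simp [hq]

theorem levelIdempotent_mul_self (k : Fin (n - 1)) :
    levelIdempotent A k * levelIdempotent A k = levelIdempotent A k := by
  rw [levelIdempotent, Matrix.diagonal_mul_diagonal]
  congr 1
  funext j
  split_ifs <;> simp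

theorem trace_level {M : Matrix (Fin n) (Fin n) A} (k : Fin (n - 1)) :
    (levelIdempotent A k * M * levelIdempotent A k).trace =
      ∑ j, if j ≤ lo k then M j j else 0 := by
  refine Finset.sum_congr rfl fun j _ => ?_
  rw [Matrix.diag_apply, levelIdempotent, Matrix.mul_diagonal, Matrix.diagonal_mul]
  split_ifs <;> simp

/-- The element of `LevelRing` by which an upper triangular matrix acts on the base point. -/
def levelValue (z w : Fin n) (M : Matrix (Fin n) (Fin n) A) : LevelRing A n :=
  (M z z, MulOpposite.op (-M w w), fun k => levelIdempotent A k * M * levelIdempotent A k)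

theorem levelValue_add (z w : Fin n) (M N : Matrix (Fin n) (Fin n) A) :
    levelValue z w (M + N) = levelValue z w M + levelValue z w N := by
  refine Prod.ext rfl (Prod.ext ?_ (funext fun k => ?_))
  · exact congrArg MulOpposite.op (neg_add (M w w) (N w w))
  · change levelIdempotent A k * (M + N) * levelIdempotent A k =
      levelIdempotent A k * M * levelIdempotent A k + levelIdempotent A k * N * levelIdempotent A k
    rw [mul_add, add_mul]

theorem levelValue_smul (z w : Fin n) (c : K) (M : Matrix (Fin n) (Fin n) A) :
    levelValue z w (c • M) = c • levelValue z w M := by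
  refine Prod.ext rfl (Prod.ext ?_ (funext fun k => ?_))
  · exact congrArg MulOpposite.op (smul_neg c (M w w)).symm
  · change levelIdempotent A k * (c • M) * levelIdempotent A k =
      c • (levelIdempotent A k * M * levelIdempotent A k)
    rw [mul_smul_comm, smul_mul_assoc]

variable (A) in
/-- The base point of `LevelModule`. -/
def levelBase (z w : Fin n) : LevelModule A n :=
  (Pi.single z 1, Pi.single w 1, fun k => levelIdempotent A k)

/-- The projection of `LevelModule` to `LevelRing`. -/
def levelProj (K : Type u) [Field K] [Algebra K A] (z w : Fin n) :
    LevelModule A n →ₗ[K] LevelRing A n where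
  toFun v := (v.1 z, MulOpposite.op (v.2.1 w), fun k => levelIdempotent A k * v.2.2 k)
  map_add' _ _ := Prod.ext rfl (Prod.ext rfl (funext fun _ => mul_add _ _ _))
  map_smul' c v := Prod.ext rfl (Prod.ext rfl (funext fun k => mul_smul_comm c _ (v.2.2 k)))

theorem levelProj_levelRightAction (z w : Fin n) (Y : LevelRing A n) (v : LevelModule A n) :
    levelProj K z w (levelRightAction K Y v) = levelProj K z w v * Y :=
  Prod.ext rfl (Prod.ext rfl (funext fun _ => (mul_assoc _ _ _).symm))

/-- The base point is a highest weight vector with noncommutative coefficients: the first column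
vector, the last dual vector and the idempotents are moved by upper triangular matrices only through
the right action of `LevelRing`. -/
theorem levelAction_levelBase {z w : Fin n} (hz : ∀ p, z ≤ p) (hw : ∀ p, p ≤ w) {x : sl K A n}
    (hx : ∀ p q, q < p → x.1 p q = 0) :
    levelAction K x (levelBase A z w) =
      levelRightAction K (levelValue z w x.1) (levelBase A z w) := by
  refine Prod.ext (funext fun i => ?_) (Prod.ext (funext fun i => ?_) (funext fun k => ?_))
  · change Matrix.mulVec x.1 (Pi.single z 1) i =
      (Pi.single z 1 : Fin n → A) i * x.1 z z
    rw [Matrix.mulVec_single_one, Matrix.col_apply]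
    by_cases h : i = z
    · subst h; simp
    · rw [Pi.single_eq_of_ne h, zero_mul, hx _ _ (lt_of_le_of_ne (hz i) (Ne.symm h))]
  · change -Matrix.vecMul (Pi.single w 1) x.1 i =
      -x.1 w w * (Pi.single w 1 : Fin n → A) i
    rw [Matrix.single_one_vecMul, Matrix.row_apply]
    by_cases h : i = w
    · subst h; simp
    · rw [Pi.single_eq_of_ne h, mul_zero, hx _ _ (lt_of_le_of_ne (hw i) h), neg_zero]
  · change x.1 * levelIdempotent A k =
      levelIdempotent A k * (levelIdempotent A k * x.1 *
        levelIdempotent A k)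
    rw [mul_assoc (levelIdempotent A k), ← mul_assoc, levelIdempotent_mul_self, ← mul_assoc]
    exact mul_levelIdempotent hx k

theorem levelProj_levelBase (z w : Fin n) (M : Matrix (Fin n) (Fin n) A) :
    levelProj K z w (levelRightAction K (levelValue z w M) (levelBase A z w)) =
      levelValue z w M := by
  rw [levelProj_levelRightAction]
  refine Prod.ext ?_ (Prod.ext ?_ (funext fun k => ?_))
  · change (Pi.single z 1 : Fin n → A) z * M z z = M z z
    rw [Pi.single_eq_same, one_mul]
  · change MulOpposite.op (-M w w * (Pi.single w 1 : Fin n → A) w) = MulOpposite.op (-M w w)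
    rw [Pi.single_eq_same, mul_one]
  · change levelIdempotent A k * levelIdempotent A k *
      (levelIdempotent A k * M * levelIdempotent A k) = _
    rw [levelIdempotent_mul_self, mul_assoc (levelIdempotent A k) M, ← mul_assoc,
      levelIdempotent_mul_self, ← mul_assoc]
    rfl

/-- In the second component the sign of the dual action is compensated by the reversed product of
the opposite ring. -/
theorem levelValue_lie {z w : Fin n} {x y : zeroPart (cartanIncl K A n)}
    (hx : x.1.1.IsDiag)
    (hy : y.1.1.IsDiag) :
    levelValue z w ((⁅x, y⁆ : zeroPart (cartanIncl K A n)) : Matrix (Fin n) (Fin n) A) =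
      levelValue z w x.1.1 *
        levelValue z w y.1.1 -
      levelValue z w y.1.1 *
        levelValue z w x.1.1 := by
  rw [coe_lie_zeroPart]
  generalize x.1.1 = M at hx
  generalize y.1.1 = N at hy
  have hmul : ∀ {M N : Matrix (Fin n) (Fin n) A}, M.IsDiag → ∀ p, (M * N) p p = M p p * N p p := by
    intro M N hM p
    rw [Matrix.mul_apply, Finset.sum_eq_single p]
    · intro j _ hj
      rw [hM (Ne.symm hj), zero_mul]
    · simp
  have hlev : ∀ {M N : Matrix (Fin n) (Fin n) A}, N.IsDiag → ∀ k,
      levelIdempotent A k * (M * N) * levelIdempotent A k =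
        levelIdempotent A k * M * levelIdempotent A k *
          (levelIdempotent A k * N * levelIdempotent A k) := by
    intro M N hN k
    have h1 := mul_levelIdempotent (M := N) (fun p q h => hN h.ne') k
    have h2 : levelIdempotent A k * (levelIdempotent A k * N * levelIdempotent A k) =
        levelIdempotent A k * N * levelIdempotent A k := by
      rw [← mul_assoc, ← mul_assoc, levelIdempotent_mul_self]
    rw [mul_assoc (levelIdempotent A k * M), h2, ← h1]
    simp only [mul_assoc]
  refine Prod.ext ?_ (Prod.ext ?_ (funext fun k => ?_))
  · change (M * N - N * M) z z = M z z * N z z - N z z * M z z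
    rw [Matrix.sub_apply, hmul hx, hmul hy]
  · change MulOpposite.op (-(M * N - N * M) w w) =
      MulOpposite.op (-N w w * -M w w - -M w w * -N w w)
    rw [Matrix.sub_apply, hmul hx, hmul hy, neg_mul_neg, neg_mul_neg, neg_sub]
  · change levelIdempotent A k * (M * N - N * M) * levelIdempotent A k =
      levelIdempotent A k * M * levelIdempotent A k *
          (levelIdempotent A k * N * levelIdempotent A k) -
      levelIdempotent A k * N * levelIdempotent A k *
          (levelIdempotent A k * M * levelIdempotent A k)
    rw [mul_sub, sub_mul, hlev hy, hlev hx]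

/-- The maps assemble to `θ = θ₁ + θ₂ + ∑ θ₃ k ∘ trace` on `LevelRing`. The commutator relation
holds for `θ` because the pieces commute with each other and `θ₃ k ∘ trace` has commuting,
cyclically invariant values. Then `exists_enveloping_functional` applies. -/
theorem exists_weightHom [CharZero K] {z w : Fin n} (hz : ∀ p, z ≤ p) (hw : ∀ p, p ≤ w)
    (θ₁ : A →ₗ[K] C) (θ₂ : Aᵐᵒᵖ →ₗ[K] C) (θ₃ : Fin (n - 1) → A →ₗ[K] C)
    (h₁ : ∀ a b, θ₁ a * θ₁ b - θ₁ b * θ₁ a = θ₁ (a * b) - θ₁ (b * a))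
    (h₂ : ∀ a b, θ₂ a * θ₂ b - θ₂ b * θ₂ a = θ₂ (a * b) - θ₂ (b * a))
    (h₃ : ∀ k a b, θ₃ k (a * b) = θ₃ k (b * a))
    (h₁₂ : ∀ a b, Commute (θ₁ a) (θ₂ b)) (h₁₃ : ∀ a k b, Commute (θ₁ a) (θ₃ k b))
    (h₂₃ : ∀ a k b, Commute (θ₂ a) (θ₃ k b)) (h₃₃ : ∀ j a k b, Commute (θ₃ j a) (θ₃ k b)) :
    ∃ φ : zeroPart (cartanIncl K A n) →ₗ⁅K⁆ C,
      (∀ x, φ x = θ₁ (x.1.1 z z) -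
          θ₂ (MulOpposite.op (x.1.1 w w)) +
          ∑ k, θ₃ k (∑ j, if j ≤ lo k then x.1.1 j j else 0)) ∧
      ∀ s, (0, s) ∈ congruenceGraph (envelopingIncl (cartanIncl K A n))
        (posIdeal (cartanIncl K A n) (posRoots K n)) (UniversalEnvelopingAlgebra.lift K φ) →
        s = 0 := by
  let θ : LevelRing A n →ₗ[K] C := θ₁ ∘ₗ LinearMap.fst K _ _ +
    θ₂ ∘ₗ LinearMap.fst K _ _ ∘ₗ LinearMap.snd K _ _ +
    ∑ k, θ₃ k ∘ₗ Matrix.traceLinearMap (Fin n) K A ∘ₗ LinearMap.proj k ∘ₗ LinearMap.snd K _ _ ∘ₗ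
      LinearMap.snd K _ _
  have hθ_apply : ∀ Y : LevelRing A n, θ Y = θ₁ Y.1 + θ₂ Y.2.1 + ∑ k, θ₃ k (Y.2.2 k).trace := by
    intro Y
    simp only [θ, LinearMap.add_apply, LinearMap.sum_apply]
    rfl
  have hθ : ∀ a b, θ a * θ b - θ b * θ a = θ (a * b) - θ (b * a) := by
    intro a b
    have e : ∀ a b : LevelRing A n,
        Commute (θ₁ a.1 + θ₂ a.2.1) (∑ k, θ₃ k (b.2.2 k).trace) := fun a b =>
      Commute.sum_right _ _ _ fun k _ => (h₁₃ _ _ _).add_left (h₂₃ _ _ _)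
    have e' : Commute (∑ k, θ₃ k (a.2.2 k).trace) (∑ k, θ₃ k (b.2.2 k).trace) :=
      Commute.sum_left _ _ _ fun j _ => Commute.sum_right _ _ _ fun k _ => h₃₃ _ _ _ _
    have e'' : ∀ k, θ₃ k ((a * b).2.2 k).trace = θ₃ k ((b * a).2.2 k).trace := by
      intro k
      change θ₃ k (∑ i, ∑ j, a.2.2 k i j * b.2.2 k j i) = θ₃ k (∑ i, ∑ j, b.2.2 k i j * a.2.2 k j i)
      rw [Finset.sum_comm]
      simp only [map_sum, h₃ k (a.2.2 k _ _)]
    rw [hθ_apply, hθ_apply, hθ_apply, hθ_apply, Finset.sum_congr rfl fun k _ => e'' k]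
    have f1 : (θ₁ a.1 + θ₂ a.2.1) * (θ₁ b.1 + θ₂ b.2.1) - (θ₁ b.1 + θ₂ b.2.1) * (θ₁ a.1 + θ₂ a.2.1) =
        (θ₁ (a * b).1 + θ₂ (a * b).2.1) - (θ₁ (b * a).1 + θ₂ (b * a).2.1) := by
      have g1 := h₁ a.1 b.1
      have g2 := h₂ a.2.1 b.2.1
      rw [add_sub_add_comm]
      change _ = (θ₁ (a.1 * b.1) - θ₁ (b.1 * a.1)) + (θ₂ (a.2.1 * b.2.1) - θ₂ (b.2.1 * a.2.1))
      rw [← g1, ← g2, mul_add, mul_add, add_mul, add_mul, add_mul, add_mul,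
        (h₁₂ a.1 b.2.1).eq, (h₁₂ b.1 a.2.1).eq]
      abel
    have f2 : ∀ p q r t : C, Commute p t → Commute q r → Commute r t →
        (p + r) * (q + t) - (q + t) * (p + r) = p * q - q * p := by
      intro p q r t h h' h''
      rw [mul_add, add_mul, add_mul, mul_add, add_mul, add_mul, h.eq, h'.eq, h''.eq]
      abel
    rw [add_sub_add_right_eq_sub, ← f1]
    exact f2 _ _ _ _ (e a b) (e b a) e'
  let φ : zeroPart (cartanIncl K A n) →ₗ⁅K⁆ C :=
    { toFun := fun x => θ (levelValue z w x.1.1)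
      map_add' := fun x y => (congrArg θ (levelValue_add z w x.1.1 y.1.1)).trans (map_add θ _ _)
      map_smul' := fun c x => (congrArg θ (levelValue_smul z w c x.1.1)).trans (map_smul θ _ _)
      map_lie' := fun {x y} => by
        rw [LieRing.of_associative_ring_bracket, hθ, ← map_sub,
          levelValue_lie (isDiag_of_mem_zeroPart x.2) (isDiag_of_mem_zeroPart y.2)] }
  obtain ⟨χ, hχ1, hχ⟩ := exists_enveloping_functional hθ (levelAction K) (levelBase A z w)
    (levelRightAction K) (levelProj K z w) levelAction_levelRightAction
    (levelProj_levelRightAction z w)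
  refine ⟨φ, fun x => ?_, fun s hs => ?_⟩
  · change θ _ = _
    rw [hθ_apply]
    simp only [levelValue, trace_level]
    rw [MulOpposite.op_neg, map_neg, ← sub_eq_add_neg]
  · refine eq_zero_of_mem_congruenceGraph hχ1 (fun x u => ?_) (fun x hx u => ?_) hs
    · exact hχ _ _ (levelAction_levelBase hz hw fun p q h => isDiag_of_mem_zeroPart x.2 h.ne')
        (levelProj_levelBase z w _) u
    · rw [hχ _ _ (levelAction_levelBase hz hw fun p q h => strictUpper_of_mem_posPart hx h.le)
        (levelProj_levelBase z w _) u, hθ_apply]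
      -- `θ` sees only diagonal entries of a matrix, and these vanish on `L₊`.
      have hd : ∀ p, x.1 p p = 0 := fun p => strictUpper_of_mem_posPart hx le_rfl
      simp only [levelValue, trace_level, hd]
      simp

end WeightFunctional

/-! ### The universal property of the factors `B_i` -/

section FactorMap

variable {K : Type u} [Field K] {A : Type v} [Ring A] [Algebra K A] {n : ℕ}
variable {C : Type*} [Ring C] [Algebra K C]

/-- The linear maps that satisfy the relations of the `i`-th factor. -/
def IsFactorMap (l : Fin (n - 1) → ℕ) (i : Fin (n - 1)) (θ : A →ₗ[K] C) : Prop :=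
  if (i : ℕ) = 0 then IsPowerSum θ (l i)
  else if (i : ℕ) = n - 2 then
    IsPowerSum (θ ∘ₗ (MulOpposite.opLinearEquiv K).symm.toLinearMap) (l i)
  else IsPowerSum θ (l i) ∧ ∀ a b, θ a * θ b = θ b * θ a

/-- Treats the three kinds of nodes uniformly: each factor is generated by a universal map
satisfying `IsFactorMap`, so the case distinction is not needed in the final assembly. -/
theorem exists_factorMap [CharZero K] (l : Fin (n - 1) → ℕ) (i : Fin (n - 1)) :
    ∃ δ : A →ₗ[K] factor K A l i, IsFactorMap l i δ ∧ Algebra.adjoin K (Set.range δ) = ⊤ ∧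
      ∀ {C : Type (max u v)} [Ring C] [Algebra K C] (θ : A →ₗ[K] C), IsFactorMap l i θ →
        ∃ g : factor K A l i →ₐ[K] C, ∀ a, g (δ a) = θ a := by
  by_cases h1 : (i : ℕ) = 0
  · rw [show factor K A l i = AlgCat.of K (symTensors K A (l i)) from if_pos h1]
    simp only [IsFactorMap, if_pos h1]
    exact ⟨symPowerSum K (l i), isPowerSum_symPowerSum _, adjoin_symPowerSum _,
      fun _ hθ => hθ.exists_symTensors_lift⟩
  by_cases h2 : (i : ℕ) = n - 2
  · rw [show factor K A l i = AlgCat.of K (symTensors K Aᵐᵒᵖ (l i)) from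
      (if_neg h1).trans (if_pos h2)]
    simp only [IsFactorMap, if_neg h1, if_pos h2]
    refine ⟨symPowerSum K (l i) ∘ₗ (MulOpposite.opLinearEquiv K).toLinearMap,
      isPowerSum_symPowerSum _, ?_, fun θ hθ => ?_⟩
    · refine Eq.trans ?_ (adjoin_symPowerSum (K := K) (A := Aᵐᵒᵖ) (l i))
      rw [LinearMap.coe_comp]
      congr 1
      exact (MulOpposite.opLinearEquiv K).surjective.range_comp _
    · obtain ⟨g, hg⟩ := hθ.exists_symTensors_lift
      exact ⟨g, fun a => hg (MulOpposite.op a)⟩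
  · rw [show factor K A l i = AlgCat.of K (SymTensorsAb K A (l i)) from
      (if_neg h1).trans (if_neg h2)]
    simp only [IsFactorMap, if_neg h1, if_neg h2]
    exact ⟨symPowerSumAb K (A := A) (l i),
      ⟨isPowerSum_symPowerSumAb _, symPowerSumAb_commute K _⟩, adjoin_symPowerSumAb _,
      fun _ hθ => hθ.1.exists_symTensorsAb_lift hθ.2⟩

theorem IsFactorMap.map {l : Fin (n - 1) → ℕ} {i : Fin (n - 1)} {θ : A →ₗ[K] C}
    (hθ : IsFactorMap l i θ) {C' : Type*} [Ring C'] [Algebra K C'] (f : C →ₐ[K] C') :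
    IsFactorMap l i (f.toLinearMap ∘ₗ θ) := by
  have key : ∀ {R : Type v} [Ring R] [Algebra K R] {θ : R →ₗ[K] C}, IsPowerSum θ (l i) →
      IsPowerSum (f.toLinearMap ∘ₗ θ) (l i) := by
    intro R _ _ θ h
    refine ⟨fun a b => ?_, ?_, fun l hl => ?_⟩
    · change f _ * f _ - f _ * f _ = f _ - f _
      rw [← map_mul f, ← map_mul f, ← map_sub f, ← map_sub f, h.comm]
    · change f _ = _
      rw [h.one, map_natCast]
    · have := map_newton f.toRingHom (θ := θ) l
      rw [h.vanish l hl] at this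
      exact this.symm.trans (map_zero f)
  unfold IsFactorMap at hθ ⊢
  split_ifs at hθ ⊢ with h1 h2
  · exact key hθ
  · exact key hθ
  · refine ⟨key hθ.1, fun a b => ?_⟩
    change f _ * f _ = f _ * f _
    rw [← map_mul f, ← map_mul f, hθ.2]

theorem IsFactorMap.one {l : Fin (n - 1) → ℕ} {i : Fin (n - 1)} {θ : A →ₗ[K] C}
    (hθ : IsFactorMap l i θ) : θ 1 = l i := by
  unfold IsFactorMap at hθ
  split_ifs at hθ with h1 h2
  exacts [hθ.one, hθ.one, hθ.1.one]

/-- For `ℓ + 1` factors the Newton polynomial given by straightening is zero. -/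
theorem IsSl2Triple.prod_mul_prod_mem_of_isPowerSum [CharZero K] {U U₀ R : Type*} [Ring U]
    [Algebra K U] [Ring U₀] [Algebra K U₀] [Ring R] [Algebra K R] {incl : U₀ →ₐ[K] U} {J : Ideal U}
    {x y : R →ₗ[K] U} {h : R → U₀} (H : IsSl2Triple incl J x y h) {θ : R →ₗ[K] C}
    {ψ : U₀ →ₐ[K] C} {ℓ : ℕ} (hθ : IsPowerSum θ ℓ) (hψ : ∀ b, ψ (h b) = θ b) (k l : List R)
    (hk : k.length = ℓ + 1) (hl : l.length = ℓ + 1) :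
    ((k.map x).prod * (l.map y).prod, (0 : C)) ∈ congruenceGraph incl J ψ := by
  refine H.prod_mul_prod_mem (fun l hl => ?_) k l hk hl
  have := H.pow_mul_prod hθ.comm hψ l
  rwa [hθ.vanish l hl, smul_zero, hl] at this

theorem IsFactorMap.prod_mul_prod_mem [CharZero K] {l : Fin (n - 1) → ℕ} {i : Fin (n - 1)}
    {θ : A →ₗ[K] C} (hθ : IsFactorMap l i θ) {U U₀ : Type*} [Ring U] [Algebra K U] [Ring U₀]
    [Algebra K U₀] {incl : U₀ →ₐ[K] U} {J : Ideal U} {x y : A →ₗ[K] U} {h : A → U₀}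
    (H : IsSl2Triple incl J x y h) {ψ : U₀ →ₐ[K] C} (hψ : ∀ b, ψ (h b) = θ b) (s t : List A)
    (hs : s.length = l i + 1) (ht : t.length = l i + 1) :
    ((s.map x).prod * (t.map y).prod, (0 : C)) ∈ congruenceGraph incl J ψ := by
  unfold IsFactorMap at hθ
  split_ifs at hθ with h1 h2
  · exact H.prod_mul_prod_mem_of_isPowerSum hθ hψ s t hs ht
  · have := H.op.prod_mul_prod_mem_of_isPowerSum hθ (fun b => hψ b.unop)
      (s.map MulOpposite.op) (t.map MulOpposite.op) (by simpa using hs) (by simpa using ht)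
    rw [List.map_map, List.map_map] at this
    exact this
  · exact H.prod_mul_prod_mem_of_isPowerSum hθ.1 hψ s t hs ht

end FactorMap

/-! ### Elements of weight zero in the enveloping algebra -/

section HarishChandra

variable {K : Type u} [Field K] {L : Type*} [LieRing L] [LieAlgebra K L]
variable {T : Type*} [AddCommGroup T] [Module K T] {τ : T →ₗ[K] L}

theorem envelopingIncl_mem_envelopingZero (u : UniversalEnvelopingAlgebra K (zeroPart τ)) :
    envelopingIncl τ u ∈ envelopingZero τ := by
  have hu : u ∈ Algebra.adjoin K (Set.range (UniversalEnvelopingAlgebra.ι K : zeroPart τ → _)) := by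
    rw [adjoin_range_ι]; trivial
  have hle : Algebra.adjoin K (Set.range (UniversalEnvelopingAlgebra.ι K : zeroPart τ → _)) ≤
      (envelopingZero τ).comap (envelopingIncl τ) := by
    refine Algebra.adjoin_le ?_
    rintro _ ⟨x, rfl⟩ _ ⟨t, rfl⟩
    change _ * envelopingIncl τ _ = envelopingIncl τ _ * _
    have hx : ⁅τ t, (x : L)⁆ = 0 := by simpa using x.2 t
    rw [envelopingIncl_ι, ι_mul_ι, hx, map_zero, add_zero]
  exact hle hu

theorem ι_mul_prod_of_weight {t : T} {c : K} (s : List L) (hs : ∀ x ∈ s, ⁅τ t, x⁆ = c • x) :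
    UniversalEnvelopingAlgebra.ι K (τ t) * (s.map (UniversalEnvelopingAlgebra.ι K)).prod =
      (s.map (UniversalEnvelopingAlgebra.ι K)).prod * UniversalEnvelopingAlgebra.ι K (τ t) +
        (s.length * c) • (s.map (UniversalEnvelopingAlgebra.ι K)).prod := by
  induction s with
  | nil => simp
  | cons x s ih =>
    rw [List.map_cons, List.prod_cons, ← mul_assoc, ι_mul_ι, hs x (by simp), map_smul, add_mul,
      mul_assoc, ih fun y hy => hs y (by simp [hy]), mul_add, ← mul_assoc, mul_smul_comm,
      smul_mul_assoc, add_assoc, ← add_smul, List.length_cons]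
    push_cast
    rw [add_mul, one_mul]

theorem prod_mul_prod_mem_envelopingZero {β : Module.Dual K T} (s t : List L)
    (hst : s.length = t.length) (hs : ∀ x ∈ s, x ∈ weightSpace τ β)
    (ht : ∀ y ∈ t, y ∈ weightSpace τ (-β)) :
    (s.map (UniversalEnvelopingAlgebra.ι K)).prod * (t.map (UniversalEnvelopingAlgebra.ι K)).prod ∈
      envelopingZero τ := by
  rintro _ ⟨r, rfl⟩
  change UniversalEnvelopingAlgebra.ι K (τ r) * _ = _ * UniversalEnvelopingAlgebra.ι K (τ r)
  rw [← mul_assoc, ι_mul_prod_of_weight s fun x hx => hs x hx r, add_mul, mul_assoc,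
    ι_mul_prod_of_weight t fun y hy => ht y hy r, mul_add, mul_assoc, smul_mul_assoc,
    mul_smul_comm, hst, add_assoc, ← add_smul]
  simp

end HarishChandra

/-! ### The homomorphism from the Seligman algebra to the tensor product -/

section Comparison

variable {K : Type u} [Field K] {A : Type v} [Ring A] [Algebra K A] {n : ℕ}
variable {C : Type*} [Ring C] [Algebra K C]

theorem IsFactorMap.isPowerSum_zero {l : Fin (n - 1) → ℕ} {i : Fin (n - 1)} {θ : A →ₗ[K] C}
    (hθ : IsFactorMap l i θ) (hi : (i : ℕ) = 0) : IsPowerSum θ (l i) := by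
  simpa only [IsFactorMap, if_pos hi] using hθ

theorem IsFactorMap.isPowerSum_last {l : Fin (n - 1) → ℕ} {i : Fin (n - 1)} {θ : A →ₗ[K] C}
    (hθ : IsFactorMap l i θ) (h0 : (i : ℕ) ≠ 0) (hi : (i : ℕ) = n - 2) :
    IsPowerSum (θ ∘ₗ (MulOpposite.opLinearEquiv K).symm.toLinearMap) (l i) := by
  simpa only [IsFactorMap, if_neg h0, if_pos hi] using hθ

theorem IsFactorMap.isPowerSum_inner {l : Fin (n - 1) → ℕ} {i : Fin (n - 1)} {θ : A →ₗ[K] C}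
    (hθ : IsFactorMap l i θ) (h0 : (i : ℕ) ≠ 0) (hi : (i : ℕ) ≠ n - 2) :
    IsPowerSum θ (l i) ∧ ∀ a b, θ a * θ b = θ b * θ a := by
  simpa only [IsFactorMap, if_neg h0, if_neg hi] using hθ

theorem corootBracket_apply (i : Fin (n - 1)) (b : A) (p : Fin n) :
    (corootBracket K i 1 b).1.1 p p =
      (if p = lo i then b else 0) - (if p = hi i then b else 0) := by
  rw [coe_corootBracket, one_mul, mul_one, Matrix.sub_apply, Matrix.single_apply,
    Matrix.single_apply]
  simp only [and_self, eq_comm]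

theorem sum_corootBracket_apply (i k : Fin (n - 1)) (b : A) :
    (∑ j, if j ≤ lo k then (corootBracket K i 1 b).1.1 j j else 0) = if i = k then b else 0 := by
  have h : ∀ j : Fin n, (if j ≤ lo k then (corootBracket K i 1 b).1.1 j j else 0) =
      (if j = lo i then (if lo i ≤ lo k then b else 0) else 0) -
        (if j = hi i then (if hi i ≤ lo k then b else 0) else 0) := by
    intro j
    rw [corootBracket_apply]
    by_cases h1 : j = lo i
    · rw [if_pos h1, if_pos h1, if_neg (h1.trans_ne (lo_ne_hi i)),
        if_neg (h1.trans_ne (lo_ne_hi i)), h1, sub_zero, sub_zero]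
    · by_cases h2 : j = hi i
      · rw [if_pos h2, if_neg h1, if_neg h1, if_pos h2, h2]
        split_ifs <;> simp
      · simp [h1, h2]
  rw [Finset.sum_congr rfl fun j _ => h j, Finset.sum_sub_distrib, Finset.sum_ite_eq',
    Finset.sum_ite_eq', if_pos (Finset.mem_univ _), if_pos (Finset.mem_univ _)]
  simp only [lo, hi, Fin.le_def, Fin.ext_iff]
  split_ifs <;> first | omega | simp

/-- The entry at the first position, minus the entry at the last one, and the sums of the first `k`
entries are dual to the `h_i(1, ·)`. So the outer nodes use the column and dual row modules, which
need no commutativity, and the inner nodes use traces, for which commutativity of `Δ k` is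
essential. -/
theorem exists_factor_weightHom [CharZero K] (hn : 3 ≤ n) {l : Fin (n - 1) → ℕ}
    {Δ : Fin (n - 1) → A →ₗ[K] C} (hΔ : ∀ i, IsFactorMap l i (Δ i))
    (hcomm : ∀ i j, i ≠ j → ∀ a b, Commute (Δ i a) (Δ j b)) :
    ∃ φ : zeroPart (cartanIncl K A n) →ₗ⁅K⁆ C,
      (∀ i b, φ (corootBracket K i 1 b) = Δ i b) ∧
      ∀ s, (0, s) ∈ congruenceGraph (envelopingIncl (cartanIncl K A n))
        (posIdeal (cartanIncl K A n) (posRoots K n)) (UniversalEnvelopingAlgebra.lift K φ) →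
        s = 0 := by
  let i₀ : Fin (n - 1) := ⟨0, by omega⟩
  let i₁ : Fin (n - 1) := ⟨n - 2, by omega⟩
  -- The trace components at the two outer nodes are set to 0; otherwise `Δ` would be counted twice
  -- there, and cyclic invariance may fail.
  let inner : Fin (n - 1) → A →ₗ[K] C :=
    fun k => if (k : ℕ) ≠ 0 ∧ (k : ℕ) ≠ n - 2 then Δ k else 0
  have hinner : ∀ k, inner k = 0 ∨ (inner k = Δ k ∧ (k : ℕ) ≠ 0 ∧ (k : ℕ) ≠ n - 2) := by
    intro k
    by_cases h : (k : ℕ) ≠ 0 ∧ (k : ℕ) ≠ n - 2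
    · exact .inr ⟨if_pos h, h⟩
    · exact .inl (if_neg h)
  have hne : i₀ ≠ i₁ := fun h => by
    have := congrArg Fin.val h
    change 0 = n - 2 at this
    omega
  have houter : ∀ i : Fin (n - 1), ¬((i : ℕ) ≠ 0 ∧ (i : ℕ) ≠ n - 2) →
      ∀ a k b, Commute (Δ i a) (inner k b) := by
    intro i hi a k b
    rcases hinner k with h | ⟨h, h'⟩ <;> rw [h]
    · exact Commute.zero_right _
    · exact hcomm _ _ (fun e : i = k => hi (by rw [e]; exact h')) a b
  have htrace : ∀ k a b, inner k (a * b) = inner k (b * a) := by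
    intro k a b
    rcases hinner k with h | ⟨h, h0, h1⟩ <;> rw [h]
    · rfl
    · obtain ⟨h2, h3⟩ := (hΔ k).isPowerSum_inner h0 h1
      rw [← sub_eq_zero, ← h2.comm, h3, sub_self]
  have hcomm' : ∀ j a k b, Commute (inner j a) (inner k b) := by
    intro j a k b
    rcases hinner j with h | ⟨h, h'⟩
    · rw [h]
      exact Commute.zero_left _
    · rw [h]
      by_cases hjk : j = k
      · subst hjk
        rw [h]
        exact ((hΔ j).isPowerSum_inner h'.1 h'.2).2 a b
      · rcases hinner k with h2 | ⟨h2, -⟩ <;> rw [h2]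
        · exact Commute.zero_right _
        · exact hcomm _ _ hjk a b
  obtain ⟨φ, hφ, hs⟩ := exists_weightHom (K := K) (A := A) (n := n) (z := ⟨0, by omega⟩)
    (w := ⟨n - 1, by omega⟩) (fun p => Nat.zero_le _) (fun p => Nat.le_sub_one_of_lt p.2) (Δ i₀)
    (Δ i₁ ∘ₗ (MulOpposite.opLinearEquiv K).symm.toLinearMap) inner
    ((hΔ i₀).isPowerSum_zero rfl).comm
    ((hΔ i₁).isPowerSum_last (by change n - 2 ≠ 0; omega) rfl).comm htrace
    (fun a b => hcomm _ _ hne a _) (houter i₀ fun h => h.1 rfl)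
    (fun a => houter i₁ (fun h => h.2 rfl) a.unop) hcomm'
  refine ⟨φ, fun i b => ?_, hs⟩
  rw [hφ]
  have hsum : ∀ k, inner k (∑ j, if j ≤ lo k then (corootBracket K i 1 b).1.1 j j else 0) =
      if k = i then inner i b else 0 := by
    intro k
    rw [sum_corootBracket_apply]
    by_cases h : k = i
    · rw [if_pos h, if_pos h.symm, h]
    · rw [if_neg h, if_neg (Ne.symm h), map_zero]
  rw [Finset.sum_congr rfl fun k _ => hsum k, Finset.sum_ite_eq', if_pos (Finset.mem_univ _),
    corootBracket_apply, corootBracket_apply]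
  simp only [lo, hi, Fin.ext_iff]
  by_cases h0 : (i : ℕ) = 0
  · have hii : i = i₀ := Fin.ext h0
    subst hii
    rw [if_pos rfl, if_neg (by omega), if_neg (by omega), if_neg (by omega)]
    simp [inner, i₀]
  · by_cases h1 : (i : ℕ) = n - 2
    · have hii : i = i₁ := Fin.ext h1
      rw [if_neg (Ne.symm h0), if_neg (by omega), if_neg (by omega), if_pos (by omega)]
      subst hii
      simp [inner, i₁]
    · rw [if_neg (Ne.symm h0), if_neg (by omega), if_neg (by omega), if_neg (by omega)]
      simp [inner, h0, h1]

theorem exists_map_rootVector {m : ℕ} {p q : Fin n} [CharZero K] (hpq : p ≠ q)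
    {β : Module.Dual K (cartan K n)} (hβ : β = eps K n p - eps K n q)
    {x : Fin m → sl K A n} (hx : ∀ j, x j ∈ weightSpace (cartanIncl K A n) β) :
    ∃ s : List A, s.length = m ∧ (List.ofFn fun j => UniversalEnvelopingAlgebra.ι K (x j)) =
      s.map (ιLinear K (sl K A n) ∘ₗ rootVector K hpq) := by
  subst hβ
  refine ⟨List.ofFn fun j => (x j).1 p q, List.length_ofFn, ?_⟩
  rw [List.map_ofFn]
  congr 1
  funext j
  exact congrArg _ (eq_rootVector_of_mem_weightSpace hpq (hx j))

theorem corootBracket_one_one (i : Fin (n - 1)) :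
    ((corootBracket K i 1 1 : zeroPart (cartanIncl K A n)) : sl K A n) =
      cartanIncl K A n (coroot K i) := by
  refine Subtype.ext ?_
  rw [coe_corootBracket, one_mul]
  change _ = (Matrix.diagonal _ : Matrix (Fin n) (Fin n) K).map (algebraMap K A)
  rw [Matrix.diagonal_map (map_zero _), ← Matrix.diagonal_single, ← Matrix.diagonal_single,
    Matrix.diagonal_sub]
  congr 1
  funext p
  simp only [Pi.sub_apply, map_sub, Pi.single_apply]
  split_ifs <;> simp

/-- A generator `u` of type (i) is congruent to a product that straightening also makes congruent to
an element killed by the extension of `φ`. By `exists_factor_weightHom` the extension of `φ` then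
kills `u` too. Type (ii) is the relation `Δ i 1 = l i`. -/
theorem exists_seligmanHom [CharZero K] (hn : 3 ≤ n) {l : Fin (n - 1) → ℕ}
    {lam : Module.Dual K (cartan K n)} (hlam : ∀ i, lam (coroot K i) = (l i : K))
    {Δ : Fin (n - 1) → A →ₗ[K] C} (hΔ : ∀ i, IsFactorMap l i (Δ i))
    (hcomm : ∀ i j, i ≠ j → ∀ a b, Commute (Δ i a) (Δ j b)) :
    ∃ f : SlSeligman K A lam →ₐ[K] C, ∀ i b,
      f ((seligmanIdeal (cartanIncl K A n) (posRoots K n) (simpleRoot K) (coroot K)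
        lam).ringCon.mkₐ K (UniversalEnvelopingAlgebra.ι K (corootBracket K i 1 b))) = Δ i b := by
  obtain ⟨φ, hφ, hs⟩ := exists_factor_weightHom hn hΔ hcomm
  obtain ⟨f, hf⟩ := exists_spanQuotient_lift (UniversalEnvelopingAlgebra.lift K φ)
    (s := seligmanGenerators (cartanIncl K A n) (posRoots K n) (simpleRoot K) (coroot K) lam) (by
    rintro u (⟨i, l', m, β, x, y, hl', hx, hy, hsum, hu⟩ | ⟨i, x, hx, rfl⟩)
    · obtain rfl : l' = l i := Nat.cast_injective (R := K) (hl'.symm.trans (hlam i))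
      -- All the `x j` thus lie in the root space of the simple root, so the product involves a
      -- single `sl₂`-triple.
      obtain ⟨rfl, hβ⟩ := posRoots_sum_eq (fun j => (hx j).1) hsum
      obtain ⟨s, hs1, hs2⟩ := exists_map_rootVector (lo_ne_hi i) (hβ := rfl)
        (fun j => (hβ j) ▸ (hx j).2)
      obtain ⟨t, ht1, ht2⟩ := exists_map_rootVector (lo_ne_hi i).symm (hβ := neg_sub _ _) hy
      rw [hs2, ht2] at hu
      have h1 := (hΔ i).prod_mul_prod_mem (isSl2Triple i) (ψ := UniversalEnvelopingAlgebra.lift K φ)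
        (fun b => (UniversalEnvelopingAlgebra.lift_ι_apply _ _ _).trans (hφ i b)) s t hs1 ht1
      have h2 : (_, UniversalEnvelopingAlgebra.lift K φ u) ∈ congruenceGraph _ _ _ :=
        mem_congruenceGraph.2 ⟨u, hu.2.2, rfl⟩
      refine hs _ ?_
      have h3 := sub_mem h2 h1
      rw [Prod.mk_sub_mk, sub_self, sub_zero] at h3
      exact h3
    · obtain rfl : x = corootBracket K i 1 1 :=
        Subtype.ext (hx.trans (corootBracket_one_one i).symm)
      rw [map_sub, UniversalEnvelopingAlgebra.lift_ι_apply, hφ, (hΔ i).one, AlgHom.commutes, hlam,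
        map_natCast, sub_self])
  exact ⟨f, fun i b => (hf _).trans ((UniversalEnvelopingAlgebra.lift_ι_apply _ _ _).trans (hφ i b))⟩

end Comparison

/-! ### The relations and generators of the Seligman algebra -/

section Relations

variable {K : Type u} [Field K] {A : Type v} [Ring A] [Algebra K A] {n : ℕ}

variable (A) in
/-- The quotient map from `U(L₀)` to the Seligman algebra. -/
def seligmanMk (lam : Module.Dual K (cartan K n)) :
    UniversalEnvelopingAlgebra K (zeroPart (cartanIncl K A n)) →ₐ[K] SlSeligman K A lam :=
  (seligmanIdeal (cartanIncl K A n) (posRoots K n) (simpleRoot K) (coroot K) lam).ringCon.mkₐ K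

theorem seligmanMk_surjective (lam : Module.Dual K (cartan K n)) :
    Function.Surjective (seligmanMk A lam) :=
  RingCon.mkₐ_surjective _

theorem seligmanMk_of_mem {lam : Module.Dual K (cartan K n)}
    {u : UniversalEnvelopingAlgebra K (zeroPart (cartanIncl K A n))}
    (hu : u ∈ seligmanGenerators (cartanIncl K A n) (posRoots K n) (simpleRoot K) (coroot K) lam) :
    seligmanMk A lam u = 0 := by
  have h : u ∈ seligmanIdeal (cartanIncl K A n) (posRoots K n) (simpleRoot K) (coroot K) lam :=
    TwoSidedIdeal.subset_span hu
  exact (RingCon.eq _).2 h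

theorem exists_ofFn_eq {α : Type*} {m : ℕ} (s : List α) (hs : s.length = m) :
    ∃ a : Fin m → α, s = List.ofFn a := by
  subst hs
  exact ⟨s.get, (List.ofFn_get s).symm⟩

variable {l : Fin (n - 1) → ℕ} {lam : Module.Dual K (cartan K n)}

/-- Any `u` congruent to such a product modulo `U(L) L₊` is itself a generator of the ideal, because
the product and the image of `u` have weight zero. -/
theorem seligmanMk_eq_zero (hlam : ∀ i, lam (coroot K i) = (l i : K)) (i : Fin (n - 1))
    (s t : List A) (hs : s.length = l i + 1) (ht : t.length = l i + 1)
    {u : UniversalEnvelopingAlgebra K (zeroPart (cartanIncl K A n))}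
    (hu : (s.map (ιLinear K (sl K A n) ∘ₗ rootVector K (lo_ne_hi i))).prod *
        (t.map (ιLinear K (sl K A n) ∘ₗ rootVector K (lo_ne_hi i).symm)).prod -
      envelopingIncl (cartanIncl K A n) u ∈ posIdeal (cartanIncl K A n) (posRoots K n)) :
    seligmanMk A lam u = 0 := by
  have hz : (s.map (ιLinear K (sl K A n) ∘ₗ rootVector K (lo_ne_hi i))).prod *
      (t.map (ιLinear K (sl K A n) ∘ₗ rootVector K (lo_ne_hi i).symm)).prod ∈
        envelopingZero (cartanIncl K A n) := by
    have := prod_mul_prod_mem_envelopingZero (τ := cartanIncl K A n) (β := simpleRoot K i)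
      (s.map (rootVector K (lo_ne_hi i))) (t.map (rootVector K (lo_ne_hi i).symm))
      (by simp [hs, ht]) (by
        intro x hx
        obtain ⟨a, -, rfl⟩ := List.mem_map.1 hx
        exact rootVector_mem_weightSpace _ _) (by
        intro x hx
        obtain ⟨a, -, rfl⟩ := List.mem_map.1 hx
        rw [simpleRoot, neg_sub]
        exact rootVector_mem_weightSpace _ _)
    rw [List.map_map, List.map_map] at this
    exact this
  obtain ⟨a, rfl⟩ := exists_ofFn_eq s hs
  obtain ⟨b, rfl⟩ := exists_ofFn_eq t ht
  rw [List.map_ofFn, List.map_ofFn] at hu hz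
  refine seligmanMk_of_mem (.inl ⟨i, l i, l i + 1, fun _ => simpleRoot K i,
    fun j => rootVector K (lo_ne_hi i) (a j), fun j => rootVector K (lo_ne_hi i).symm (b j), hlam i,
    fun j => ⟨⟨_, _, lo_lt_hi i, rfl⟩, rootVector_mem_weightSpace _ _⟩, fun j => ?_, by simp,
    hz, sub_mem hz (envelopingIncl_mem_envelopingZero u), hu⟩)
  rw [simpleRoot, neg_sub]
  exact rootVector_mem_weightSpace _ _

/-- The image of `[E_{i,i+1}, a E_{i+1,i}]` in the Seligman algebra, as a function of `a`. -/
def seligmanPowerSum (lam : Module.Dual K (cartan K n)) (i : Fin (n - 1)) :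
    A →ₗ[K] SlSeligman K A lam :=
  (seligmanMk A lam).toLinearMap ∘ₗ ιLinear K (zeroPart (cartanIncl K A n)) ∘ₗ
    { toFun := corootBracket K i 1
      map_add' := corootBracket_add_right i 1
      map_smul' := fun r => corootBracket_smul_right i r 1 }

theorem seligmanPowerSum_apply (i : Fin (n - 1)) (b : A) :
    seligmanPowerSum lam i b =
      seligmanMk A lam (UniversalEnvelopingAlgebra.ι K (corootBracket K i 1 b)) := rfl

/-- For `l i = 0` the relation (i) has one factor of each kind, and `x y = y x + [x, y]` is
congruent to `[x, y]`. -/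
theorem seligmanMk_corootBracket_of_eq_zero (hlam : ∀ i, lam (coroot K i) = (l i : K))
    {i : Fin (n - 1)} (h0 : l i = 0) (a b : A) :
    seligmanMk A lam (UniversalEnvelopingAlgebra.ι K (corootBracket K i a b)) = 0 := by
  refine seligmanMk_eq_zero hlam i [a] [b] (by simp [h0]) (by simp [h0]) ?_
  rw [envelopingIncl_ι]
  simp only [List.map_cons, List.map_nil, List.prod_cons, List.prod_nil, mul_one]
  change UniversalEnvelopingAlgebra.ι K _ * UniversalEnvelopingAlgebra.ι K _ -
    UniversalEnvelopingAlgebra.ι K ⁅_, _⁆ ∈ _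
  rw [ι_mul_ι, add_sub_cancel_right]
  exact Ideal.mul_mem_left _ _ (Ideal.subset_span ⟨_, Submodule.mem_iSup_of_mem _
    (Submodule.mem_iSup_of_mem ⟨lo i, hi i, lo_lt_hi i, rfl⟩
      (rootVector_mem_weightSpace (lo_ne_hi i) a)), rfl⟩)

theorem seligmanPowerSum_of_eq_zero (hlam : ∀ i, lam (coroot K i) = (l i : K))
    {i : Fin (n - 1)} (hi : l i = 0) (b : A) : seligmanPowerSum lam i b = 0 :=
  seligmanMk_corootBracket_of_eq_zero hlam hi 1 b

/-- By `commutator_succ_eq` the two defects agree, and one of them is zero because one of the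
neighbouring nodes has level 0. -/
theorem seligmanMk_corootBracket_succ (hlam : ∀ i, lam (coroot K i) = (l i : K))
    (hl : TotallyDisconnectedSupport l) {i j : Fin (n - 1)} (hij : (j : ℕ) = i + 1) (a b : A) :
    seligmanMk A lam (UniversalEnvelopingAlgebra.ι K (corootBracket K i a b)) =
        seligmanPowerSum lam i (a * b) ∧
      seligmanMk A lam (UniversalEnvelopingAlgebra.ι K (corootBracket K j a b)) =
        seligmanPowerSum lam j (b * a) := by
  have h := congrArg (fun x => seligmanMk A lam (UniversalEnvelopingAlgebra.ι K x))
    (commutator_succ_eq (K := K) hij a b)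
  simp only [map_sub, ← seligmanPowerSum_apply] at h
  rw [← sub_eq_zero, ← sub_eq_zero (a := seligmanMk A lam _), ← h, and_self]
  rcases hl i j hij with h0 | h0
  · rw [seligmanMk_corootBracket_of_eq_zero hlam h0, seligmanPowerSum_of_eq_zero hlam h0, sub_zero]
  · rw [h, seligmanMk_corootBracket_of_eq_zero hlam h0, seligmanPowerSum_of_eq_zero hlam h0,
      sub_zero]

theorem seligmanMk_corootBracket_left (hlam : ∀ i, lam (coroot K i) = (l i : K))
    (hl : TotallyDisconnectedSupport l) {i : Fin (n - 1)} (hi : (i : ℕ) ≠ n - 2) (a b : A) :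
    seligmanMk A lam (UniversalEnvelopingAlgebra.ι K (corootBracket K i a b)) =
      seligmanPowerSum lam i (a * b) :=
  (seligmanMk_corootBracket_succ hlam hl (j := ⟨i + 1, by omega⟩) rfl a b).1

theorem seligmanMk_corootBracket_right (hlam : ∀ i, lam (coroot K i) = (l i : K))
    (hl : TotallyDisconnectedSupport l) {i : Fin (n - 1)} (hi : (i : ℕ) ≠ 0) (a b : A) :
    seligmanMk A lam (UniversalEnvelopingAlgebra.ι K (corootBracket K i a b)) =
      seligmanPowerSum lam i (b * a) :=
  (seligmanMk_corootBracket_succ hlam hl (i := ⟨i - 1, by omega⟩) (j := i)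
    (by change (i : ℕ) = i - 1 + 1; omega) a b).2

theorem commute_seligmanMk_ι {x y : zeroPart (cartanIncl K A n)} (h : ⁅x, y⁆ = 0) :
    Commute (seligmanMk A lam (UniversalEnvelopingAlgebra.ι K x))
      (seligmanMk A lam (UniversalEnvelopingAlgebra.ι K y)) := by
  refine Commute.map ?_ (seligmanMk A lam)
  change _ * _ = _ * _
  rw [ι_mul_ι, h, map_zero, add_zero]

theorem seligmanPowerSum_sub (i : Fin (n - 1)) (a b : A) :
    seligmanPowerSum lam i a * seligmanPowerSum lam i b -
        seligmanPowerSum lam i b * seligmanPowerSum lam i a =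
      (seligmanMk A lam (UniversalEnvelopingAlgebra.ι K (corootBracket K i a b)) -
        seligmanPowerSum lam i (b * a)) +
      (seligmanMk A lam (UniversalEnvelopingAlgebra.ι K (corootBracket K i a b)) -
        seligmanPowerSum lam i (a * b)) := by
  simp only [seligmanPowerSum_apply]
  rw [← map_mul (seligmanMk A lam), ← map_mul (seligmanMk A lam), ι_mul_ι, map_add,
    add_sub_cancel_left, lie_corootBracket_self]
  simp only [map_add, map_sub]

theorem seligmanPowerSum_one (hlam : ∀ i, lam (coroot K i) = (l i : K)) (i : Fin (n - 1)) :
    seligmanPowerSum lam i (1 : A) = l i := by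
  have h := seligmanMk_of_mem (A := A) (lam := lam)
    (.inr ⟨i, corootBracket K i 1 1, corootBracket_one_one i, rfl⟩)
  rw [map_sub, sub_eq_zero, AlgHom.commutes, hlam, map_natCast] at h
  exact h

/-- Straightening supplies a representative `u` with `ψ u = m! • newton θ t`. If every
representative is killed, division by `m!` gives the claim. -/
theorem IsSl2Triple.newton_eq_zero [CharZero K] {U U₀ R C : Type*} [Ring U] [Algebra K U]
    [Ring U₀] [Algebra K U₀] [Ring R] [Algebra K R] [Ring C] [Algebra K C] {incl : U₀ →ₐ[K] U}
    {J : Ideal U} {x y : R →ₗ[K] U} {h : R → U₀} (H : IsSl2Triple incl J x y h) {θ : R →ₗ[K] C}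
    {ψ : U₀ →ₐ[K] C} (hθ : ∀ a b, θ a * θ b - θ b * θ a = θ (a * b) - θ (b * a))
    (hψ : ∀ b, ψ (h b) = θ b) (t : List R)
    (ht : ∀ u, ((List.replicate t.length 1).map x).prod * (t.map y).prod - incl u ∈ J → ψ u = 0) :
    newton θ t = 0 := by
  obtain ⟨u, hu, hu'⟩ := mem_congruenceGraph.1 (H.pow_mul_prod hθ hψ t)
  rw [ht u (by rwa [List.map_replicate, List.prod_replicate]), ← Nat.cast_smul_eq_nsmul K] at hu'
  exact (smul_eq_zero.1 hu'.symm).resolve_left (Nat.cast_ne_zero.2 (Nat.factorial_ne_zero _))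

/-- In `seligmanPowerSum_sub` the defect towards each existing neighbour vanishes. At the first node
this leaves the commutator relation of `A`, at the last one that of `Aᵐᵒᵖ`, and at an inner node
both defects vanish, which makes the values commute. -/
theorem isFactorMap_seligmanPowerSum [CharZero K] (hn : 3 ≤ n)
    (hlam : ∀ i, lam (coroot K i) = (l i : K)) (hl : TotallyDisconnectedSupport l)
    (i : Fin (n - 1)) : IsFactorMap l i (seligmanPowerSum (A := A) lam i) := by
  have key : (∀ a b : A, seligmanPowerSum lam i a * seligmanPowerSum lam i b -
        seligmanPowerSum lam i b * seligmanPowerSum lam i a =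
        seligmanPowerSum lam i (a * b) - seligmanPowerSum lam i (b * a)) →
      IsPowerSum (seligmanPowerSum (A := A) lam i) (l i) := fun h =>
    ⟨h, seligmanPowerSum_one hlam i, fun t ht => (isSl2Triple i).newton_eq_zero
      (ψ := seligmanMk A lam) h (fun b => rfl) t fun u hu =>
        seligmanMk_eq_zero hlam i _ _ (by simp [ht]) ht hu⟩
  by_cases h0 : (i : ℕ) = 0
  · simp only [IsFactorMap, if_pos h0]
    refine key fun a b => ?_
    rw [seligmanPowerSum_sub, seligmanMk_corootBracket_left hlam hl (by omega), sub_self, add_zero]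
  by_cases h1 : (i : ℕ) = n - 2
  · simp only [IsFactorMap, if_neg h0, if_pos h1]
    have h : ∀ a b : Aᵐᵒᵖ, seligmanPowerSum lam i a.unop * seligmanPowerSum lam i b.unop -
        seligmanPowerSum lam i b.unop * seligmanPowerSum lam i a.unop =
        seligmanPowerSum lam i (a * b).unop - seligmanPowerSum lam i (b * a).unop := by
      intro a b
      rw [seligmanPowerSum_sub, seligmanMk_corootBracket_right hlam hl h0, sub_self, zero_add]
      rfl
    refine ⟨h, seligmanPowerSum_one hlam i, fun t ht => (isSl2Triple i).op.newton_eq_zero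
      (ψ := seligmanMk A lam) h (fun b => rfl) t fun u hu => seligmanMk_eq_zero hlam i
        ((List.replicate t.length (1 : Aᵐᵒᵖ)).map MulOpposite.unop) (t.map MulOpposite.unop)
        (by simp [ht]) (by simp [ht]) ?_⟩
    rw [List.map_map, List.map_map]
    exact hu
  · simp only [IsFactorMap, if_neg h0, if_neg h1]
    have h : ∀ a b : A, seligmanPowerSum lam i (a * b) = seligmanPowerSum lam i (b * a) := by
      intro a b
      rw [← seligmanMk_corootBracket_left hlam hl h1, seligmanMk_corootBracket_right hlam hl h0]
    have h' : ∀ a b : A, seligmanPowerSum lam i a * seligmanPowerSum lam i b -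
        seligmanPowerSum lam i b * seligmanPowerSum lam i a = 0 := by
      intro a b
      rw [seligmanPowerSum_sub, seligmanMk_corootBracket_right hlam hl h0, h a b, sub_self,
        add_zero]
    exact ⟨key fun a b => by rw [h', h, sub_self], fun a b => sub_eq_zero.1 (h' a b)⟩

/-- Distant nodes have disjoint diagonal positions; of two neighbouring nodes one has level 0, and
its map is zero. -/
theorem commute_seligmanPowerSum (hlam : ∀ i, lam (coroot K i) = (l i : K))
    (hl : TotallyDisconnectedSupport l) {i j : Fin (n - 1)} (hij : i ≠ j) (a b : A) :
    Commute (seligmanPowerSum lam i a) (seligmanPowerSum lam j b) := by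
  have hzero : l i = 0 ∨ l j = 0 →
      Commute (seligmanPowerSum lam i a) (seligmanPowerSum lam j b) := by
    rintro (h | h) <;> rw [seligmanPowerSum_of_eq_zero hlam h]
    · exact Commute.zero_left _
    · exact Commute.zero_right _
  by_cases h1 : (i : ℕ) = j + 1
  · exact hzero (hl j i h1).symm
  by_cases h2 : (j : ℕ) = i + 1
  · exact hzero (hl i j h2)
  · exact commute_seligmanMk_ι (lie_corootBracket_of_far hij h1 h2 a b)

theorem adjoin_seligmanPowerSum [CharZero K] (hn : 3 ≤ n)
    (hlam : ∀ i, lam (coroot K i) = (l i : K)) (hl : TotallyDisconnectedSupport l) :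
    Algebra.adjoin K (⋃ i, Set.range (seligmanPowerSum (A := A) lam i)) = ⊤ := by
  set S := Algebra.adjoin K (⋃ i, Set.range (seligmanPowerSum (A := A) lam i))
  have hθ : ∀ i b, seligmanPowerSum lam i b ∈ S := fun i b =>
    Algebra.subset_adjoin (Set.mem_iUnion.2 ⟨i, b, rfl⟩)
  have h1 : ∀ x : zeroPart (cartanIncl K A n),
      seligmanMk A lam (UniversalEnvelopingAlgebra.ι K x) ∈ S := by
    intro x
    have hx : x ∈ Submodule.span K
        (Set.range fun p : Fin (n - 1) × A × A => corootBracket K p.1 p.2.1 p.2.2) := by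
      rw [span_corootBracket (by omega)]; trivial
    have hle : Submodule.span K
        (Set.range fun p : Fin (n - 1) × A × A => corootBracket K p.1 p.2.1 p.2.2) ≤
        (Subalgebra.toSubmodule S).comap ((seligmanMk A lam).toLinearMap ∘ₗ ιLinear K _) := by
      rw [Submodule.span_le]
      rintro _ ⟨⟨i, a, b⟩, rfl⟩
      change seligmanMk A lam (UniversalEnvelopingAlgebra.ι K (corootBracket K i a b)) ∈ S
      by_cases h : (i : ℕ) = 0
      · rw [seligmanMk_corootBracket_left hlam hl (by omega)]
        exact hθ _ _
      · rw [seligmanMk_corootBracket_right hlam hl h]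
        exact hθ _ _
    exact hle hx
  rw [eq_top_iff]
  rintro x -
  obtain ⟨u, rfl⟩ := seligmanMk_surjective lam x
  have hu : u ∈ Algebra.adjoin K (Set.range (UniversalEnvelopingAlgebra.ι K :
      zeroPart (cartanIncl K A n) → _)) := by
    rw [adjoin_range_ι]; trivial
  have hle : Algebra.adjoin K (Set.range (UniversalEnvelopingAlgebra.ι K :
      zeroPart (cartanIncl K A n) → _)) ≤ S.comap (seligmanMk A lam) := by
    refine Algebra.adjoin_le ?_
    rintro _ ⟨x, rfl⟩
    exact h1 x
  exact hle hu

end Relations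

/-! ### Commuting homomorphisms and tensor products of algebras -/

section CommutingFamily

theorem prod_ofFn_mul {S : Type*} [Monoid S] {m : ℕ} (f h : Fin m → S)
    (hc : ∀ i j, i ≠ j → Commute (f i) (h j)) :
    (List.ofFn fun i => f i * h i).prod = (List.ofFn f).prod * (List.ofFn h).prod := by
  induction m with
  | zero => simp
  | succ m ih =>
    simp only [List.ofFn_succ, List.prod_cons]
    have h1 : Commute (h 0) (List.ofFn fun i : Fin m => f i.succ).prod := by
      refine Commute.list_prod_right _ _ fun x hx => ?_
      obtain ⟨i, rfl⟩ := List.mem_ofFn.1 hx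
      exact (hc _ _ (Fin.succ_ne_zero i)).symm
    rw [ih _ _ fun i j hij => hc _ _ fun e => hij (Fin.succ_injective _ e), mul_assoc, mul_assoc,
      ← mul_assoc (h 0), h1.eq, mul_assoc]

theorem prod_ofFn_mulSingle {S : Type*} [Monoid S] {m : ℕ} (i : Fin m) (c : S) :
    (List.ofFn (Pi.mulSingle i c : Fin m → S)).prod = c := by
  induction m with
  | zero => exact i.elim0
  | succ m ih =>
    rw [List.ofFn_succ, List.prod_cons]
    cases i using Fin.cases with
    | zero =>
      have h : (fun j : Fin m => (Pi.mulSingle 0 c : Fin (m + 1) → S) j.succ) = fun _ => 1 :=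
        funext fun j => Pi.mulSingle_eq_of_ne (Fin.succ_ne_zero j) c
      rw [h, Pi.mulSingle_eq_same]
      simp
    | succ i =>
      have h : (fun j : Fin m => (Pi.mulSingle i.succ c : Fin (m + 1) → S) j.succ) =
          Pi.mulSingle i c := by
        funext j
        by_cases hij : j = i
        · subst hij
          rw [Pi.mulSingle_eq_same, Pi.mulSingle_eq_same]
        · rw [Pi.mulSingle_eq_of_ne hij,
            Pi.mulSingle_eq_of_ne fun e => hij (Fin.succ_injective _ e)]
      rw [h, ih, Pi.mulSingle_eq_of_ne (Fin.succ_ne_zero i).symm, one_mul]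

/-- The target is not commutative, so the images are multiplied in the order of the indices;
commutation across different indices makes this ordered product multiplicative. -/
theorem exists_piTensorProduct_lift {K : Type*} [CommRing K] {m : ℕ} {B : Fin m → Type*}
    [∀ i, Ring (B i)] [∀ i, Algebra K (B i)] {S : Type*} [Ring S] [Algebra K S]
    (g : ∀ i, B i →ₐ[K] S) (hg : ∀ i j, i ≠ j → ∀ a b, Commute (g i a) (g j b)) :
    ∃ G : (⨂[K] i, B i) →ₐ[K] S, ∀ i b, G (PiTensorProduct.singleAlgHom i b) = g i b := by
  let M : MultilinearMap K B S :=
    MultilinearMap.compLinearMap (MultilinearMap.mkPiAlgebraFin K m S)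
      fun i => (g i : B i →ₐ[K] S).toLinearMap
  have hM : ∀ x, M x = (List.ofFn fun i => g i (x i)).prod := fun _ => rfl
  refine ⟨PiTensorProduct.liftAlgHom M ?_ fun x y => ?_, fun i b => ?_⟩
  · rw [hM]
    simp
  · rw [hM, hM, hM, ← prod_ofFn_mul _ _ fun i j hij => hg i j hij _ _]
    simp only [Pi.mul_apply, map_mul]
  · refine (PiTensorProduct.lift.tprod _).trans ((hM _).trans ?_)
    refine Eq.trans ?_ (prod_ofFn_mulSingle i (g i b))
    congr 2
    funext j
    change g j ((Pi.mulSingle i b : ∀ j, B j) j) = _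
    by_cases hij : j = i
    · subst hij
      rw [Pi.mulSingle_eq_same, Pi.mulSingle_eq_same]
    · rw [Pi.mulSingle_eq_of_ne hij, Pi.mulSingle_eq_of_ne hij, map_one]

theorem commute_singleAlgHom {K ι : Type*} [CommRing K] [DecidableEq ι] {B : ι → Type*}
    [∀ i, Ring (B i)] [∀ i, Algebra K (B i)] {i j : ι} (hij : i ≠ j) (a : B i) (b : B j) :
    Commute (PiTensorProduct.singleAlgHom (R := K) i a) (PiTensorProduct.singleAlgHom j b) :=
  Commute.tprod (Pi.mulSingle_commute hij a b)

theorem commute_of_adjoin_eq_top {K B B' S : Type*} [CommRing K] [Ring B] [Algebra K B] [Ring B']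
    [Algebra K B'] [Ring S] [Algebra K S] {s : Set B} {s' : Set B'}
    (hs : Algebra.adjoin K s = ⊤) (hs' : Algebra.adjoin K s' = ⊤) (f : B →ₐ[K] S)
    (f' : B' →ₐ[K] S) (h : ∀ a ∈ s, ∀ b ∈ s', Commute (f a) (f' b)) (a : B) (b : B') :
    Commute (f a) (f' b) := by
  have h1 : ∀ a ∈ s, ∀ b, Commute (f a) (f' b) := by
    intro a ha b
    have hle : Algebra.adjoin K s' ≤ (Subalgebra.centralizer K {f a}).comap f' :=
      Algebra.adjoin_le fun b hb => by
        rintro _ rfl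
        exact h a ha b hb
    exact hle (hs' ▸ Algebra.mem_top) _ rfl
  have hle : Algebra.adjoin K s ≤ (Subalgebra.centralizer K {f' b}).comap f :=
    Algebra.adjoin_le fun a ha => by
      rintro _ rfl
      exact (h1 a ha b).symm
  exact (hle (hs ▸ Algebra.mem_top) _ rfl : Commute (f' b) (f a)).symm

end CommutingFamily

end SeligmanAlg

end

/-! ### The isomorphism -/

theorem theorem6p6 {K : Type*} [Field K] [CharZero K] {A : Type*} [Ring A] [Algebra K A]
    (n : ℕ) (hn : 3 ≤ n)
    (lam : Module.Dual K (SeligmanAlg.cartan K n)) (l : Fin (n - 1) → ℕ)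
    (hlam : ∀ i, lam (SeligmanAlg.coroot K i) = (l i : K))
    (hl : SeligmanAlg.TotallyDisconnectedSupport l) :
    Nonempty (SeligmanAlg.SlSeligman K A lam ≃ₐ[K] ⨂[K] i, (SeligmanAlg.factor K A l i)) := by
  choose δ hδ hδ' hlift using fun i => SeligmanAlg.exists_factorMap (K := K) (A := A) l i
  let Δ : Fin (n - 1) → A →ₗ[K] ⨂[K] i, SeligmanAlg.factor K A l i := fun i =>
    (PiTensorProduct.singleAlgHom i).toLinearMap ∘ₗ δ i
  obtain ⟨f, hf⟩ := SeligmanAlg.exists_seligmanHom hn hlam (Δ := Δ) (fun i => (hδ i).map _)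
    fun i j hij a b => SeligmanAlg.commute_singleAlgHom hij _ _
  have hf' : ∀ i b, f (SeligmanAlg.seligmanPowerSum lam i b) = Δ i b := hf
  choose g hg using fun i => hlift i _ (SeligmanAlg.isFactorMap_seligmanPowerSum (A := A) hn hlam hl i)
  have hcomm : ∀ i j, i ≠ j → ∀ a b, Commute (g i a) (g j b) := by
    intro i j hij
    refine SeligmanAlg.commute_of_adjoin_eq_top (hδ' i) (hδ' j) (g i) (g j) ?_
    rintro _ ⟨a, rfl⟩ _ ⟨b, rfl⟩
    rw [hg, hg]
    exact SeligmanAlg.commute_seligmanPowerSum hlam hl hij a b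
  obtain ⟨G, hG⟩ := SeligmanAlg.exists_piTensorProduct_lift g hcomm
  -- Both composites are compared with the identity on generators: `f` sends `seligmanPowerSum lam i
  -- b` to the copy of `δ i b` in the tensor product, and `G` sends it back.
  refine ⟨AlgEquiv.ofAlgHom f G ?_ ?_⟩
  · refine PiTensorProduct.algHom_ext fun i => AlgHom.ext_of_adjoin_eq_top (hδ' i) ?_
    rintro _ ⟨b, rfl⟩
    change f (G (PiTensorProduct.singleAlgHom i (δ i b))) =
      PiTensorProduct.singleAlgHom i (δ i b)
    rw [hG, hg, hf']
    rfl
  · refine AlgHom.ext_of_adjoin_eq_top (SeligmanAlg.adjoin_seligmanPowerSum hn hlam hl) ?_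
    intro x hx
    obtain ⟨i, b, rfl⟩ := Set.mem_iUnion.1 hx
    change G (f _) = _
    rw [hf']
    exact (hG i _).trans (hg i b)
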